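/- **Setting.** Let $\varrho(z)=\max(z,0)$, $d,N,n\in\mathbb N=\{1,2,\dots\}$, $\mathfrak B\in\{1,\dots,n\}$, $\mathcal T\in\{2,3,\dots\}$. All random variables live on a probability space $(\Omega,\mathcal F,\mathbb P)$. *Hidden weights.* $A_1,\dots,A_N$ are i.i.d. $\mathbb R^d$-valued with the multivariate $t$-distribution $t_\nu(0,\mathbb 1_d)$, i.e. with density $\frac{\Gamma((\nu+d)/2)}{\Gamma(\nu/2)\nu^{d/2}\pi^{d/2}}(1+\nu^{-1}\|x\|^2)^{-(\nu+d)/2}$; $B_1,\dots,B_N$ are i.i.d. real with a strictly positive density $\pi_{\rm b}$ of at most polynomial decay (there is a polynomial $p_{\rm b}:\mathbb R\to(0,\infty)$ with $1\le p_{\rm b}(z)\pi_{\rm b}(z)$ for all $z$) and with $\mathbb E[|B_1|^4]=\int z^4\pi_{\rm b}(z)\,dz<\infty$; $A=(A_i)_i$ and $B=(B_i)_i$ are independent. For $w\in\mathbb R^N$ put $H^{A,B}_w(x)=\sum_{i=1}^N w_i\varrho(A_i\cdot x+B_i)$. *Data.* $D_n=((X_i,Y_i))_{i\le n}$ are i.i.d.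 $\mathbb R^d\times\mathbb R$-valued and independent of $(A,B)$; $(\bar X,\bar Y)$ has the law of $(X_1,Y_1)$ and is independent of $(A,B,D_n)$. Moreover $\|X_1\|_\infty\le M$ a.s. and $\mathbb E[|Y_1|^4]<\infty$. *Target.* $H:\mathbb R^d\to\mathbb R$ is the regression function, $H(X_1)=\mathbb E[Y_1\mid X_1]$ a.s., and $H(x)=\mathbb E[\Phi(x+V)]$ for all $x$, where $\Phi\in L^1(\mathbb R^d)$ and $V$ is an $\mathbb R^d$-valued random vector with $|\mathbb E[e^{i\xi\cdot V}]|\le\exp(-C\|\xi\|^2)$ for all $\xi\in\mathbb R^d$. *SGD.* Let $\eta_0>0$, $\eta_t=\eta_0t^{-1/2}$, let $\Pi_{\mathcal V}$ be the orthogonal projection onto $\mathcal V=\{w\in\mathbb R^N:\|w\|\le\lambda\}$, let $\mathbf X^i\in\mathbb R^N$ have the components $\mathbf X^i_j=\varrho(A_j\cdot X_i+B_j)$, and let $J_{i,t}$ ($1\le i\le\mathfrak B$, $1\le t\le\mathcal T$) be i.i.d. uniform on $\{1,\dots,n\}$ and independent of $(A,B,D_n,\bar X,\bar Y)$. Put $W_1=0$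 and $$W_{t+1}=\Pi_{\mathcal V}\Big(W_t-\frac{2\eta_t}{\mathfrak B}\sum_{i=1}^{\mathfrak B}\mathbf X^{J_{i,t}}\big(W_t\cdot\mathbf X^{J_{i,t}}-Y_{J_{i,t}}\big)\Big),\qquad t=1,\dots,\mathcal T-1.$$ **Proposition.** Let $\nu>4$, $C>\frac1{2^{3/2}\pi}$, $M>0$, $\eta_0>0$, $C_{\rm lam}>0$, and let $\pi_{\rm b}$ be as above. There exist $k\in\mathbb N\cup\{0\}$ depending only on $\pi_{\rm b}$, constants $C_{\rm wgt},C_{\rm app}>0$ depending only on $\nu,\pi_{\rm b},C,M$, and constants $C_{\rm est},C_{\rm opt}>0$ depending only on $\nu,\pi_{\rm b},C,M,\mathbb E[Y_1^4],\eta_0,C_{\rm lam}$, such that in the above setting, for all $d$, $n$, $N$, $\mathfrak B$, $\mathcal T$, all $p\ge0$ and all $\lambda$ with $$\frac{C_{\rm wgt}\|\Phi\|_{L^1(\mathbb R^d)}(\nu+d)^{2k+\frac12}}{\sqrt N}\le\lambda\le\frac{C_{\rm lam}d^p}{\sqrt N},$$ the prediction error is square integrable and $$\mathbb E\big[|H(\bar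 X)-H^{A,B}_{W_{\mathcal T}}(\bar X)|^2\big]^{1/2}\le\frac{C_{\rm app}\|\Phi\|_{L^1(\mathbb R^d)}(\nu+d)^{k+3}}{\sqrt N}+\frac{C_{\rm est}d^{p+1}}{n^{1/4}}+\frac{C_{\rm opt}d^{p+2}N(2+\log\mathcal T)^{1/2}}{\mathcal T^{1/4}}.$$ -/

import Mathlib

open MeasureTheory ProbabilityTheory

/-- `ℝ^m` with the Euclidean norm. -/
abbrev RVec (m : ℕ) : Type := EuclideanSpace ℝ (Fin m)

/-- The multivariate `t`-distribution `t_ν(0, 1_d)` on `ℝ^d`, given by its Lebesgue density. -/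
noncomputable def multivariateT (ν : ℝ) (d : ℕ) : Measure (RVec d) :=
  volume.withDensity fun x => ENNReal.ofReal
    (Real.Gamma ((ν + d) / 2) /
        (Real.Gamma (ν / 2) * ν ^ ((d : ℝ) / 2) * Real.pi ^ ((d : ℝ) / 2)) *
      (1 + ‖x‖ ^ 2 / ν) ^ (-((ν + d) / 2)))

/-- `π_b` is a probability density on `ℝ` with at most polynomial decay: `1 ≤ p_b π_b` for some
strictly positive polynomial `p_b`. -/
structure IsPolyDecayDensity (πb : ℝ → ℝ) : Prop where
  measurable : Measurable πb
  pos : ∀ z, 0 < πb z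
  lintegral_eq_one : ∫⁻ z, ENNReal.ofReal (πb z) = 1
  poly : ∃ pb : Polynomial ℝ, ∀ z : ℝ, 0 < pb.eval z ∧ 1 ≤ pb.eval z * πb z

/-- The ReLU activation function. -/
noncomputable def relu (z : ℝ) : ℝ := max z 0

/-- The vector of hidden-layer outputs `(ϱ(a_j · x + b_j))_j`. -/
noncomputable def features {d N : ℕ} (a : Fin N → RVec d) (b : Fin N → ℝ) (x : RVec d) : RVec N :=
  WithLp.toLp 2 fun j => relu (inner ℝ (a j) x + b j)

/-- The network `H^{a,b}_w(x) = ∑ w_j ϱ(a_j · x + b_j)`. -/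
noncomputable def network {d N : ℕ} (a : Fin N → RVec d) (b : Fin N → ℝ) (w : RVec N)
    (x : RVec d) : ℝ :=
  ∑ j, w j * relu (inner ℝ (a j) x + b j)

/-- Orthogonal projection of `ℝ^N` onto the closed ball of radius `r` around the origin. -/
noncomputable def projBall {N : ℕ} (r : ℝ) (w : RVec N) : RVec N :=
  if ‖w‖ ≤ r then w else (r / ‖w‖) • w

theorem norm_projBall_le {N : ℕ} {r : ℝ} (hr : 0 ≤ r) (w : RVec N) : ‖projBall r w‖ ≤ r := by
  unfold projBall
  split_ifs with h
  · exact h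
  · have hw : 0 < ‖w‖ := lt_of_le_of_lt hr (not_le.mp h)
    rw [norm_smul, Real.norm_eq_abs, abs_of_nonneg (by positivity), div_mul_cancel₀ _ hw.ne']

/-- `projBall r w` is the nearest point to `w` in the ball. -/
theorem norm_sub_projBall_le {N : ℕ} {r : ℝ} (hr : 0 ≤ r) (w v : RVec N) (hv : ‖v‖ ≤ r) :
    ‖w - projBall r w‖ ≤ ‖w - v‖ := by
  unfold projBall
  split_ifs with h
  · simp
  · have h' := not_le.mp h
    have hw : 0 < ‖w‖ := lt_of_le_of_lt hr h'
    have h1 : w - (r / ‖w‖) • w = (1 - r / ‖w‖) • w := by rw [sub_smul, one_smul]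
    have h2 : 0 ≤ 1 - r / ‖w‖ := by
      rw [sub_nonneg, div_le_one hw]
      exact h'.le
    have h3 : (1 - r / ‖w‖) * ‖w‖ = ‖w‖ - r := by field_simp
    rw [h1, norm_smul, Real.norm_eq_abs, abs_of_nonneg h2, h3]
    linarith [norm_sub_norm_le w v]

/-- The projected mini-batch SGD iterates `W_t` with step size `η_t = η₀ t^{-1/2}` for the
empirical squared loss of the data `(x_i, y_i)`, where `j t i` is the `i`-th index of the batch
used at time `t`. The iteration starts at time `1` (`W_1 = 0`); the value at `0` is a dummy. -/
noncomputable def sgdIterate {d N n 𝔅 : ℕ} (η₀ lam : ℝ) (a : Fin N → RVec d) (b : Fin N → ℝ)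
    (x : Fin n → RVec d) (y : Fin n → ℝ) (j : ℕ → Fin 𝔅 → Fin n) : ℕ → RVec N
  | 0 => 0
  | 1 => 0
  | (s + 2) =>
    let t : ℕ := s + 1
    let w : RVec N := sgdIterate η₀ lam a b x y j (s + 1)
    let η : ℝ := η₀ * (t : ℝ) ^ (-(1 / 2) : ℝ)
    projBall lam (w - (2 * η / (𝔅 : ℝ)) •
      ∑ i : Fin 𝔅, (inner ℝ w (features a b (x (j t i))) - y (j t i)) • features a b (x (j t i)))

section Setting

variable {Ω : Type*} [MeasurableSpace Ω]

/-- The hidden weights: `A_1, …, A_N` i.i.d. with law `t_ν(0, 1_d)`, `B_1, …, B_N` i.i.d. with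
density `π_b`, and `A = (A_1, …, A_N)` independent of `B = (B_1, …, B_N)`. -/
structure IsHiddenWeights {d N : ℕ} (P : Measure Ω) (ν : ℝ) (πb : ℝ → ℝ)
    (A : Fin N → Ω → RVec d) (B : Fin N → Ω → ℝ) : Prop where
  measurable_A : ∀ i, Measurable (A i)
  measurable_B : ∀ i, Measurable (B i)
  law_A : ∀ i, P.map (A i) = multivariateT ν d
  law_B : ∀ i, P.map (B i) = volume.withDensity fun z => ENNReal.ofReal (πb z)
  iIndep_A : iIndepFun A P
  iIndep_B : iIndepFun B P
  indep_A_B : IndepFun (fun ω i => A i ω) (fun ω i => B i ω) P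

/-- The data `D_n = ((X_1, Y_1), …, (X_n, Y_n))` is i.i.d. and independent of `(A, B)`; the test
pair `(X̄, Ȳ)` has the law of `(X_1, Y_1)` and is independent of `(A, B, D_n)`. -/
structure IsLearningData {d N n : ℕ} (P : Measure Ω)
    (A : Fin N → Ω → RVec d) (B : Fin N → Ω → ℝ)
    (X : Fin n → Ω → RVec d) (Y : Fin n → Ω → ℝ) (Xbar : Ω → RVec d) (Ybar : Ω → ℝ) : Prop where
  measurable_X : ∀ i, Measurable (X i)
  measurable_Y : ∀ i, Measurable (Y i)
  measurable_Xbar : Measurable Xbar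
  measurable_Ybar : Measurable Ybar
  iIndep : iIndepFun (fun i ω => (X i ω, Y i ω)) P
  identDistrib : ∀ i, IdentDistrib (fun ω => (X i ω, Y i ω)) (fun ω => (Xbar ω, Ybar ω)) P P
  indep_weights : IndepFun (fun ω => ((fun i => A i ω), (fun i => B i ω)))
    (fun ω i => (X i ω, Y i ω)) P
  indep_test : IndepFun (fun ω => (Xbar ω, Ybar ω))
    (fun ω => ((fun i => A i ω), (fun i => B i ω), (fun i => (X i ω, Y i ω)))) P

/-- The batch indices `J_{i,t}`, `1 ≤ i ≤ 𝔅`, `1 ≤ t ≤ 𝒯`, are i.i.d. uniform on the `n` data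
indices and jointly independent of `(A, B, D_n, X̄, Ȳ)`. Nothing is required of `J t` for `t`
outside `{1, …, 𝒯}`. -/
structure IsBatchIndices {d N n 𝔅 : ℕ} (P : Measure Ω) (𝒯 : ℕ)
    (A : Fin N → Ω → RVec d) (B : Fin N → Ω → ℝ)
    (X : Fin n → Ω → RVec d) (Y : Fin n → Ω → ℝ) (Xbar : Ω → RVec d) (Ybar : Ω → ℝ)
    (J : ℕ → Fin 𝔅 → Ω → Fin n) : Prop where
  measurable : ∀ t ∈ Finset.Icc 1 𝒯, ∀ i, Measurable (J t i)
  uniform : ∀ t ∈ Finset.Icc 1 𝒯, ∀ i r, P.real {ω | J t i ω = r} = 1 / (n : ℝ)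
  iIndep : iIndepFun (fun (q : Fin 𝔅 × Finset.Icc 1 𝒯) ω => J q.2 q.1 ω) P
  indep : IndepFun (fun ω (q : Fin 𝔅 × Finset.Icc 1 𝒯) => J q.2 q.1 ω)
    (fun ω => (((fun i => A i ω), (fun i => B i ω), (fun i => (X i ω, Y i ω))),
      (Xbar ω, Ybar ω))) P

end Setting

/-!
# Learning with random features by projected stochastic gradient descent

The mean square prediction error of the trained network is split into three parts.

*Approximation.* Since the characteristic function of `V` has Gaussian decay, Fourier inversion
turns `H(x) = E[Φ(x + V)]` into `∫ h(a) exp(i a · x) da` with `h` dominated by a Gaussian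
(`exists_fourier_representation`). On a bounded interval `exp(i ·)` is a superposition of shifted
ReLUs with a bounded, compactly supported kernel (`integral_reluKernel_mul_relu`). Dividing by the
density of a random neuron gives `H(x) = E[f(A₁, B₁) ϱ(A₁ · x + B₁)]` on the cube with a *bounded*
`f`: the tails of the `t`-distribution and of `π_b` are polynomial, and the lower bound on `C`
makes the quotient of the Gaussian by the normalized `t`-density grow at most linearly
in the dimension (`exists_random_feature_representation`, `exp_div_tDensity_le`). The output
weights `v_i = f(A_i, B_i) / N` have norm of order `N^{-1/2}`, so that the lower bound on the
projection radius puts them into the ball, and their error is that of a Monte Carlo mean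
(`lintegral_oracle_error_le`).

*Optimization.* For fixed hidden weights and data, the last iterate of projected SGD is compared
with `v` in empirical risk. The regret inequality for the comparators `W_s`, `s < T`, and `v`,
together with a harmonic summation, bounds the last iterate rather than an average of iterates, at
the cost of the logarithm (`sgd_last_iterate`, `expect_sgdIterate_sub_le`).

*Generalization.* On the ball, the difference of population and empirical risk is linear in the
deviations of the empirical second moments of features and response, whose mean squares are
`O(1/n)` (`loss_gap_le`, `integral_pi_expect_sub_sq_le`). As `H` is the regression function, the
excess risk of a network is its squared `L²` distance from `H` (`integral_sq_sub_eq_excess`), which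
yields the oracle inequality `lintegral_excess_fixed_features_le`.

Finally the bound is averaged over the hidden weights, whose fourth moments grow polynomially in
`d` (`exists_moment_neuronBound`), and transferred to the original probability space by
independence (`lintegral_prediction_error_le`). Working with nonnegative integrals throughout gives
square integrability of the error along with the bound.
-/

/-! ### Ridge representation of complex exponentials -/

/-- Kernel representing `z ↦ exp (i z)` on `[-R, R]` as a superposition of shifted ReLUs. On
`[-R, R]` it is the second derivative of `exp (i ·)` at `-b`; the affine part on `(R, R + 1]`
creates the value and the slope of `exp (i ·)` at `-R`. -/
noncomputable def reluKernel (R b : ℝ) : ℂ :=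
  if |b| ≤ R then -Complex.exp (-(b * Complex.I))
  else if R < b ∧ b ≤ R + 1 then
    Complex.exp (-(R * Complex.I)) *
      ((4 * Complex.I - 6) + (12 - 6 * Complex.I) * (b - R))
  else 0

theorem measurable_reluKernel : Measurable fun p : ℝ × ℝ => reluKernel p.1 p.2 := by
  unfold reluKernel
  refine Measurable.ite (measurableSet_le (by fun_prop) (by fun_prop)) (by fun_prop)
    (Measurable.ite ?_ (by fun_prop) (by fun_prop))
  exact (measurableSet_lt measurable_fst measurable_snd).inter
    (measurableSet_le measurable_snd (measurable_fst.add_const 1))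

theorem norm_reluKernel_le (R b : ℝ) : ‖reluKernel R b‖ ≤ 28 := by
  unfold reluKernel
  have h1 : ∀ x : ℝ, ‖Complex.exp (-(x * Complex.I))‖ = 1 := fun x => by
    have := Complex.norm_exp_ofReal_mul_I (-x)
    simpa using this
  split_ifs with h h'
  · rw [norm_neg, h1]; norm_num
  · rw [norm_mul, h1, one_mul]
    have h2 : ‖(b - R : ℂ)‖ ≤ 1 := by
      rw [← Complex.ofReal_sub, Complex.norm_real, Real.norm_eq_abs, abs_le]
      constructor <;> linarith [h'.1, h'.2]
    calc _ ≤ ‖(4 * Complex.I - 6 : ℂ)‖ + ‖(12 - 6 * Complex.I : ℂ)‖ * ‖(b - R : ℂ)‖ := by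
          rw [← norm_mul]; exact norm_add_le _ _
      _ ≤ (4 + 6) + (12 + 6) * 1 := by
          gcongr
          · refine (norm_sub_le _ _).trans ?_
            simp
          · refine (norm_sub_le _ _).trans ?_
            simp
      _ = 28 := by norm_num
  · simp

theorem reluKernel_eq_zero {R b : ℝ} (hR : 0 ≤ R) (hb : R + 1 < |b|) : reluKernel R b = 0 := by
  unfold reluKernel
  rw [if_neg (by linarith), if_neg]
  rintro ⟨h1, h2⟩
  rw [abs_of_nonneg (by linarith)] at hb
  linarith

theorem relu_nonneg (z : ℝ) : 0 ≤ relu z := le_max_right _ _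

theorem relu_le_abs (z : ℝ) : relu z ≤ |z| := max_le (le_abs_self z) (abs_nonneg z)

@[fun_prop]
theorem continuous_relu : Continuous relu := by unfold relu; fun_prop

@[fun_prop]
theorem measurable_relu : Measurable relu := continuous_relu.measurable

theorem integral_reluKernel_mul_relu {R z : ℝ} (hz : |z| ≤ R) :
    ∫ b : ℝ, reluKernel R b * (relu (z + b) : ℂ) = Complex.exp (z * Complex.I) := by
  have hz1 := (abs_le.1 hz).1
  have hz2 := (abs_le.1 hz).2
  have hR : 0 ≤ R := (abs_nonneg z).trans hz
  -- The integrand vanishes outside `(-z, R + 1]`.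
  have h0 : ∫ b : ℝ, reluKernel R b * (relu (z + b) : ℂ)
      = ∫ b in (-z)..(R + 1), reluKernel R b * (relu (z + b) : ℂ) := by
    rw [intervalIntegral.integral_of_le (by linarith),
      setIntegral_eq_integral_of_forall_compl_eq_zero]
    intro b hb
    rw [Set.mem_Ioc, not_and_or, not_lt, not_le] at hb
    rcases hb with hb | hb
    · have : relu (z + b) = 0 := max_eq_right (by linarith)
      simp [this]
    · rw [reluKernel_eq_zero hR (hb.trans_le (le_abs_self b)), zero_mul]
  have c1 : ∀ b ∈ Set.uIcc (-z) R, reluKernel R b * (relu (z + b) : ℂ)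
      = -Complex.exp (-(b * Complex.I)) * (z + b) := by
    intro b hb
    rw [Set.uIcc_of_le (by linarith)] at hb
    have : relu (z + b) = z + b := max_eq_left (by linarith [hb.1])
    rw [reluKernel, if_pos (abs_le.2 ⟨by linarith [hb.1], hb.2⟩), this]
    push_cast; ring
  have c2 : ∀ b ∈ Set.uIoc R (R + 1), reluKernel R b * (relu (z + b) : ℂ)
      = Complex.exp (-(R * Complex.I)) *
      ((4 * Complex.I - 6) + (12 - 6 * Complex.I) * (b - R)) * (z + b) := by
    intro b hb
    rw [Set.uIoc_of_le (by linarith)] at hb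
    have : relu (z + b) = z + b := max_eq_left (by linarith [hb.1])
    rw [reluKernel, if_neg (by rw [abs_of_nonneg (by linarith [hb.1])]; linarith [hb.1]),
      if_pos ⟨hb.1, hb.2⟩, this]
    push_cast; ring
  have i1 : IntervalIntegrable (fun b : ℝ => reluKernel R b * (relu (z + b) : ℂ)) volume (-z) R :=
    (IntervalIntegrable.congr (fun b hb => (c1 b (Set.uIoc_subset_uIcc hb)).symm)
      (Continuous.intervalIntegrable (by fun_prop) _ _))
  have i2 : IntervalIntegrable (fun b : ℝ => reluKernel R b * (relu (z + b) : ℂ)) volume R (R + 1) :=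
    (IntervalIntegrable.congr (fun b hb => (c2 b hb).symm)
      (Continuous.intervalIntegrable (by fun_prop) _ _))
  rw [h0, ← intervalIntegral.integral_add_adjacent_intervals i1 i2,
    intervalIntegral.integral_congr c1, intervalIntegral.integral_congr_ae (.of_forall c2)]
  have d0 : ∀ b : ℝ, HasDerivAt (fun b : ℝ => (b : ℂ)) 1 b := fun b => Complex.ofRealCLM.hasDerivAt
  have e1 : ∫ b in (-z)..R, -Complex.exp (-(b * Complex.I)) * (z + b : ℂ)
      = (Complex.exp (-(R * Complex.I)) * (-Complex.I * (z + R) - 1))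
        - Complex.exp (-(((-z : ℝ) : ℂ) * Complex.I)) * (-Complex.I * (z + ((-z : ℝ) : ℂ)) - 1) := by
    refine intervalIntegral.integral_eq_sub_of_hasDerivAt
      (f := fun b : ℝ => Complex.exp (-(b * Complex.I)) * (-Complex.I * (z + b) - 1)) ?_
      (Continuous.intervalIntegrable (by fun_prop) _ _)
    intro b _
    have := (((d0 b).mul_const Complex.I).neg.cexp).mul
      ((((d0 b).const_add (z : ℂ)).const_mul (-Complex.I)).sub_const 1)
    convert! this using 1
    linear_combination (-Complex.exp (-(b * Complex.I)) * (z + b)) * (Complex.I_sq)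
  -- The coefficients `4i - 6` and `12 - 6i` solve the two linear equations that make this integral
  -- the first order Taylor polynomial of `exp (i ·)` at `-R`.
  have e2 : ∫ b in R..(R + 1), Complex.exp (-(R * Complex.I)) *
      ((4 * Complex.I - 6) + (12 - 6 * Complex.I) * (b - R)) * (z + b : ℂ)
      = Complex.exp (-(R * Complex.I)) * (1 + Complex.I * (z + R)) := by
    have := intervalIntegral.integral_eq_sub_of_hasDerivAt (a := R) (b := R + 1)
      (f := fun b : ℝ => Complex.exp (-(R * Complex.I)) *
        ((4 * Complex.I - 6) * ((z + R) * (b - R) + (b - R) ^ 2 / 2)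
          + (12 - 6 * Complex.I) * ((z + R) * ((b - R) ^ 2 / 2) + (b - R) ^ 3 / 3)))
      (f' := fun b : ℝ => Complex.exp (-(R * Complex.I)) *
        ((4 * Complex.I - 6) + (12 - 6 * Complex.I) * (b - R)) * (z + b : ℂ)) ?_
      (Continuous.intervalIntegrable (by fun_prop) _ _)
    · rw [this]; push_cast; ring
    intro b _
    have hb := (d0 b).sub_const (R : ℂ)
    have := ((((hb.const_mul (z + R : ℂ)).add ((hb.pow 2).div_const 2)).const_mul
      (4 * Complex.I - 6)).add ((((((hb.pow 2).div_const 2)).const_mul (z + R : ℂ)).add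
        ((hb.pow 3).div_const 3)).const_mul (12 - 6 * Complex.I))).const_mul
        (Complex.exp (-(R * Complex.I)))
    convert! this using 1
    push_cast
    ring
  rw [e1, e2]
  push_cast
  ring_nf

/-! ### Fourier inversion for measures with integrable characteristic function -/

open FourierTransform in
/-- Parseval's identity pairing a finite measure with an integrable function. -/
theorem integral_fourier_measure {d : ℕ} (μ : Measure (RVec d)) [IsFiniteMeasure μ]
    {g : RVec d → ℂ} (hg : Integrable g) :
    ∫ v, 𝓕 g v ∂μ = ∫ ξ, charFun μ (-(2 * Real.pi) • ξ) * g ξ := by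
  have := VectorFourier.integral_fourierIntegral_smul_eq_flip (μ := μ) (ν := volume)
    (L := innerₗ (RVec d)) (f := fun _ => (1 : ℂ)) (g := g) Real.continuous_fourierChar
    continuous_inner (integrable_const _) hg
  simp only [smul_eq_mul] at this
  rw [flip_innerₗ] at this
  refine Eq.trans ?_ (this.symm.trans ?_)
  · simp only [one_mul]
    rfl
  · congr 1; ext ξ
    congr 1
    rw [charFun_apply, VectorFourier.fourierIntegral]
    congr 1; ext v
    rw [Circle.smul_def, Real.fourierChar_apply]
    simp only [innerₗ_apply_apply, inner_smul_right, smul_eq_mul, mul_one]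
    congr 1; push_cast; ring

open FourierTransform in
theorem integral_fourier_mul_eq_flip {d : ℕ} {f g : RVec d → ℂ} (hf : Integrable f)
    (hg : Integrable g) : ∫ ξ, 𝓕 f ξ * g ξ = ∫ x, f x * 𝓕 g x := by
  have := VectorFourier.integral_fourierIntegral_smul_eq_flip (μ := volume) (ν := volume)
    (L := innerₗ (RVec d)) (f := f) (g := g) Real.continuous_fourierChar
    continuous_inner hf hg
  rw [flip_innerₗ] at this
  exact this

open FourierTransform in
/-- Against smooth compactly supported functions, `μ` integrates like the continuous function
obtained from its characteristic function by Fourier inversion. -/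
theorem integral_contDiff_eq_integral_mul_fourier {d : ℕ} (μ : Measure (RVec d))
    [IsFiniteMeasure μ] (hμ : Integrable fun ξ : RVec d => charFun μ ((2 * Real.pi) • ξ))
    {f : RVec d → ℂ} (hf : ContDiff ℝ (⊤ : ℕ∞) f) (hc : HasCompactSupport f) :
    ∫ v, f v ∂μ = ∫ v, f v * 𝓕 (fun ξ => charFun μ ((2 * Real.pi) • ξ)) v := by
  set F : SchwartzMap (RVec d) ℂ := hc.toSchwartzMap hf with hF
  have hFf : (F : RVec d → ℂ) = f := by ext; simp [hF]
  have h1 : 𝓕 (fun ξ => 𝓕 f (-ξ)) = f := by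
    have : (fun ξ => 𝓕 f (-ξ)) = 𝓕⁻ f := by ext ξ; rw [Real.fourierInv_eq_fourier_neg]
    rw [this]
    have h2 : ((𝓕 (𝓕⁻ F) : SchwartzMap (RVec d) ℂ) : RVec d → ℂ) = F := by
      rw [FourierTransform.fourier_fourierInv_eq]
    rwa [SchwartzMap.fourier_coe, SchwartzMap.fourierInv_coe, hFf] at h2
  have hi : Integrable (𝓕 f) := by
    rw [← hFf, ← SchwartzMap.fourier_coe]; exact (𝓕 F).integrable
  rw [← integral_fourier_mul_eq_flip (hFf ▸ F.integrable) hμ]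
  conv_lhs => rw [← h1]
  rw [integral_fourier_measure μ hi.comp_neg, ← integral_neg_eq_self]
  congr 1; ext ξ
  simp [mul_comm]

open FourierTransform in
theorem norm_fourier_le {d : ℕ} (q : RVec d → ℂ) (v : RVec d) : ‖𝓕 q v‖ ≤ ∫ ξ, ‖q ξ‖ :=
  VectorFourier.norm_fourierIntegral_le_integral_norm _ _ _ _ _

/-- A finite measure with integrable characteristic function has a bounded density; the bound on
open sets comes from testing with smooth bump functions. -/
theorem absolutelyContinuous_of_integrable_charFun {d : ℕ} (μ : Measure (RVec d))
    [IsFiniteMeasure μ] (hμ : Integrable fun ξ : RVec d => charFun μ ((2 * Real.pi) • ξ)) :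
    μ ≪ volume := by
  set K : ℝ := ∫ ξ : RVec d, ‖charFun μ ((2 * Real.pi) • ξ)‖ with hK
  have hK0 : 0 ≤ K := integral_nonneg fun _ => norm_nonneg _
  -- A bump function that is `1` on the compact set `S` and supported in `U` bounds `μ S`.
  have hcomp : ∀ U : Set (RVec d), IsOpen U → ∀ S ⊆ U, IsCompact S →
      μ S ≤ ENNReal.ofReal K * volume U := by
    intro U hU S hSU hS
    obtain ⟨δ, δpos, hδ⟩ := hS.exists_isCompact_cthickening
    obtain ⟨r, rpos, hr⟩ := hS.exists_thickening_subset_open hU hSU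
    set T := Metric.thickening (min δ r) S with hT
    have hTU : T ⊆ U := (Metric.thickening_mono (min_le_right _ _) _).trans hr
    have hTc : closure T ⊆ Metric.cthickening δ S :=
      (Metric.closure_thickening_subset_cthickening _ _).trans
        (Metric.cthickening_mono (min_le_left _ _) _)
    obtain ⟨g, g_smooth, g_range, g_supp, hg⟩ :=
      exists_contMDiff_support_eq_eq_one_iff (n := (⊤ : ℕ∞)) (modelWithCornersSelf ℝ (RVec d))
        (Metric.isOpen_thickening (δ := min δ r) (E := S)) hS.isClosed
        (Metric.self_subset_thickening (lt_min δpos rpos) S)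
    have gc : HasCompactSupport g := by
      rw [HasCompactSupport, tsupport, g_supp]
      exact hδ.of_isClosed_subset isClosed_closure hTc
    have g0 : ∀ x, 0 ≤ g x := fun x => (g_range (Set.mem_range_self x)).1
    have g1 : ∀ x, g x ≤ 1 := fun x => (g_range (Set.mem_range_self x)).2
    have gcont : Continuous g := g_smooth.contDiff.continuous
    have hTfin : volume T ≠ ⊤ :=
      ((measure_mono (subset_closure.trans hTc)).trans_lt hδ.measure_lt_top).ne
    have key : ∫ v, g v ∂μ ≤ K * (volume T).toReal := by
      have h1 := integral_contDiff_eq_integral_mul_fourier μ hμ (f := fun v => (g v : ℂ))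
        (Complex.ofRealCLM.contDiff.comp g_smooth.contDiff)
        (gc.comp_left (g := fun x : ℝ => (x : ℂ)) (by simp))
      rw [integral_complex_ofReal] at h1
      have h2 : ‖((∫ v, g v ∂μ : ℝ) : ℂ)‖ ≤ K * (volume T).toReal := by
        rw [h1]
        have : ∀ v, ‖(g v : ℂ) * FourierTransform.fourier
            (fun ξ : RVec d => charFun μ ((2 * Real.pi) • ξ)) v‖ ≤ T.indicator (fun _ => K) v := by
          intro v
          by_cases hv : v ∈ T
          · rw [Set.indicator_of_mem hv, norm_mul, Complex.norm_real, Real.norm_of_nonneg (g0 v)]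
            calc _ ≤ 1 * K := by
                  gcongr
                  · exact g1 v
                  · exact norm_fourier_le _ _
              _ = K := one_mul _
          · have : g v = 0 := by
              rw [← Function.notMem_support, g_supp]; exact hv
            simp [this, Set.indicator_of_notMem hv]
        have hmT : MeasurableSet T := Metric.isOpen_thickening.measurableSet
        calc _ ≤ ∫ v, T.indicator (fun _ => K) v := by
              refine norm_integral_le_of_norm_le ?_ (.of_forall this)
              rw [integrable_indicator_iff hmT]
              exact integrableOn_const hTfin
          _ = _ := by
              rw [integral_indicator hmT, setIntegral_const, smul_eq_mul, mul_comm]; rfl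
      rw [Complex.norm_real] at h2
      exact (le_abs_self _).trans h2
    calc μ S = ∫⁻ v in S, 1 ∂μ := by simp
      _ ≤ ∫⁻ v, ENNReal.ofReal (g v) ∂μ := by
          rw [← lintegral_indicator hS.measurableSet]
          refine lintegral_mono fun v => ?_
          by_cases hv : v ∈ S
          · simp [hv, (hg v).1 hv]
          · simp [hv]
      _ = ENNReal.ofReal (∫ v, g v ∂μ) :=
          (ofReal_integral_eq_lintegral_ofReal
            ⟨gcont.aestronglyMeasurable, HasFiniteIntegral.of_bounded (C := 1)
              (.of_forall fun v => by rw [Real.norm_of_nonneg (g0 v)]; exact g1 v)⟩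
            (.of_forall g0)).symm
      _ ≤ ENNReal.ofReal (K * (volume T).toReal) := ENNReal.ofReal_le_ofReal key
      _ = ENNReal.ofReal K * volume T := by
          rw [ENNReal.ofReal_mul hK0, ENNReal.ofReal_toReal hTfin]
      _ ≤ _ := by gcongr
  have hopen : ∀ U : Set (RVec d), IsOpen U → μ U ≤ ENNReal.ofReal K * volume U := by
    intro U hU
    rw [hU.measure_eq_iSup_isCompact]
    exact iSup₂_le fun S hS => iSup_le fun hSc => hcomp U hU S hS hSc
  -- Outer regularity of Lebesgue measure passes from open sets to null sets.
  intro s hs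
  rw [← nonpos_iff_eq_zero]
  refine le_of_forall_pos_le_add fun ε hε => ?_
  have hε' : (0 : ENNReal) < ε / (ENNReal.ofReal K + 1) :=
    ENNReal.div_pos hε.ne' (by simp)
  obtain ⟨U, hsU, hU, hlt⟩ := Set.exists_isOpen_lt_of_lt s _ (hs.trans_lt hε')
  calc μ s ≤ μ U := measure_mono hsU
    _ ≤ ENNReal.ofReal K * volume U := hopen U hU
    _ ≤ (ENNReal.ofReal K + 1) * (ε / (ENNReal.ofReal K + 1)) := by
        gcongr; exact le_self_add
    _ ≤ 0 + ε := by rw [zero_add]; exact ENNReal.mul_div_le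

open FourierTransform in
/-- The Fourier transform of the rescaled characteristic function is the density of `μ`. No
regularity of `f` is needed, as both sides integrate `f` against the same density. -/
theorem integral_eq_integral_mul_fourier {d : ℕ} (μ : Measure (RVec d))
    [IsFiniteMeasure μ] (hμ : Integrable fun ξ : RVec d => charFun μ ((2 * Real.pi) • ξ))
    (f : RVec d → ℂ) :
    ∫ v, f v ∂μ = ∫ v, f v * 𝓕 (fun ξ => charFun μ ((2 * Real.pi) • ξ)) v := by
  have hac := absolutelyContinuous_of_integrable_charFun μ hμ
  have hae : ∀ᵐ v, (((μ.rnDeriv volume v).toReal : ℝ) : ℂ)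
      = 𝓕 (fun ξ => charFun μ ((2 * Real.pi) • ξ)) v := by
    refine ae_eq_of_integral_contDiff_smul_eq (μ := volume) ?_ ?_ ?_
    · exact (Measure.integrable_toReal_rnDeriv.ofReal).locallyIntegrable
    · refine Continuous.locallyIntegrable ?_
      exact VectorFourier.fourierIntegral_continuous Real.continuous_fourierChar
        continuous_inner hμ
    · intro g hg hgc
      have h1 := integral_contDiff_eq_integral_mul_fourier μ hμ (f := fun v => (g v : ℂ))
        (Complex.ofRealCLM.contDiff.comp hg)
        (hgc.comp_left (g := fun x : ℝ => (x : ℂ)) (by simp))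
      rw [← integral_rnDeriv_smul hac] at h1
      simp only [Complex.real_smul] at h1 ⊢
      rw [← h1]
      simp_rw [mul_comm]
  rw [← integral_rnDeriv_smul hac]
  refine integral_congr_ae ?_
  filter_upwards [hae] with v hv
  rw [← hv, Complex.real_smul, mul_comm]

theorem integrable_exp_neg_mul_norm_sq {d : ℕ} {C : ℝ} (hC : 0 < C) :
    Integrable fun ξ : RVec d => Real.exp (-C * ‖ξ‖ ^ 2) := by
  have := (GaussianFourier.integrable_cexp_neg_mul_sq_norm_add (V := RVec d) (b := (C : ℂ))
    (by simpa using hC) 0 0).re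
  refine this.congr (.of_forall fun ξ => ?_)
  simp only [zero_mul, add_zero]
  rw [show (-(C : ℂ) * (‖ξ‖ : ℂ) ^ 2) = ((-C * ‖ξ‖ ^ 2 : ℝ) : ℂ) by push_cast; ring,
    ← Complex.ofReal_exp]
  exact Complex.ofReal_re _

/-- A characteristic function with Gaussian decay is integrable. -/
theorem integrable_charFun_of_norm_le {d : ℕ} (μ : Measure (RVec d)) [IsFiniteMeasure μ]
    {C : ℝ} (hC : 0 < C) (hμ : ∀ ξ, ‖charFun μ ξ‖ ≤ Real.exp (-C * ‖ξ‖ ^ 2)) :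
    Integrable fun ξ : RVec d => charFun μ ((2 * Real.pi) • ξ) := by
  have hpi : 0 < 2 * Real.pi := by positivity
  have hcont : Continuous (charFun μ) := continuous_charFun
  have hint : Integrable (charFun μ) :=
    (integrable_exp_neg_mul_norm_sq hC).mono' hcont.aestronglyMeasurable (.of_forall hμ)
  exact hint.comp_smul hpi.ne'

open FourierTransform in
/-- **Fourier representation of `x ↦ E[Φ(x + V)]`**: for integrable `Φ` and a random vector whose
characteristic function has Gaussian decay, this function is the inverse Fourier transform of a
continuous function with the same decay. -/
theorem exists_fourier_representation {d : ℕ} (μ : Measure (RVec d)) [IsProbabilityMeasure μ]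
    {C : ℝ} (hC : 0 < C) (hμ : ∀ ξ, ‖charFun μ ξ‖ ≤ Real.exp (-C * ‖ξ‖ ^ 2)) {Φ : RVec d → ℝ}
    (hΦ : Integrable Φ) :
    ∃ h : RVec d → ℂ, Continuous h ∧ Integrable h ∧
      (∀ a, ‖h a‖ ≤ ((2 * Real.pi) ^ d)⁻¹ * (∫ x, |Φ x|) * Real.exp (-C * ‖a‖ ^ 2)) ∧
      ∀ x, ((∫ v, Φ (x + v) ∂μ : ℝ) : ℂ)
        = ∫ a, h a * Complex.exp ((inner ℝ a x : ℝ) * Complex.I) := by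
  have hpi : 0 < 2 * Real.pi := by positivity
  have hcont : Continuous (charFun μ) := continuous_charFun
  have hgauss := integrable_exp_neg_mul_norm_sq (d := d) hC
  have hq := integrable_charFun_of_norm_le μ hC hμ
  have hΦc : Integrable fun x => (Φ x : ℂ) := hΦ.ofReal
  have hFcont : Continuous (𝓕 fun x => (Φ x : ℂ)) :=
    VectorFourier.fourierIntegral_continuous Real.continuous_fourierChar
        continuous_inner hΦc
  have hbound : ∀ a, ‖(((2 * Real.pi) ^ d : ℝ)⁻¹ : ℂ) *
      (charFun μ a * 𝓕 (fun x => (Φ x : ℂ)) ((2 * Real.pi)⁻¹ • a))‖ ≤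
      ((2 * Real.pi) ^ d)⁻¹ * (∫ x, |Φ x|) * Real.exp (-C * ‖a‖ ^ 2) := by
    intro a
    have h1 : ‖𝓕 (fun x => (Φ x : ℂ)) ((2 * Real.pi)⁻¹ • a)‖ ≤ ∫ x, |Φ x| := by
      simpa using norm_fourier_le (fun x => (Φ x : ℂ)) ((2 * Real.pi)⁻¹ • a)
    rw [norm_mul, norm_mul, norm_inv, Complex.norm_real, Real.norm_of_nonneg (by positivity),
      mul_assoc, mul_comm (∫ x, |Φ x|)]
    gcongr
    exact hμ a
  have hcont' : Continuous fun a => (((2 * Real.pi) ^ d : ℝ)⁻¹ : ℂ) *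
      (charFun μ a * 𝓕 (fun x => (Φ x : ℂ)) ((2 * Real.pi)⁻¹ • a)) := by fun_prop
  refine ⟨_, hcont', (hgauss.const_mul _).mono' hcont'.aestronglyMeasurable (.of_forall hbound),
    hbound, ?_⟩
  · intro x
    have hΦx : Integrable fun v => (Φ (v + x) : ℂ) := hΦc.comp_add_right x
    have hshift : ∀ w : RVec d, 𝓕 (fun v => (Φ (v + x) : ℂ)) w
        = Complex.exp ((inner ℝ ((2 * Real.pi) • w) x : ℝ) * Complex.I) *
          𝓕 (fun x => (Φ x : ℂ)) w := by
      intro w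
      have := congrFun (VectorFourier.fourierIntegral_comp_add_right Real.fourierChar volume
        (innerₗ (RVec d)) (fun x => (Φ x : ℂ)) x) w
      refine Eq.trans this ?_
      rw [Circle.smul_def, Real.fourierChar_apply, smul_eq_mul, innerₗ_apply_apply,
        inner_smul_left, real_inner_comm]
      rfl
    rw [← integral_complex_ofReal]
    simp_rw [add_comm x]
    rw [integral_eq_integral_mul_fourier μ hq fun v => (Φ (v + x) : ℂ),
      ← integral_fourier_mul_eq_flip hΦx hq]
    simp_rw [hshift]
    -- The substitution `a = 2πξ` passes from the normalization of `𝓕` to that of `charFun`.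
    have := Measure.integral_comp_smul (volume : Measure (RVec d))
      (fun a => Complex.exp ((inner ℝ a x : ℝ) * Complex.I) *
          𝓕 (fun x => (Φ x : ℂ)) ((2 * Real.pi)⁻¹ • a) * charFun μ a) (2 * Real.pi)
    simp only [smul_smul, inv_mul_cancel₀ hpi.ne', one_smul] at this
    rw [this, finrank_euclideanSpace_fin, abs_of_nonneg (by positivity), ← integral_smul]
    congr 1; ext a
    rw [Complex.real_smul, Complex.ofReal_inv]
    ring

/-! ### The multivariate `t`-distribution -/

/-- The Lebesgue density of `multivariateT ν d`. -/
noncomputable def tDensity (ν : ℝ) (d : ℕ) (x : RVec d) : ℝ :=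
  Real.Gamma ((ν + d) / 2) /
      (Real.Gamma (ν / 2) * ν ^ ((d : ℝ) / 2) * Real.pi ^ ((d : ℝ) / 2)) *
    (1 + ‖x‖ ^ 2 / ν) ^ (-((ν + d) / 2))

theorem multivariateT_eq (ν : ℝ) (d : ℕ) :
    multivariateT ν d = volume.withDensity fun x => ENNReal.ofReal (tDensity ν d x) := rfl

theorem tDensity_pos {ν : ℝ} (hν : 0 < ν) (d : ℕ) (x : RVec d) : 0 < tDensity ν d x := by
  have h1 := Real.Gamma_pos_of_pos (show 0 < (ν + d) / 2 by positivity)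
  have h2 := Real.Gamma_pos_of_pos (show 0 < ν / 2 by positivity)
  unfold tDensity
  positivity

@[fun_prop]
theorem measurable_tDensity (ν : ℝ) (d : ℕ) : Measurable (tDensity ν d) := by
  unfold tDensity
  fun_prop

theorem Real.rpow_mul_exp_neg_le_Gamma {s u : ℝ} (hs : 0 < s) (hu : 0 ≤ u) :
    u ^ s * Real.exp (-u) ≤ Real.Gamma (s + 1) := by
  have hint := Real.GammaIntegral_convergent (s := s + 1) (by linarith)
  rw [Real.Gamma_eq_integral (by linarith)]
  simp only [add_sub_cancel_right] at hint ⊢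
  have hsub : Set.Ioi u ⊆ Set.Ioi (0 : ℝ) := Set.Ioi_subset_Ioi hu
  calc u ^ s * Real.exp (-u) = ∫ x in Set.Ioi u, u ^ s * Real.exp (-x) := by
        rw [integral_const_mul, integral_exp_neg_Ioi]
    _ ≤ ∫ x in Set.Ioi u, Real.exp (-x) * x ^ s := by
        refine setIntegral_mono_on ((integrableOn_exp_neg_Ioi u).const_mul _)
          (hint.mono_set hsub) measurableSet_Ioi ?_
        intro x hx
        rw [mul_comm]
        gcongr
        exact le_of_lt hx
    _ ≤ ∫ x in Set.Ioi 0, Real.exp (-x) * x ^ s := by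
        refine setIntegral_mono_set hint ?_ hsub.eventuallyLE
        filter_upwards [ae_restrict_mem measurableSet_Ioi] with x hx
        have : (0 : ℝ) < x := hx
        positivity

/-- Gaussian weights against the density of the `t`-distribution. The threshold `1 / (4π)` on
the rate makes the factors of exponential type in the dimension cancel. -/
theorem exp_div_tDensity_le {ν C : ℝ} (hν : 0 < ν) (hC : 1 / (4 * Real.pi) ≤ C) (d : ℕ)
    (x : RVec d) :
    ((2 * Real.pi) ^ d)⁻¹ * Real.exp (-C * ‖x‖ ^ 2) / tDensity ν d x ≤
      Real.Gamma (ν / 2) * ν ^ (-(ν / 2)) * C ^ (-(ν / 2)) * Real.exp (C * ν) * (ν + d) := by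
  have hpi := Real.pi_pos
  have hC0 : 0 < C := lt_of_lt_of_le (by positivity) hC
  set s : ℝ := (ν + d) / 2 with hs
  have hs0 : 0 < s := by positivity
  have hG := Real.Gamma_pos_of_pos hs0
  have hG2 := Real.Gamma_pos_of_pos (show 0 < ν / 2 by positivity)
  set u : ℝ := ν + ‖x‖ ^ 2 with hu
  have hu0 : 0 < u := by positivity
  have h1 : (1 + ‖x‖ ^ 2 / ν) = u / ν := by rw [hu]; field_simp
  -- The Gamma function in this bound is that of the normalizing constant of the density, up to
  -- the factor `s`.
  have key : u ^ s * Real.exp (-(C * u)) ≤ C ^ (-s) * (s * Real.Gamma s) := by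
    have := Real.rpow_mul_exp_neg_le_Gamma hs0 (show 0 ≤ C * u by positivity)
    rw [Real.Gamma_add_one hs0.ne', Real.mul_rpow hC0.le hu0.le] at this
    rw [Real.rpow_neg hC0.le, inv_mul_eq_div, le_div_iff₀ (by positivity)]
    linarith
  -- The left-hand side is `(4πC)^(-d/2)`.
  have hdim : ((2 * Real.pi) ^ d)⁻¹ * Real.pi ^ ((d : ℝ) / 2) * C ^ (-((d : ℝ) / 2)) ≤ 1 := by
    have e1 : (2 * Real.pi) ^ d = ((4 * Real.pi) * Real.pi) ^ ((d : ℝ) / 2) := by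
      rw [show 4 * Real.pi * Real.pi = (2 * Real.pi) ^ (2 : ℝ) by norm_cast; ring,
        ← Real.rpow_mul (by positivity), ← Real.rpow_natCast]
      congr 1; ring
    rw [e1, Real.rpow_neg hC0.le, Real.mul_rpow (by positivity) hpi.le, mul_inv, mul_assoc,
      mul_assoc, inv_mul_cancel_left₀ (show Real.pi ^ ((d : ℝ) / 2) ≠ 0 by positivity), ← mul_inv,
      ← Real.mul_rpow (by positivity) hC0.le]
    refine inv_le_one_of_one_le₀ (Real.one_le_rpow ?_ (by positivity))
    rwa [div_le_iff₀ (by positivity), mul_comm] at hC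
  have e2 : ((2 * Real.pi) ^ d)⁻¹ * Real.exp (-C * ‖x‖ ^ 2) / tDensity ν d x
      = (((2 * Real.pi) ^ d)⁻¹ * Real.pi ^ ((d : ℝ) / 2)) * (Real.Gamma (ν / 2) / Real.Gamma s) *
        (ν ^ ((d : ℝ) / 2) * ν ^ (-s)) * Real.exp (C * ν) * (u ^ s * Real.exp (-(C * u))) := by
    rw [tDensity, h1, ← hs, Real.rpow_neg (by positivity), Real.div_rpow hu0.le hν.le,
      Real.rpow_neg hν.le, hu, show -C * ‖x‖ ^ 2 = C * ν + -(C * (ν + ‖x‖ ^ 2)) by ring,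
      Real.exp_add]
    have : (ν + ‖x‖ ^ 2) ^ s ≠ 0 := by positivity
    field_simp
  have e3 : ν ^ ((d : ℝ) / 2) * ν ^ (-s) = ν ^ (-(ν / 2)) := by
    rw [← Real.rpow_add hν]; congr 1; rw [hs]; ring
  have e4 : C ^ (-s) = C ^ (-((d : ℝ) / 2)) * C ^ (-(ν / 2)) := by
    rw [← Real.rpow_add hC0]; congr 1; rw [hs]; ring
  rw [e2, e3]
  calc _ ≤ (((2 * Real.pi) ^ d)⁻¹ * Real.pi ^ ((d : ℝ) / 2)) *
        (Real.Gamma (ν / 2) / Real.Gamma s) * ν ^ (-(ν / 2)) * Real.exp (C * ν) *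
        (C ^ (-s) * (s * Real.Gamma s)) := by gcongr
    _ = (((2 * Real.pi) ^ d)⁻¹ * Real.pi ^ ((d : ℝ) / 2) * C ^ (-((d : ℝ) / 2))) *
        (Real.Gamma (ν / 2) * ν ^ (-(ν / 2)) * C ^ (-(ν / 2)) * Real.exp (C * ν) * s) := by
        rw [e4]; field_simp
    _ ≤ 1 * (Real.Gamma (ν / 2) * ν ^ (-(ν / 2)) * C ^ (-(ν / 2)) * Real.exp (C * ν) * s) := by
        gcongr
    _ ≤ _ := by
        rw [one_mul]
        gcongr
        rw [hs]
        linarith [show 0 < ν + d by positivity]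

theorem one_add_sq_div_rpow_le {ν r p : ℝ} (hν : 0 < ν) (hr : 0 < r) (hp : 0 ≤ p) :
    (1 + r ^ 2 / ν) ^ (-p) ≤ ν ^ p * r ^ (-(2 * p)) := by
  calc (1 + r ^ 2 / ν) ^ (-p) ≤ (r ^ 2 / ν) ^ (-p) :=
        Real.rpow_le_rpow_of_nonpos (by positivity) (by linarith) (by linarith)
    _ = ν ^ p * r ^ (-(2 * p)) := by
        rw [Real.div_rpow (by positivity) hν.le, Real.rpow_neg hν.le, div_inv_eq_mul,
          ← Real.rpow_natCast, ← Real.rpow_mul hr.le, mul_comm]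
        congr 2; push_cast; ring

theorem integrableOn_pow_mul_one_add_sq_div_rpow {ν p : ℝ} (hν : 0 < ν) (hp : 0 ≤ p) {k : ℕ}
    (hk : k + 1 < 2 * p) :
    IntegrableOn (fun r : ℝ => r ^ k * (1 + r ^ 2 / ν) ^ (-p)) (Set.Ioi 0) := by
  have hc : Continuous fun r : ℝ => r ^ k * (1 + r ^ 2 / ν) ^ (-p) := by
    refine (continuous_pow k).mul (Continuous.rpow_const (by fun_prop) fun r => Or.inl ?_)
    positivity
  rw [← Set.Ioc_union_Ioi_eq_Ioi (zero_le_one' ℝ)]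
  refine IntegrableOn.union
    ((hc.integrableOn_Icc (a := 0) (b := 1)).mono_set Set.Ioc_subset_Icc_self) ?_
  have h1 : IntegrableOn (fun r : ℝ => ν ^ p * r ^ (k - 2 * p)) (Set.Ioi 1) :=
    (integrableOn_Ioi_rpow_of_lt (by linarith) one_pos).const_mul _
  refine h1.mono' hc.aestronglyMeasurable ?_
  filter_upwards [ae_restrict_mem measurableSet_Ioi] with r hr
  have hr0 : 0 < r := one_pos.trans hr
  rw [Real.norm_of_nonneg (by positivity), sub_eq_add_neg, Real.rpow_add hr0, Real.rpow_natCast,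
    mul_left_comm]
  gcongr
  exact one_add_sq_div_rpow_le hν hr0 hp

/-- Recursion for the radial moments of the `t`-distribution, by integration by parts. -/
theorem integral_pow_mul_one_add_sq_div_rpow {ν p : ℝ} (hν : 0 < ν) {k : ℕ} (hk1 : 1 ≤ k)
    (hk : k + 2 < 2 * p) :
    ∫ r in Set.Ioi (0 : ℝ), r ^ (k + 1) * (1 + r ^ 2 / ν) ^ (-p) =
      k * ν / (2 * p - 2 - k) *
        ∫ r in Set.Ioi (0 : ℝ), r ^ (k - 1) * (1 + r ^ 2 / ν) ^ (-p) := by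
  obtain ⟨m, rfl⟩ : ∃ m, k = m + 1 := ⟨k - 1, by omega⟩
  simp only [Nat.add_sub_cancel]
  have hp : 0 ≤ p := by
    have : (0 : ℝ) ≤ ((m + 1 : ℕ) : ℝ) := by positivity
    linarith
  push_cast at hk ⊢
  have i1 := integrableOn_pow_mul_one_add_sq_div_rpow (k := m) hν hp (by linarith)
  have i2 := integrableOn_pow_mul_one_add_sq_div_rpow (k := m + 1 + 1) hν hp
    (by push_cast; linarith)
  have hderiv : ∀ r ∈ Set.Ici (0 : ℝ),
      HasDerivAt (fun r : ℝ => r ^ (m + 1) * (1 + r ^ 2 / ν) ^ (1 - p))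
        ((m + 1) * (r ^ m * (1 + r ^ 2 / ν) ^ (-p)) +
          (-((2 * p - 2 - (m + 1)) / ν)) * (r ^ (m + 1 + 1) * (1 + r ^ 2 / ν) ^ (-p))) r := by
    intro r _
    have hpos : 0 < 1 + r ^ 2 / ν := by positivity
    have h1 := (((hasDerivAt_pow 2 r).div_const ν).const_add 1).rpow_const (p := 1 - p)
      (Or.inl hpos.ne')
    have h2 := (hasDerivAt_pow (m + 1) r).mul h1
    convert! h2 using 1
    rw [show 1 - p - 1 = -p by ring, show 1 - p = -p + 1 by ring, Real.rpow_add_one hpos.ne']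
    push_cast
    field_simp
    ring
  have htend : Filter.Tendsto (fun r : ℝ => r ^ (m + 1) * (1 + r ^ 2 / ν) ^ (1 - p))
      Filter.atTop (nhds 0) := by
    have h0 : Filter.Tendsto (fun r : ℝ => ν ^ (p - 1) * r ^ (-(2 * p - 2 - (m + 1))))
        Filter.atTop (nhds 0) := by
      simpa using (tendsto_rpow_neg_atTop
        (show 0 < 2 * p - 2 - ((m : ℝ) + 1) by linarith)).const_mul (ν ^ (p - 1))
    refine tendsto_of_tendsto_of_tendsto_of_le_of_le' tendsto_const_nhds h0 ?_ ?_
    · filter_upwards [Filter.eventually_gt_atTop 0] with r hr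
      positivity
    · filter_upwards [Filter.eventually_gt_atTop 0] with r hr
      have hm : (0 : ℝ) ≤ m := by positivity
      have := one_add_sq_div_rpow_le hν hr (show 0 ≤ p - 1 by linarith)
      rw [neg_sub] at this
      calc _ ≤ r ^ (m + 1) * (ν ^ (p - 1) * r ^ (-(2 * (p - 1)))) := by gcongr
        _ = ν ^ (p - 1) * (r ^ (((m + 1 : ℕ) : ℝ)) * r ^ (-(2 * (p - 1)))) := by
            rw [Real.rpow_natCast]; ring
        _ = _ := by
            rw [← Real.rpow_add hr]; congr 2; push_cast; ring
  have hI := integral_Ioi_of_hasDerivAt_of_tendsto' hderiv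
    ((i1.const_mul _).add (i2.const_mul _)) htend
  rw [integral_add (i1.const_mul _) (i2.const_mul _), integral_const_mul, integral_const_mul] at hI
  have hpos : 0 < 2 * p - 2 - ((m : ℝ) + 1) := by linarith
  simp only [ne_eq, Nat.add_eq_zero_iff, one_ne_zero, and_false, not_false_eq_true, zero_pow,
    zero_mul, sub_zero] at hI
  generalize ∫ r in Set.Ioi (0 : ℝ), r ^ (m + 1 + 1) * (1 + r ^ 2 / ν) ^ (-p) = I₂ at hI ⊢
  generalize ∫ r in Set.Ioi (0 : ℝ), r ^ m * (1 + r ^ 2 / ν) ^ (-p) = I₁ at hI ⊢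
  rw [div_mul_eq_mul_div, eq_div_iff hpos.ne']
  field_simp at hI
  linarith

theorem integrable_multivariateT_iff {ν : ℝ} (hν : 0 < ν) {d : ℕ} {f : RVec d → ℝ} :
    Integrable f (multivariateT ν d) ↔ Integrable fun x => tDensity ν d x * f x := by
  rw [multivariateT_eq, integrable_withDensity_iff_integrable_smul' (by fun_prop)
    (.of_forall fun _ => ENNReal.ofReal_lt_top)]
  simp only [ENNReal.toReal_ofReal (tDensity_pos hν d _).le, smul_eq_mul]

theorem integral_multivariateT {ν : ℝ} (hν : 0 < ν) {d : ℕ} (f : RVec d → ℝ) :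
    ∫ x, f x ∂(multivariateT ν d) = ∫ x, tDensity ν d x * f x := by
  rw [multivariateT_eq, integral_withDensity_eq_integral_toReal_smul (by fun_prop)
    (.of_forall fun _ => ENNReal.ofReal_lt_top)]
  simp only [ENNReal.toReal_ofReal (tDensity_pos hν d _).le, smul_eq_mul]

/-- The fourth moment of the `t`-distribution grows at most like `d²`. The normalizing constant
of the density enters only through the total mass. -/
theorem fourth_moment_multivariateT {ν : ℝ} (hν : 4 < ν) (d : ℕ) [NeZero d]
    [IsProbabilityMeasure (multivariateT ν d)] :
    Integrable (fun x : RVec d => ‖x‖ ^ 4) (multivariateT ν d) ∧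
      ∫ x : RVec d, ‖x‖ ^ 4 ∂(multivariateT ν d)
        ≤ 3 * ν ^ 2 / ((ν - 2) * (ν - 4)) * (d : ℝ) ^ 2 := by
  have hν0 : 0 < ν := by linarith
  have hd1 : 1 ≤ d := NeZero.one_le
  have hd : (1 : ℝ) ≤ d := by exact_mod_cast hd1
  have : Nontrivial (RVec d) := by
    have : Nonempty (Fin d) := ⟨0⟩
    infer_instance
  set c : ℝ := Real.Gamma ((ν + d) / 2) /
      (Real.Gamma (ν / 2) * ν ^ ((d : ℝ) / 2) * Real.pi ^ ((d : ℝ) / 2)) with hc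
  have hdens : ∀ x : RVec d, tDensity ν d x = c * (1 + ‖x‖ ^ 2 / ν) ^ (-((ν + d) / 2)) :=
    fun _ => rfl
  set v : ℝ := d * (volume : Measure (RVec d)).real (Metric.ball 0 1) with hv
  set I : ℕ → ℝ := fun k => ∫ r in Set.Ioi (0 : ℝ), r ^ k * (1 + r ^ 2 / ν) ^ (-((ν + d) / 2))
    with hI
  -- total mass one, in polar coordinates
  have h0 : c * (v * I (d - 1)) = 1 := by
    have h1 : ∫ _ : RVec d, (1 : ℝ) ∂(multivariateT ν d) = 1 := by simp
    rw [integral_multivariateT hν0] at h1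
    simp only [hdens, mul_one] at h1
    rw [integral_const_mul, integral_fun_norm_addHaar volume
      (fun r => (1 + r ^ 2 / ν) ^ (-((ν + d) / 2))), finrank_euclideanSpace_fin] at h1
    simp only [smul_eq_mul, nsmul_eq_mul] at h1
    rw [← h1, hv]
    ring
  have hrad : ∀ y : ℝ, y ^ (d - 1) • (c * (1 + y ^ 2 / ν) ^ (-((ν + d) / 2)) * y ^ 4)
      = c * (y ^ (d + 3) * (1 + y ^ 2 / ν) ^ (-((ν + d) / 2))) := by
    intro y
    rw [show d + 3 = d - 1 + 4 by omega, pow_add, smul_eq_mul]; ring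
  have hr1 : I (d + 1) = d * ν / (ν - 2) * I (d - 1) := by
    have := integral_pow_mul_one_add_sq_div_rpow (p := (ν + d) / 2) hν0 hd1 (by linarith)
    rw [show 2 * ((ν + d) / 2) - 2 - (d : ℝ) = ν - 2 by ring] at this
    exact this
  have hr2 : I (d + 3) = (d + 2) * ν / (ν - 4) * I (d + 1) := by
    have := integral_pow_mul_one_add_sq_div_rpow (p := (ν + d) / 2) (k := d + 2) hν0 (by omega)
      (by push_cast; linarith)
    push_cast at this
    rw [show 2 * ((ν + d) / 2) - 2 - ((d : ℝ) + 2) = ν - 4 by ring] at this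
    exact this
  constructor
  · rw [integrable_multivariateT_iff hν0]
    simp only [hdens]
    rw [integrable_fun_norm_addHaar volume
      (f := fun r => c * (1 + r ^ 2 / ν) ^ (-((ν + d) / 2)) * r ^ 4), finrank_euclideanSpace_fin]
    simp only [hrad]
    exact (integrableOn_pow_mul_one_add_sq_div_rpow hν0 (by positivity)
      (by push_cast; linarith)).const_mul c
  · rw [integral_multivariateT hν0]
    simp only [hdens]
    rw [integral_fun_norm_addHaar volume
      (fun r => c * (1 + r ^ 2 / ν) ^ (-((ν + d) / 2)) * r ^ 4), finrank_euclideanSpace_fin]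
    simp only [hrad]
    rw [integral_const_mul]
    simp only [smul_eq_mul, nsmul_eq_mul]
    have h4 : 0 < ν - 4 := by linarith
    have h2 : 0 < ν - 2 := by linarith
    calc _ = (c * (v * I (d - 1))) * ((d + 2) * ν / (ν - 4) * (d * ν / (ν - 2))) := by
          change (d : ℝ) * (volume.real (Metric.ball 0 1) * (c * I (d + 3))) = _
          rw [hr2, hr1, hv]; ring
      _ = ν ^ 2 / ((ν - 2) * (ν - 4)) * (d * (d + 2)) := by rw [h0]; field_simp
      _ ≤ ν ^ 2 / ((ν - 2) * (ν - 4)) * (3 * d ^ 2) := by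
          exact mul_le_mul_of_nonneg_left (by nlinarith) (by positivity)
      _ = _ := by ring

/-! ### Last-iterate convergence of projected stochastic gradient descent -/

theorem Real.sqrt_add_one_sub_sqrt_ge (s : ℕ) :
    1 / (2 * √((s : ℝ) + 1)) ≤ √((s : ℝ) + 1) - √(s : ℝ) := by
  have h0 : (0 : ℝ) ≤ s := by positivity
  have h1 := Real.sq_sqrt h0
  have h2 := Real.sq_sqrt (show (0 : ℝ) ≤ (s : ℝ) + 1 by positivity)
  have h3 : √(s : ℝ) ≤ √((s : ℝ) + 1) := Real.sqrt_le_sqrt (by linarith)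
  have h4 : 0 < √((s : ℝ) + 1) := by positivity
  have h5 := Real.sqrt_nonneg (s : ℝ)
  rw [div_le_iff₀ (by positivity)]
  nlinarith

/-- Telescoped regret of steps with sizes `η₀ / √t` over the time window `s + 1, …, s + m + 1`.
The comparator has to be close at the start, or the window has to start at time `1`. -/
theorem regret_sum_le {e δ : ℕ → ℝ} {c Λ G η₀ : ℝ} (hη : 0 < η₀) (hG : 0 ≤ G) {s T : ℕ}
    (hδ : ∀ t, δ t ≤ 4 * Λ)
    (h0 : δ (s + 1) * √((s : ℝ) + 1) ≤ 4 * Λ * (√((s : ℝ) + 1) - √(s : ℝ)))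
    (hstep : ∀ t : ℕ, s + 1 ≤ t → t ≤ T →
      δ (t + 1) ≤ δ t - 2 * (η₀ / √(t : ℝ)) * (e t - c) + (η₀ / √(t : ℝ)) ^ 2 * G)
    (m : ℕ) (hm : s + 1 + m ≤ T) :
    ∑ i ∈ Finset.range (m + 1), (e (s + 1 + i) - c)
        + δ (s + 1 + m + 1) * √((s : ℝ) + 1 + m) / (2 * η₀)
      ≤ (2 * Λ / η₀ + η₀ * G) * (√((s : ℝ) + 1 + m) - √(s : ℝ)) := by
  have hone : ∀ t : ℕ, s + 1 ≤ t → t ≤ T → e t - c + δ (t + 1) * √(t : ℝ) / (2 * η₀)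
      ≤ δ t * √(t : ℝ) / (2 * η₀) + η₀ * G * (1 / (2 * √(t : ℝ))) := by
    intro t h1 h2
    have ht : 0 < √(t : ℝ) := Real.sqrt_pos.2 (by exact_mod_cast (by omega : 0 < t))
    have := mul_le_mul_of_nonneg_right (hstep t h1 h2) (show 0 ≤ √(t : ℝ) / (2 * η₀) by positivity)
    have e1 : (δ t - 2 * (η₀ / √(t : ℝ)) * (e t - c) + (η₀ / √(t : ℝ)) ^ 2 * G)
        * (√(t : ℝ) / (2 * η₀))
        = δ t * √(t : ℝ) / (2 * η₀) - (e t - c) + η₀ * G * (1 / (2 * √(t : ℝ))) := by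
      field_simp
    rw [e1, ← mul_div_assoc] at this
    linarith
  have hQ : ∀ r : ℕ, η₀ * G * (1 / (2 * √((r : ℝ) + 1)))
      ≤ η₀ * G * (√((r : ℝ) + 1) - √(r : ℝ)) := fun r =>
    mul_le_mul_of_nonneg_left (Real.sqrt_add_one_sub_sqrt_ge r) (by positivity)
  induction m with
  | zero =>
    have h1 := hone (s + 1) le_rfl (by omega)
    have h2 := hQ s
    have h3 : δ (s + 1) * √((s : ℝ) + 1) / (2 * η₀)
        ≤ 2 * Λ / η₀ * (√((s : ℝ) + 1) - √(s : ℝ)) := by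
      rw [div_le_iff₀ (by positivity)]
      refine h0.trans (le_of_eq ?_)
      field_simp; ring
    simp only [zero_add, Finset.range_one, Finset.sum_singleton, add_zero, Nat.cast_zero]
    push_cast at h1
    nlinarith
  | succ m ih =>
    have h1 := hone (s + 1 + (m + 1)) (by omega) hm
    have h2 := hQ (s + 1 + m)
    have h3 := ih (by omega)
    have h4 : δ (s + 1 + (m + 1)) * (√((s : ℝ) + 1 + m + 1) - √((s : ℝ) + 1 + m)) / (2 * η₀)
        ≤ 2 * Λ / η₀ * (√((s : ℝ) + 1 + m + 1) - √((s : ℝ) + 1 + m)) := by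
      rw [div_le_iff₀ (by positivity)]
      have hs : 0 ≤ √((s : ℝ) + 1 + m + 1) - √((s : ℝ) + 1 + m) :=
        sub_nonneg.2 (Real.sqrt_le_sqrt (by linarith))
      refine (mul_le_mul_of_nonneg_right (hδ _) hs).trans (le_of_eq ?_)
      field_simp; ring
    rw [Finset.sum_range_succ]
    push_cast at h1 h2 h3 ⊢
    rw [← add_assoc ((s : ℝ) + 1)] at h1 ⊢
    have e1 : s + 1 + (m + 1) = s + 1 + m + 1 := by omega
    rw [e1] at h1 h4 ⊢
    have e2 : δ (s + 1 + m + 1) * (√((s : ℝ) + 1 + m + 1) - √((s : ℝ) + 1 + m)) / (2 * η₀)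
      = δ (s + 1 + m + 1) * √((s : ℝ) + 1 + m + 1) / (2 * η₀)
        - δ (s + 1 + m + 1) * √((s : ℝ) + 1 + m) / (2 * η₀) := by ring
    rw [e2] at h4
    linarith

/-- From regret bounds to the last value of a sequence: comparing every tail average of `e` with
its first term turns the bound on the full average into one on `e T`, at the cost of a harmonic
sum. Here `δ s` and `D` stand for the squared distances of the iterates from the iterate at time
`s` and from a fixed comparator of value `c`. -/
theorem last_value_le {e : ℕ → ℝ} {c Λ G η₀ : ℝ} (hη : 0 < η₀) (hΛ : 0 ≤ Λ) (hG : 0 ≤ G) {T : ℕ}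
    (hT : 1 ≤ T) (δ : ℕ → ℕ → ℝ) (D : ℕ → ℝ)
    (hδ0 : ∀ s, δ s s = 0) (hδn : ∀ s t, 0 ≤ δ s t) (hδ : ∀ s t, δ s t ≤ 4 * Λ)
    (hDn : ∀ t, 0 ≤ D t) (hD : ∀ t, D t ≤ 4 * Λ)
    (hδstep : ∀ s t : ℕ, 1 ≤ s → s ≤ t → t ≤ T → δ s (t + 1) ≤ δ s t
      - 2 * (η₀ / √(t : ℝ)) * (e t - e s) + (η₀ / √(t : ℝ)) ^ 2 * G)
    (hDstep : ∀ t : ℕ, 1 ≤ t → t ≤ T →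
      D (t + 1) ≤ D t - 2 * (η₀ / √(t : ℝ)) * (e t - c) + (η₀ / √(t : ℝ)) ^ 2 * G) :
    e T - c ≤ (2 * Λ / η₀ + η₀ * G) * (2 + Real.log T) / √(T : ℝ) := by
  set Q := 2 * Λ / η₀ + η₀ * G with hQ
  have hQ0 : 0 ≤ Q := by positivity
  have hT0 : (0 : ℝ) < T := by exact_mod_cast hT
  have hsT : 0 < √(T : ℝ) := Real.sqrt_pos.2 hT0
  set A : ℕ → ℝ := fun m => ∑ i ∈ Finset.range m, e (T - i) with hA
  have hrefl : ∀ (m : ℕ) (a : ℝ), m + 1 ≤ T →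
      ∑ i ∈ Finset.range (m + 1), (e (T - m + i) - a) = A (m + 1) - (m + 1) * a := by
    intro m a hm
    rw [Finset.sum_sub_distrib, ← Finset.sum_range_reflect]
    simp only [Finset.sum_const, Finset.card_range, nsmul_eq_mul, hA]
    push_cast
    congr 1
    refine Finset.sum_congr rfl fun i hi => ?_
    have := Finset.mem_range.1 hi
    congr 1; omega
  -- The sum of the last `m + 1` values, compared with the first of them.
  have htail : ∀ m : ℕ, m + 1 ≤ T → A (m + 1) - (m + 1) * e (T - m) ≤ Q * (m + 1) / √(T : ℝ) := by
    intro m hm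
    obtain ⟨s, rfl⟩ : ∃ s, T = s + 1 + m := ⟨T - (m + 1), by omega⟩
    have h1 := regret_sum_le (e := e) (c := e (s + 1)) (δ := δ (s + 1)) (s := s) (T := s + 1 + m)
      hη hG (hδ (s + 1)) (by
        rw [hδ0, zero_mul]
        have : √(s : ℝ) ≤ √((s : ℝ) + 1) := Real.sqrt_le_sqrt (by linarith)
        have := sub_nonneg.2 this
        positivity) (fun t h1 h2 => hδstep (s + 1) t (by omega) h1 h2) m le_rfl
    have h2 : 0 ≤ δ (s + 1) (s + 1 + m + 1) * √((s : ℝ) + 1 + m) / (2 * η₀) := by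
      have := hδn (s + 1) (s + 1 + m + 1)
      positivity
    have h3 := hrefl m (e (s + 1)) hm
    rw [show s + 1 + m - m = s + 1 by omega] at h3 ⊢
    rw [h3] at h1
    push_cast at hsT ⊢
    have h4 : √((s : ℝ) + 1 + m) - √(s : ℝ) ≤ ((m : ℝ) + 1) / √((s : ℝ) + 1 + m) := by
      rw [le_div_iff₀ hsT]
      have h5 := Real.sq_sqrt (show (0 : ℝ) ≤ s by positivity)
      have h6 := Real.sq_sqrt (show (0 : ℝ) ≤ (s : ℝ) + 1 + m by positivity)
      have h7 : √(s : ℝ) ≤ √((s : ℝ) + 1 + m) :=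
        Real.sqrt_le_sqrt (by linarith [show (0 : ℝ) ≤ m by positivity])
      have h8 := Real.sqrt_nonneg (s : ℝ)
      nlinarith
    have h9 := mul_le_mul_of_nonneg_left h4 hQ0
    rw [← mul_div_assoc] at h9
    linarith
  -- Shortening the tail from `m + 2` to `m + 1` terms raises its mean by at most
  -- `Q / (√T (m + 1))`.
  have hind : ∀ m : ℕ, m + 1 ≤ T →
      e T ≤ A (m + 1) / ((m : ℝ) + 1) + Q / √(T : ℝ) * (harmonic m : ℝ) := by
    intro m
    induction m with
    | zero => intro _; simp [hA]
    | succ m ih =>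
      intro hm
      have h1 := ih (by omega)
      have h2 := htail (m + 1) hm
      have h3 : A (m + 1 + 1) = A (m + 1) + e (T - (m + 1)) := by
        simp only [hA]; rw [Finset.sum_range_succ]
      rw [harmonic_succ]
      push_cast at h2 ⊢
      have hm1 : (0 : ℝ) < (m : ℝ) + 1 := by positivity
      have hm2 : (0 : ℝ) < (m : ℝ) + 1 + 1 := by positivity
      have h4 : A (m + 1) / ((m : ℝ) + 1) ≤ A (m + 1 + 1) / ((m : ℝ) + 1 + 1)
          + Q / √(T : ℝ) * ((m : ℝ) + 1)⁻¹ := by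
        have h5 : A (m + 1 + 1) / ((m : ℝ) + 1 + 1) - e (T - (m + 1)) ≤ Q / √(T : ℝ) := by
          rw [div_sub' hm2.ne', div_le_iff₀ hm2]
          refine h2.trans (le_of_eq ?_)
          ring
        have h6 : A (m + 1) = A (m + 1 + 1) - e (T - (m + 1)) := by linarith
        rw [← div_eq_mul_inv, div_add' _ _ _ hm2.ne', div_le_div_iff₀ hm1 hm2, h6]
        rw [div_sub' hm2.ne', div_le_iff₀ hm2] at h5
        have h7 : (A (m + 1 + 1) + Q / √(T : ℝ) / ((m : ℝ) + 1) * ((m : ℝ) + 1 + 1)) * ((m : ℝ) + 1)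
            = A (m + 1 + 1) * ((m : ℝ) + 1) + Q / √(T : ℝ) * ((m : ℝ) + 1 + 1) := by
          field_simp
        rw [h7]
        nlinarith
      rw [mul_add]
      linarith
  obtain ⟨S, rfl⟩ : ∃ S, T = S + 1 := ⟨T - 1, by omega⟩
  have h1 := hind S le_rfl
  have h2 := regret_sum_le (e := e) (c := c) (δ := D) (s := 0) (T := S + 1)
      hη hG hD (by simpa using hD 1) (fun t h1 h2 => hDstep t (by omega) h2) S (by omega)
  have h3 : 0 ≤ D (0 + 1 + S + 1) * √(((0 : ℕ) : ℝ) + 1 + S) / (2 * η₀) := by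
    have := hDn (0 + 1 + S + 1)
    positivity
  have h4 := hrefl S c le_rfl
  rw [show S + 1 - S = 0 + 1 by omega] at h4
  rw [h4] at h2
  have h5 : A (S + 1) / ((S : ℝ) + 1) - c ≤ Q / √((S + 1 : ℕ) : ℝ) := by
    push_cast at h2 hT0 hsT ⊢
    rw [div_sub' hT0.ne', div_le_iff₀ hT0]
    have h6 : Q / √((S : ℝ) + 1) * ((S : ℝ) + 1) = Q * √((S : ℝ) + 1) := by
      rw [div_mul_eq_mul_div, div_eq_iff hsT.ne', mul_assoc, Real.mul_self_sqrt hT0.le]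
    rw [h6]
    rw [show (0 : ℝ) + 1 + S = S + 1 by ring, Real.sqrt_zero, sub_zero] at h2
    rw [show ((0 : ℕ) : ℝ) + 1 + S = S + 1 by push_cast; ring] at h3
    linarith
  have h6 : (harmonic S : ℝ) ≤ 1 + Real.log ((S + 1 : ℕ) : ℝ) := by
    refine le_trans ?_ (harmonic_le_one_add_log (S + 1))
    rw [harmonic_succ]
    push_cast
    have : (0 : ℝ) ≤ ((S : ℝ) + 1)⁻¹ := by positivity
    linarith
  have h7 := mul_le_mul_of_nonneg_left h6 (show 0 ≤ Q / √((S + 1 : ℕ) : ℝ) by positivity)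
  have h8 : Q * (2 + Real.log ((S + 1 : ℕ) : ℝ)) / √((S + 1 : ℕ) : ℝ)
    = Q / √((S + 1 : ℕ) : ℝ) + Q / √((S + 1 : ℕ) : ℝ) * (1 + Real.log ((S + 1 : ℕ) : ℝ)) := by ring
  rw [h8]
  linarith

open Finset in
/-- Averaging over all `j`, the entry `j t` may be replaced by an independent uniform variable if
the rest of the expression does not depend on it. -/
theorem expect_update {ι β : Type*} [Fintype ι] [DecidableEq ι] [Fintype β] [Nonempty β]
    (t : ι) (Ψ : (ι → β) → β → ℝ) (h : ∀ j u v, Ψ (Function.update j t u) v = Ψ j v) :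
    expect univ (fun j => Ψ j (j t)) = expect univ fun j => expect univ fun u => Ψ j u := by
  classical
  have e1 : expect univ (fun j : ι → β => expect univ fun u : β => Ψ j u)
      = expect univ fun p : (ι → β) × β => Ψ p.1 p.2 := by
    rw [← univ_product_univ, expect_product]
  have e2 : expect univ (fun p : (ι → β) × β => Ψ p.1 p.2)
      = expect univ fun p : (ι → β) × β => Ψ p.1 (p.1 t) := by
    refine expect_nbij' (fun p => (Function.update p.1 t p.2, p.1 t))
      (fun p => (Function.update p.1 t p.2, p.1 t)) (by simp) (by simp) (by simp) (by simp) ?_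
    intro p _
    simp [h]
  rw [e1, e2, ← univ_product_univ, expect_product]
  simp

open Finset in
theorem expect_apply_eq {ι β : Type*} [Fintype ι] [DecidableEq ι] [Fintype β] [Nonempty β]
    (t : ι) (h : β → ℝ) : expect univ (fun j : ι → β => h (j t)) = expect univ h := by
  rw [expect_update t (fun _ u => h u) (fun _ _ _ => rfl)]
  simp

/-- **Last-iterate convergence of projected SGD** in expectation, for a convex function `f` on a
ball. `W j` is the trajectory driven by the noise sequence `j`, and `g w u` is the stochastic
gradient at `w` for the noise value `u`. -/
theorem sgd_last_iterate {E β : Type*} [NormedAddCommGroup E] [InnerProductSpace ℝ E] [Fintype β]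
    [Nonempty β] {T : ℕ} (hT : 1 ≤ T) {f : E → ℝ} {g : E → β → E} {r G η₀ : ℝ} (hη : 0 < η₀)
    (hr : 0 ≤ r) (hG0 : 0 ≤ G) {proj : E → E} (hproj : ∀ z, ‖proj z‖ ≤ r)
    (hproj' : ∀ z v, ‖v‖ ≤ r → ‖proj z - v‖ ≤ ‖z - v‖)
    (hconv : ∀ w v, ‖w‖ ≤ r → ‖v‖ ≤ r →
      f w - f v ≤ Finset.expect Finset.univ fun u => inner ℝ (g w u) (w - v))
    (hG : ∀ w, ‖w‖ ≤ r → Finset.expect Finset.univ (fun u => ‖g w u‖ ^ 2) ≤ G)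
    (W : (Finset.Icc 1 T → β) → ℕ → E) (hW1 : ∀ j, W j 1 = 0)
    (hW : ∀ j (t : ℕ) (ht : t ∈ Finset.Icc 1 T),
      W j (t + 1) = proj (W j t - (η₀ / √(t : ℝ)) • g (W j t) (j ⟨t, ht⟩)))
    {v : E} (hv : ‖v‖ ≤ r) :
    Finset.expect Finset.univ (fun j => f (W j T)) - f v
      ≤ (2 * r ^ 2 / η₀ + η₀ * G) * (2 + Real.log T) / √(T : ℝ) := by
  classical
  have hWr : ∀ j t, 1 ≤ t → t ≤ T + 1 → ‖W j t‖ ≤ r := by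
    intro j t h1 h2
    rcases Nat.eq_or_lt_of_le h1 with rfl | h1
    · rw [hW1]; simpa using hr
    · obtain ⟨s, rfl⟩ : ∃ s, t = s + 1 := ⟨t - 1, by omega⟩
      rw [hW j s (Finset.mem_Icc.2 ⟨by omega, by omega⟩)]
      exact hproj _
  -- The trajectory up to time `t` does not depend on the noise at time `t`.
  have hdep : ∀ (t : ℕ) (ht : t ∈ Finset.Icc 1 T) j u, ∀ s, 1 ≤ s → s ≤ t →
      W (Function.update j ⟨t, ht⟩ u) s = W j s := by
    intro t ht j u s h1
    induction s, h1 using Nat.le_induction with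
    | base => intro _; rw [hW1, hW1]
    | succ s h1 ih =>
      intro h2
      have hs : s ∈ Finset.Icc 1 T := Finset.mem_Icc.2 ⟨h1, by
        have := (Finset.mem_Icc.1 ht).2; omega⟩
      rw [hW _ s hs, hW _ s hs, ih (by omega), Function.update_of_ne]
      simp only [ne_eq, Subtype.mk.injEq]; omega
  -- One step in expectation, for a random comparator independent of the noise at time `t`.
  have hstep : ∀ (V : (Finset.Icc 1 T → β) → E) (t : ℕ) (ht : t ∈ Finset.Icc 1 T),
      (∀ j, ‖V j‖ ≤ r) → (∀ j u, V (Function.update j ⟨t, ht⟩ u) = V j) →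
      Finset.expect Finset.univ (fun j => ‖W j (t + 1) - V j‖ ^ 2)
        ≤ Finset.expect Finset.univ (fun j => ‖W j t - V j‖ ^ 2)
          - 2 * (η₀ / √(t : ℝ)) * (Finset.expect Finset.univ (fun j => f (W j t))
            - Finset.expect Finset.univ (fun j => f (V j)))
          + (η₀ / √(t : ℝ)) ^ 2 * G := by
    intro V t ht hVr hV
    obtain ⟨ht1, ht2⟩ := Finset.mem_Icc.1 ht
    set η := η₀ / √(t : ℝ) with hηt
    have hη0 : 0 ≤ η := by positivity
    have hpt : ∀ j, ‖W j (t + 1) - V j‖ ^ 2 ≤ ‖W j t - V j‖ ^ 2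
        - 2 * η * inner ℝ (g (W j t) (j ⟨t, ht⟩)) (W j t - V j)
        + η ^ 2 * ‖g (W j t) (j ⟨t, ht⟩)‖ ^ 2 := by
      intro j
      have h1 := hproj' (W j t - η • g (W j t) (j ⟨t, ht⟩)) (V j) (hVr j)
      rw [← hW j t ht] at h1
      have h2 := pow_le_pow_left₀ (norm_nonneg _) h1 2
      rw [show W j t - η • g (W j t) (j ⟨t, ht⟩) - V j
        = (W j t - V j) - η • g (W j t) (j ⟨t, ht⟩) by abel,
        norm_sub_sq_real (W j t - V j), norm_smul, inner_smul_right, real_inner_comm,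
        mul_pow, Real.norm_eq_abs, sq_abs] at h2
      linarith
    have e1 := expect_update (⟨t, ht⟩ : Finset.Icc 1 T)
      (fun j u => inner ℝ (g (W j t) u) (W j t - V j))
      (fun j u v => by rw [hdep t ht j u t ht1 le_rfl, hV])
    have e2 := expect_update (⟨t, ht⟩ : Finset.Icc 1 T)
      (fun j u => ‖g (W j t) u‖ ^ 2)
      (fun j u v => by rw [hdep t ht j u t ht1 le_rfl])
    have h3 := Finset.expect_le_expect (s := Finset.univ) fun j _ => hpt j
    rw [Finset.expect_add_distrib, Finset.expect_sub_distrib, ← Finset.mul_expect,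
      ← Finset.mul_expect, e1, e2] at h3
    have h4 : Finset.expect Finset.univ (fun j => f (W j t))
        - Finset.expect Finset.univ (fun j => f (V j))
        ≤ Finset.expect Finset.univ fun j => Finset.expect Finset.univ fun u =>
          inner ℝ (g (W j t) u) (W j t - V j) := by
      rw [← Finset.expect_sub_distrib]
      exact Finset.expect_le_expect fun j _ =>
        hconv _ _ (hWr j t ht1 (by omega)) (hVr j)
    have h5 : (Finset.expect Finset.univ fun j => Finset.expect Finset.univ fun u =>
          ‖g (W j t) u‖ ^ 2) ≤ G :=
      Finset.expect_le Finset.univ_nonempty fun j _ => hG _ (hWr j t ht1 (by omega))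
    have h6 := mul_le_mul_of_nonneg_left h4 (show 0 ≤ 2 * η by positivity)
    have h7 := mul_le_mul_of_nonneg_left h5 (show 0 ≤ η ^ 2 by positivity)
    linarith
  -- Times are clamped to `[1, T + 1]`, where the iterates stay in the ball.
  set cl : ℕ → ℕ := fun t => max 1 (min t (T + 1)) with hcl
  have hclid : ∀ t, 1 ≤ t → t ≤ T + 1 → cl t = t := fun t h1 h2 => by simp only [hcl]; omega
  have hWcl : ∀ j t, ‖W j (cl t)‖ ≤ r := fun j t =>
    hWr j _ (by simp only [hcl]; omega) (by simp only [hcl]; omega)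
  have hdist : ∀ a b : E, ‖a‖ ≤ r → ‖b‖ ≤ r → ‖a - b‖ ^ 2 ≤ 4 * r ^ 2 := by
    intro a b ha hb
    have h1 := (norm_sub_le a b).trans (add_le_add ha hb)
    have h2 := pow_le_pow_left₀ (norm_nonneg _) h1 2
    linarith [h2, show (r + r) ^ 2 = 4 * r ^ 2 by ring]
  have hmain := last_value_le (e := fun t => Finset.expect Finset.univ fun j => f (W j t))
    (c := f v) (Λ := r ^ 2) hη (sq_nonneg r) hG0 hT
    (fun s t => Finset.expect Finset.univ fun j => ‖W j (cl t) - W j (cl s)‖ ^ 2)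
    (fun t => Finset.expect Finset.univ fun j => ‖W j (cl t) - v‖ ^ 2)
    (fun s => by simp)
    (fun s t => Finset.expect_nonneg fun j _ => by positivity)
    (fun s t => Finset.expect_le Finset.univ_nonempty fun j _ =>
      hdist _ _ (hWcl j t) (hWcl j s))
    (fun t => Finset.expect_nonneg fun j _ => by positivity)
    (fun t => Finset.expect_le Finset.univ_nonempty fun j _ =>
      hdist _ _ (hWcl j t) hv)
    (fun s t h1 h2 h3 => by
      have ht : t ∈ Finset.Icc 1 T := Finset.mem_Icc.2 ⟨h1.trans h2, h3⟩
      simp only [hclid s h1 (by omega), hclid t (by omega) (by omega),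
        hclid (t + 1) (by omega) (by omega)]
      exact hstep (fun j => W j s) t ht (fun j => hWr j s h1 (by omega))
        (fun j u => hdep t ht j u s h1 h2))
    (fun t h1 h3 => by
      have ht : t ∈ Finset.Icc 1 T := Finset.mem_Icc.2 ⟨h1, h3⟩
      simp only [hclid t (by omega) (by omega), hclid (t + 1) (by omega) (by omega)]
      have := hstep (fun _ => v) t ht (fun _ => hv) (fun _ _ => rfl)
      simpa using this)
  exact hmain

theorem norm_projBall_sub_le {N : ℕ} {r : ℝ} (hr : 0 ≤ r) (z v : RVec N) (hv : ‖v‖ ≤ r) :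
    ‖projBall r z - v‖ ≤ ‖z - v‖ := by
  unfold projBall
  split_ifs with h
  · exact le_rfl
  · have h' := not_le.mp h
    have hz : 0 < ‖z‖ := lt_of_le_of_lt hr h'
    set θ := r / ‖z‖ with hθ
    have hθ0 : 0 ≤ θ := by positivity
    have hθ1 : θ ≤ 1 := by rw [hθ, div_le_one hz]; exact h'.le
    have hθr : r = θ * ‖z‖ := by rw [hθ]; field_simp
    refine le_of_sq_le_sq ?_ (norm_nonneg _)
    rw [norm_sub_sq_real, norm_sub_sq_real, norm_smul, inner_smul_left, Real.norm_of_nonneg hθ0]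
    have h1 : inner ℝ z v ≤ ‖z‖ * (θ * ‖z‖) := by
      rw [← hθr]
      exact (real_inner_le_norm z v).trans (by gcongr)
    simp only [RCLike.conj_to_real]
    nlinarith [mul_le_mul_of_nonneg_left h1 (sub_nonneg.2 hθ1),
      mul_nonneg (mul_nonneg (sub_nonneg.2 hθ1) (sub_nonneg.2 hθ1)) (sq_nonneg ‖z‖)]

/-- The index sequence `j` of the batches at the times `1, …, T`, extended arbitrarily. -/
def extendBatch {n 𝔅 T : ℕ} [NeZero n] (j : Finset.Icc 1 T → Fin 𝔅 → Fin n) :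
    ℕ → Fin 𝔅 → Fin n :=
  fun t i => if h : t ∈ Finset.Icc 1 T then j ⟨t, h⟩ i else 0

/-- Optimization error of `sgdIterate` for the empirical squared loss on fixed data. -/
theorem expect_sgdIterate_sub_le {d N n 𝔅 T : ℕ} [NeZero n] (h𝔅 : 1 ≤ 𝔅) (hT : 1 ≤ T)
    {η₀ lam R2 : ℝ} (hη : 0 < η₀) (hlam : 0 ≤ lam) (hR2 : 0 ≤ R2)
    (a : Fin N → RVec d) (b : Fin N → ℝ) (x : Fin n → RVec d) (y : Fin n → ℝ)
    (hx : ∀ r, ‖features a b (x r)‖ ^ 2 ≤ R2) {v : RVec N} (hv : ‖v‖ ≤ lam) :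
    (Finset.expect Finset.univ fun j : Finset.Icc 1 T → Fin 𝔅 → Fin n =>
        Finset.expect Finset.univ fun r =>
          (inner ℝ (sgdIterate η₀ lam a b x y (extendBatch j) T) (features a b (x r)) - y r) ^ 2)
      - (Finset.expect Finset.univ fun r => (inner ℝ v (features a b (x r)) - y r) ^ 2)
      ≤ (2 * lam ^ 2 / η₀ + η₀ * (8 * (lam ^ 2 * R2 ^ 2
          + R2 * Finset.expect Finset.univ fun r => y r ^ 2)))
        * (2 + Real.log T) / √(T : ℝ) := by
  classical
  have : NeZero 𝔅 := ⟨by omega⟩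
  have h𝔅0 : (0 : ℝ) < 𝔅 := by exact_mod_cast h𝔅
  set φ : Fin n → RVec N := fun r => features a b (x r) with hφ
  set q : RVec N → Fin n → RVec N := fun w r => (inner ℝ w (φ r) - y r) • φ r with hq
  have hy0 : 0 ≤ Finset.expect Finset.univ fun r => y r ^ 2 :=
    Finset.expect_nonneg fun r _ => sq_nonneg _
  have hbatch : ∀ h : Fin n → ℝ, Finset.expect Finset.univ (fun u : Fin 𝔅 → Fin n =>
      (1 / (𝔅 : ℝ)) * ∑ i, h (u i)) = Finset.expect Finset.univ h := by
    intro h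
    rw [← Finset.mul_expect, Finset.expect_sum_comm]
    simp only [expect_apply_eq]
    rw [Finset.sum_const, Finset.card_univ, Fintype.card_fin, nsmul_eq_mul]
    field_simp
  refine sgd_last_iterate (E := RVec N) (β := Fin 𝔅 → Fin n) hT
    (f := fun w => Finset.expect Finset.univ fun r => (inner ℝ w (φ r) - y r) ^ 2)
    (g := fun w u => (2 / (𝔅 : ℝ)) • ∑ i, q w (u i)) hη hlam (by positivity)
    (proj := projBall lam) (norm_projBall_le hlam) (norm_projBall_sub_le hlam) ?_ ?_
    (fun j t => sgdIterate η₀ lam a b x y (extendBatch j) t) (fun j => rfl) ?_ hv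
  · intro w v _ _
    have e1 : ∀ u : Fin 𝔅 → Fin n, inner ℝ ((2 / (𝔅 : ℝ)) • ∑ i, q w (u i)) (w - v)
        = 1 / (𝔅 : ℝ) * ∑ i, 2 * inner ℝ (q w (u i)) (w - v) := by
      intro u
      rw [inner_smul_left, sum_inner, ← Finset.mul_sum, RCLike.conj_to_real]
      ring
    simp only [e1]
    rw [hbatch fun r => 2 * inner ℝ (q w r) (w - v), ← Finset.expect_sub_distrib]
    refine Finset.expect_le_expect fun r _ => ?_
    simp only [hq]
    rw [inner_smul_left, inner_sub_right, RCLike.conj_to_real, real_inner_comm w,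
      real_inner_comm v]
    nlinarith [sq_nonneg (inner ℝ w (φ r) - inner ℝ v (φ r))]
  · intro w hw
    have hqn : ∀ r, ‖q w r‖ ^ 2 ≤ 2 * (lam ^ 2 * R2 ^ 2 + R2 * y r ^ 2) := by
      intro r
      simp only [hq]
      rw [norm_smul, mul_pow, Real.norm_eq_abs, sq_abs]
      have h1 : (inner ℝ w (φ r)) ^ 2 ≤ lam ^ 2 * R2 := by
        calc (inner ℝ w (φ r)) ^ 2 ≤ (‖w‖ * ‖φ r‖) ^ 2 :=
              sq_le_sq' (by linarith [neg_abs_le (inner ℝ w (φ r)),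
                abs_real_inner_le_norm w (φ r)])
                (real_inner_le_norm w (φ r))
          _ = ‖w‖ ^ 2 * ‖φ r‖ ^ 2 := by ring
          _ ≤ lam ^ 2 * R2 := by gcongr; exact hx r
      have h2 : (inner ℝ w (φ r) - y r) ^ 2 ≤ 2 * (lam ^ 2 * R2 + y r ^ 2) := by
        nlinarith [sq_nonneg (inner ℝ w (φ r) + y r)]
      calc _ ≤ (2 * (lam ^ 2 * R2 + y r ^ 2)) * R2 := by gcongr; exact hx r
        _ = _ := by ring
    have e1 : ∀ u : Fin 𝔅 → Fin n, ‖(2 / (𝔅 : ℝ)) • ∑ i, q w (u i)‖ ^ 2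
        ≤ 1 / (𝔅 : ℝ) * ∑ i, 4 * ‖q w (u i)‖ ^ 2 := by
      intro u
      rw [norm_smul, mul_pow, Real.norm_of_nonneg (by positivity), ← Finset.mul_sum]
      have h1 : ‖∑ i, q w (u i)‖ ^ 2 ≤ (𝔅 : ℝ) * ∑ i, ‖q w (u i)‖ ^ 2 := by
        refine (pow_le_pow_left₀ (norm_nonneg _) (norm_sum_le _ _) 2).trans ?_
        simpa using sq_sum_le_card_mul_sum_sq (s := (Finset.univ : Finset (Fin 𝔅)))
          (f := fun i => ‖q w (u i)‖)
      calc _ ≤ (2 / (𝔅 : ℝ)) ^ 2 * ((𝔅 : ℝ) * ∑ i, ‖q w (u i)‖ ^ 2) := by gcongr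
        _ = _ := by field_simp; ring
    refine (Finset.expect_le_expect fun u _ => e1 u).trans ?_
    rw [hbatch fun r => 4 * ‖q w r‖ ^ 2]
    calc _ ≤ Finset.expect Finset.univ fun r => 8 * (lam ^ 2 * R2 ^ 2 + R2 * y r ^ 2) :=
          Finset.expect_le_expect fun r _ => by linarith [hqn r]
      _ = _ := by
          rw [← Finset.mul_expect, Finset.expect_add_distrib, Finset.mul_expect (M := ℝ) _ _ R2,
            Finset.expect_const Finset.univ_nonempty]
  · intro j t ht
    obtain ⟨s, rfl⟩ : ∃ s, t = s + 1 := ⟨t - 1, by have := (Finset.mem_Icc.1 ht).1; omega⟩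
    have e1 : ∀ i, extendBatch j (s + 1) i = j ⟨s + 1, ht⟩ i := fun i => by
      simp only [extendBatch, dif_pos ht]
    rw [sgdIterate]
    simp only [e1, hq, hφ, smul_smul]
    congr 3
    rw [Real.sqrt_eq_rpow, Real.rpow_neg (by positivity)]
    ring

/-! ### Representation of the target by random features -/

theorem Polynomial.abs_eval_le (p : Polynomial ℝ) :
    ∃ K > 0, ∀ z : ℝ, |p.eval z| ≤ K * (1 + |z|) ^ p.natDegree := by
  refine ⟨∑ i ∈ Finset.range (p.natDegree + 1), |p.coeff i| + 1, by positivity, fun z => ?_⟩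
  rw [Polynomial.eval_eq_sum_range]
  calc _ ≤ ∑ i ∈ Finset.range (p.natDegree + 1), |p.coeff i * z ^ i| :=
        Finset.abs_sum_le_sum_abs _ _
    _ ≤ ∑ i ∈ Finset.range (p.natDegree + 1), |p.coeff i| * (1 + |z|) ^ p.natDegree := by
        refine Finset.sum_le_sum fun i hi => ?_
        rw [abs_mul, abs_pow]
        gcongr
        have hi' : i ≤ p.natDegree := Nat.lt_succ_iff.1 (Finset.mem_range.1 hi)
        calc |z| ^ i ≤ (1 + |z|) ^ i := by gcongr; linarith
          _ ≤ _ := pow_le_pow_right₀ (by linarith [abs_nonneg z]) hi'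
    _ ≤ _ := by
        rw [← Finset.sum_mul]
        gcongr
        linarith

theorem pow_mul_exp_neg_sq_le (m : ℕ) {M ε : ℝ} (hε : 0 < ε) {r : ℝ}
    (hr : 0 ≤ r) (hM : 0 ≤ M) :
    (2 + M * r) ^ m * Real.exp (-ε * r ^ 2) ≤ m.factorial * Real.exp (2 + M ^ 2 / (4 * ε)) := by
  have h1 := Real.pow_div_factorial_le_exp (2 + M * r) (by positivity) m
  rw [div_le_iff₀ (by positivity)] at h1
  have h2 : 2 + M * r + -ε * r ^ 2 ≤ 2 + M ^ 2 / (4 * ε) := by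
    have : 2 + M ^ 2 / (4 * ε) - (2 + M * r + -ε * r ^ 2) = (2 * ε * r - M) ^ 2 / (4 * ε) := by
      field_simp; ring
    have h3 : 0 ≤ (2 * ε * r - M) ^ 2 / (4 * ε) := by positivity
    linarith
  calc _ ≤ (Real.exp (2 + M * r) * m.factorial) * Real.exp (-ε * r ^ 2) := by gcongr
    _ = m.factorial * Real.exp (2 + M * r + -ε * r ^ 2) := by rw [Real.exp_add (2 + M * r)]; ring
    _ ≤ _ := by gcongr

/-- The law of the biases. -/
noncomputable def biasLaw (πb : ℝ → ℝ) : Measure ℝ :=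
  volume.withDensity fun z => ENNReal.ofReal (πb z)

theorem IsPolyDecayDensity.isProbabilityMeasure {πb : ℝ → ℝ} (h : IsPolyDecayDensity πb) :
    IsProbabilityMeasure (biasLaw πb) := ⟨by simp [biasLaw, h.lintegral_eq_one]⟩

theorem integrable_biasLaw_iff {πb : ℝ → ℝ} (h : IsPolyDecayDensity πb) {f : ℝ → ℝ} :
    Integrable f (biasLaw πb) ↔ Integrable fun z => πb z * f z := by
  rw [biasLaw, integrable_withDensity_iff_integrable_smul' h.measurable.ennreal_ofReal
    (.of_forall fun _ => ENNReal.ofReal_lt_top)]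
  simp only [ENNReal.toReal_ofReal (h.pos _).le, smul_eq_mul]

theorem integral_biasLaw {πb : ℝ → ℝ} (h : IsPolyDecayDensity πb) (f : ℝ → ℝ) :
    ∫ z, f z ∂(biasLaw πb) = ∫ z, πb z * f z := by
  rw [biasLaw, integral_withDensity_eq_integral_toReal_smul h.measurable.ennreal_ofReal
    (.of_forall fun _ => ENNReal.ofReal_lt_top)]
  simp only [ENNReal.toReal_ofReal (h.pos _).le, smul_eq_mul]

theorem le_one_add_pow_four {r : ℝ} : r ≤ 1 + r ^ 4 := by
  nlinarith [sq_nonneg (r ^ 2 - 1 / 2), sq_nonneg (r - 1), sq_nonneg (r - 1 / 2)]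

theorem norm_le_of_abs_le {d : ℕ} {M : ℝ} (hM : 0 ≤ M) {x : RVec d} (hx : ∀ l, |x l| ≤ M) :
    ‖x‖ ≤ M * √(d : ℝ) := by
  rw [EuclideanSpace.norm_eq]
  refine Real.sqrt_le_iff.2 ⟨by positivity, ?_⟩
  rw [mul_pow, Real.sq_sqrt (by positivity)]
  calc ∑ i, ‖x i‖ ^ 2 ≤ ∑ _i : Fin d, M ^ 2 := Finset.sum_le_sum fun i _ => by
        rw [Real.norm_eq_abs]
        exact pow_le_pow_left₀ (abs_nonneg _) (hx i) 2
    _ = M ^ 2 * d := by simp [mul_comm]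

theorem relu_inner_add_le {d : ℕ} {M : ℝ} (hM : 0 ≤ M) {x : RVec d} (hx : ∀ l, |x l| ≤ M)
    (a : RVec d) (b : ℝ) : relu (inner ℝ a x + b) ≤ M * √(d : ℝ) * ‖a‖ + |b| := by
  calc relu (inner ℝ a x + b) ≤ |inner ℝ a x + b| := relu_le_abs _
    _ ≤ |inner ℝ a x| + |b| := abs_add_le _ _
    _ ≤ ‖a‖ * ‖x‖ + |b| := by gcongr; exact abs_real_inner_le_norm a x
    _ ≤ ‖a‖ * (M * √(d : ℝ)) + |b| := by gcongr; exact norm_le_of_abs_le hM hx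
    _ = _ := by ring

/-- **Random feature representation.** On the cube of radius `M`, the function `x ↦ E[Φ(x + V)]`
is the mean of a bounded function of a random neuron times the output of that neuron. The function
is the ridge representation of the Fourier integral divided by the density of the neuron; the
tails of the `t`-distribution and of `π_b` are heavy enough for the quotient to be bounded, with
polynomial dependence on the dimension. -/
theorem exists_random_feature_representation {πb : ℝ → ℝ} (hπb : IsPolyDecayDensity πb)
    (hB4 : Integrable (fun z : ℝ => z ^ 4 * πb z)) :
    ∃ m : ℕ, ∀ ν C M : ℝ, 4 < ν → 1 / ((2 : ℝ) ^ (3 / 2 : ℝ) * Real.pi) < C → 0 < M →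
    ∃ F > (0 : ℝ), ∀ (d : ℕ) [NeZero d] [IsProbabilityMeasure (multivariateT ν d)]
      (μ : Measure (RVec d)) [IsProbabilityMeasure μ] (Φ : RVec d → ℝ), Integrable Φ →
      (∀ ξ : RVec d, ‖charFun μ ξ‖ ≤ Real.exp (-C * ‖ξ‖ ^ 2)) →
      ∃ f : RVec d × ℝ → ℝ, Measurable f ∧
        (∀ p, |f p| ≤ F * (∫ x, |Φ x|) * (ν + d) ^ (m + 1)) ∧
        ∀ x : RVec d, (∀ l, |x l| ≤ M) →
          ∫ p, f p * relu (inner ℝ p.1 x + p.2) ∂((multivariateT ν d).prod (biasLaw πb))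
            = ∫ v, Φ (x + v) ∂μ := by
  obtain ⟨pb, hpb⟩ := hπb.poly
  obtain ⟨Kb, hKb0, hKb⟩ := pb.abs_eval_le
  have := hπb.isProbabilityMeasure
  refine ⟨pb.natDegree, fun ν C M hν hC hM => ?_⟩
  set m := pb.natDegree
  have hν0 : 0 < ν := by linarith
  have hpi := Real.pi_pos
  -- The Gaussian decay of rate `C` is split: rate `C₁` compensates the density of the
  -- `t`-distribution, the remaining rate `ε` the polynomial growth of `1 / π_b`.
  set C₁ : ℝ := 1 / (4 * Real.pi) with hC₁
  have hC₁C : C₁ < C := by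
    refine lt_of_le_of_lt ?_ hC
    rw [hC₁]
    gcongr
    calc (2 : ℝ) ^ (3 / 2 : ℝ) ≤ 2 ^ (2 : ℝ) :=
          Real.rpow_le_rpow_of_exponent_le (by norm_num) (by norm_num)
      _ = 4 := by norm_num
  have hC₁0 : 0 < C₁ := by positivity
  set ε := C - C₁ with hε
  have hε0 : 0 < ε := sub_pos.2 hC₁C
  set K₁ := Real.Gamma (ν / 2) * ν ^ (-(ν / 2)) * C₁ ^ (-(ν / 2)) * Real.exp (C₁ * ν) with hK₁
  have hK₁0 : 0 < K₁ := by
    have := Real.Gamma_pos_of_pos (show 0 < ν / 2 by positivity)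
    positivity
  set K₂ := m.factorial * Real.exp (2 + M ^ 2 / (4 * ε)) with hK₂
  have hK₂0 : 0 < K₂ := by positivity
  refine ⟨28 * Kb * K₁ * K₂, by positivity, ?_⟩
  intro d _ _ μ _ Φ hΦ hμ
  obtain ⟨h, hh, hhi, hhb, hhx⟩ := exists_fourier_representation μ (hC₁0.trans hC₁C) hμ hΦ
  have hd1 : (1 : ℝ) ≤ d := by exact_mod_cast NeZero.one_le (n := d)
  have hΦ0 : 0 ≤ ∫ x, |Φ x| := integral_nonneg fun _ => abs_nonneg _
  set R : RVec d → ℝ := fun a => M * √(d : ℝ) * ‖a‖ with hR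
  have hR0 : ∀ a, 0 ≤ R a := fun a => by positivity
  set f : RVec d × ℝ → ℝ := fun p =>
    (h p.1 * reluKernel (R p.1) p.2).re / (tDensity ν d p.1 * πb p.2) with hf
  have hRm : Measurable fun p : RVec d × ℝ => reluKernel (R p.1) p.2 :=
    measurable_reluKernel.comp (by fun_prop : Measurable fun p : RVec d × ℝ => (R p.1, p.2))
  have hfm : Measurable f := by
    have h1 : Measurable fun p : RVec d × ℝ => πb p.2 := hπb.measurable.comp measurable_snd
    have h2 : Measurable fun p : RVec d × ℝ => h p.1 := hh.measurable.comp measurable_fst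
    exact (Complex.measurable_re.comp (h2.mul hRm)).div
      (((measurable_tDensity ν d).comp measurable_fst).mul h1)
  have hfb : ∀ p, |f p| ≤ 28 * Kb * K₁ * K₂ * (∫ x, |Φ x|) * (ν + d) ^ (m + 1) := by
    rintro ⟨a, b⟩
    have hnn : 0 ≤ 28 * Kb * K₁ * K₂ * (∫ x, |Φ x|) * (ν + d) ^ (m + 1) := by positivity
    by_cases hb : R a + 1 < |b|
    · simp only [hf, reluKernel_eq_zero (hR0 a) hb, mul_zero, Complex.zero_re, zero_div, abs_zero]
      exact hnn
    rw [not_lt] at hb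
    have hT := tDensity_pos hν0 d a
    have hb0 := hπb.pos b
    -- The kernel confines `b` to `|b| ≤ R a + 1`, so that `1 / π_b` grows polynomially in `a`.
    have h1 : 1 / πb b ≤ Kb * ((ν + d) ^ m * (2 + M * ‖a‖) ^ m) := by
      calc 1 / πb b ≤ pb.eval b := by rw [div_le_iff₀ hb0]; exact (hpb b).2
        _ ≤ Kb * (1 + |b|) ^ m := (le_abs_self _).trans (hKb b)
        _ ≤ Kb * ((ν + d) * (2 + M * ‖a‖)) ^ m := by
            gcongr
            have h2 : √(d : ℝ) ≤ ν + d := by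
              have : √(d : ℝ) ≤ d := Real.sqrt_le_iff.2 ⟨by positivity, by nlinarith⟩
              linarith
            calc 1 + |b| ≤ 1 * 2 + √(d : ℝ) * (M * ‖a‖) := by
                  simp only [hR] at hb; linarith
              _ ≤ (ν + d) * 2 + (ν + d) * (M * ‖a‖) := by gcongr; linarith
              _ = _ := by ring
        _ = _ := by rw [mul_pow]
    have h2 : ‖h a‖ / tDensity ν d a
        ≤ (∫ x, |Φ x|) * (K₁ * (ν + d) * Real.exp (-ε * ‖a‖ ^ 2)) := by
      calc ‖h a‖ / tDensity ν d a
          ≤ ((2 * Real.pi) ^ d)⁻¹ * (∫ x, |Φ x|) * Real.exp (-C * ‖a‖ ^ 2) / tDensity ν d a := by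
            gcongr; exact hhb a
        _ = (∫ x, |Φ x|) * ((((2 * Real.pi) ^ d)⁻¹ * Real.exp (-C₁ * ‖a‖ ^ 2) / tDensity ν d a)
            * Real.exp (-ε * ‖a‖ ^ 2)) := by
            rw [show -C * ‖a‖ ^ 2 = -C₁ * ‖a‖ ^ 2 + -ε * ‖a‖ ^ 2 by rw [hε]; ring, Real.exp_add]
            ring
        _ ≤ _ := by gcongr; exact exp_div_tDensity_le hν0 le_rfl d a
    have h3 := pow_mul_exp_neg_sq_le m hε0 (norm_nonneg a) hM.le
    calc |f (a, b)| ≤ ‖h a‖ * 28 / (tDensity ν d a * πb b) := by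
          simp only [hf, abs_div, abs_of_pos (mul_pos hT hb0)]
          gcongr
          refine (Complex.abs_re_le_norm _).trans ?_
          rw [norm_mul]
          gcongr
          exact norm_reluKernel_le _ _
      _ = 28 * (‖h a‖ / tDensity ν d a) * (1 / πb b) := by field_simp
      _ ≤ 28 * ((∫ x, |Φ x|) * (K₁ * (ν + d) * Real.exp (-ε * ‖a‖ ^ 2)))
          * (Kb * ((ν + d) ^ m * (2 + M * ‖a‖) ^ m)) := by gcongr
      _ = 28 * Kb * K₁ * (∫ x, |Φ x|) * (ν + d) ^ (m + 1)
          * ((2 + M * ‖a‖) ^ m * Real.exp (-ε * ‖a‖ ^ 2)) := by ring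
      _ ≤ 28 * Kb * K₁ * (∫ x, |Φ x|) * (ν + d) ^ (m + 1) * K₂ := by gcongr
      _ = _ := by ring
  refine ⟨f, hfm, hfb, fun x hx => ?_⟩
  have hiA : Integrable (fun a : RVec d => ‖a‖) (multivariateT ν d) := by
    refine ((integrable_const (1 : ℝ)).add (fourth_moment_multivariateT hν d).1).mono'
      (by fun_prop) (.of_forall fun a => ?_)
    rw [norm_norm]
    exact le_one_add_pow_four
  have hiB : Integrable (fun b : ℝ => |b|) (biasLaw πb) := by
    have h4 : Integrable (fun b : ℝ => b ^ 4) (biasLaw πb) := by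
      rw [integrable_biasLaw_iff hπb]; simpa only [mul_comm] using hB4
    refine ((integrable_const (1 : ℝ)).add h4).mono' (by fun_prop) (.of_forall fun b => ?_)
    rw [Real.norm_of_nonneg (abs_nonneg b)]
    have := le_one_add_pow_four (r := |b|)
    rwa [Even.pow_abs ⟨2, rfl⟩] at this
  have hint : Integrable (fun p : RVec d × ℝ => f p * relu (inner ℝ p.1 x + p.2))
      ((multivariateT ν d).prod (biasLaw πb)) := by
    refine Integrable.mono'
      (g := fun p => 28 * Kb * K₁ * K₂ * (∫ x, |Φ x|) * (ν + d) ^ (m + 1) *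
        (M * √(d : ℝ) * ‖p.1‖ + |p.2|)) ?_ ?_ (.of_forall fun p => ?_)
    · exact (((hiA.comp_fst (biasLaw πb)).const_mul _).add
        (hiB.comp_snd (multivariateT ν d))).const_mul _
    · exact (hfm.mul (measurable_relu.comp (by fun_prop))).aestronglyMeasurable
    · rw [norm_mul, Real.norm_eq_abs, Real.norm_of_nonneg (relu_nonneg _)]
      gcongr
      · exact relu_nonneg _
      · exact hfb p
      · exact relu_inner_add_le hM.le hx _ _
  rw [integral_prod _ hint, integral_multivariateT hν0]
  have hinner : ∀ a : RVec d, tDensity ν d a *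
      ∫ b, f (a, b) * relu (inner ℝ a x + b) ∂(biasLaw πb)
      = (h a * Complex.exp ((inner ℝ a x : ℝ) * Complex.I)).re := by
    intro a
    have hz : |inner ℝ a x| ≤ R a := by
      refine (abs_real_inner_le_norm a x).trans ?_
      rw [mul_comm]
      simp only [hR]
      gcongr
      exact norm_le_of_abs_le hM.le hx
    have hk := integral_reluKernel_mul_relu hz
    have hki : Integrable fun b : ℝ => reluKernel (R a) b * (relu (inner ℝ a x + b) : ℂ) := by
      refine Integrable.of_integral_ne_zero ?_
      rw [hk]; exact Complex.exp_ne_zero _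
    have hT := (tDensity_pos hν0 d a).ne'
    rw [integral_biasLaw hπb, ← integral_const_mul, ← hk, ← integral_const_mul]
    refine Eq.trans ?_ (integral_re (𝕜 := ℂ) (hki.const_mul (h a)))
    congr 1; ext b
    have hb := (hπb.pos b).ne'
    rw [← mul_assoc (h a)]
    simp only [hf, RCLike.re_to_complex, Complex.re_mul_ofReal]
    field_simp
  simp only [hinner]
  have hI : Integrable fun a => h a * Complex.exp ((inner ℝ a x : ℝ) * Complex.I) := by
    refine hhi.norm.mono' (by fun_prop) (.of_forall fun a => ?_)
    rw [norm_mul, Complex.norm_exp_ofReal_mul_I, mul_one]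
  refine (integral_re (𝕜 := ℂ) hI).trans ?_
  rw [← hhx x]
  exact Complex.ofReal_re _

/-! ### Generalization error for fixed features -/

section ProductMeasure

variable {α : Type*} [MeasurableSpace α] {μ : Measure α} [IsProbabilityMeasure μ] {n : ℕ}

theorem integrable_pi_expect {h : α → ℝ} (hh : Integrable h μ) :
    Integrable (fun D : Fin n → α => Finset.expect Finset.univ fun i => h (D i))
      (Measure.pi fun _ => μ) := by
  simp only [Finset.expect_eq_sum_div_card]
  refine (integrable_finsetSum _ fun i _ => ?_).div_const _
  exact (measurePreserving_eval (fun _ : Fin n => μ) i).integrable_comp_of_integrable hh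

theorem integral_pi_expect [NeZero n] {h : α → ℝ} (hh : Integrable h μ) :
    ∫ D : Fin n → α, Finset.expect Finset.univ (fun i => h (D i)) ∂(Measure.pi fun _ => μ)
      = ∫ x, h x ∂μ := by
  simp only [Finset.expect_eq_sum_div_card]
  have h1 : ∀ i : Fin n, ∫ D : Fin n → α, h (D i) ∂(Measure.pi fun _ => μ) = ∫ x, h x ∂μ := by
    intro i
    have := (measurePreserving_eval (fun _ : Fin n => μ) i).map_eq
    conv_rhs => rw [← this]
    exact (integral_map (measurable_pi_apply i).aemeasurable
      (by rw [this]; exact hh.aestronglyMeasurable)).symm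
  have h2 : ∀ i : Fin n, Integrable (fun D : Fin n → α => h (D i)) (Measure.pi fun _ => μ) :=
    fun i => (measurePreserving_eval (fun _ : Fin n => μ) i).integrable_comp_of_integrable hh
  rw [integral_div, integral_finsetSum _ fun i _ => h2 i]
  simp only [h1]
  have : (n : ℝ) ≠ 0 := by exact_mod_cast NeZero.ne n
  simp [this]

/-- The empirical mean of a square integrable function has mean square error at most
`(∫ h²) / n`. -/
theorem integral_pi_expect_sub_sq_le [NeZero n] {h : α → ℝ} (hh : MemLp h 2 μ) :
    Integrable (fun D : Fin n → α =>
        ((Finset.expect Finset.univ fun i => h (D i)) - ∫ x, h x ∂μ) ^ 2) (Measure.pi fun _ => μ) ∧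
    ∫ D : Fin n → α, ((Finset.expect Finset.univ fun i => h (D i)) - ∫ x, h x ∂μ) ^ 2
        ∂(Measure.pi fun _ => μ) ≤ (∫ x, h x ^ 2 ∂μ) / n := by
  have hn : (0 : ℝ) < n := by exact_mod_cast NeZero.pos n
  have hmem : ∀ i : Fin n, MemLp (fun D : Fin n → α => h (D i)) 2 (Measure.pi fun _ => μ) :=
    fun i => hh.comp_measurePreserving (measurePreserving_eval (fun _ : Fin n => μ) i)
  have hmean : MemLp (fun D : Fin n → α => Finset.expect Finset.univ fun i => h (D i)) 2
      (Measure.pi fun _ => μ) := by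
    simp only [Finset.expect_eq_sum_div_card, div_eq_inv_mul]
    exact (memLp_finsetSum _ fun i _ => hmem i).const_mul _
  refine ⟨(hmean.sub (memLp_const _)).integrable_sq, ?_⟩
  rw [← integral_pi_expect (hh.integrable one_le_two) (n := n),
    ← variance_eq_integral hmean.aestronglyMeasurable.aemeasurable]
  have h1 : (fun D : Fin n → α => Finset.expect Finset.univ fun i => h (D i))
      = fun D => (n : ℝ)⁻¹ * (∑ i, fun D : Fin n → α => h (D i)) D := by
    ext D
    simp [Finset.expect_eq_sum_div_card, div_eq_inv_mul]
  rw [h1, variance_const_mul, variance_sum_pi fun _ => hh]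
  have h2 : variance h μ ≤ ∫ x, h x ^ 2 ∂μ := variance_le_expectation_sq hh.aestronglyMeasurable
  simp only [Finset.sum_const, Finset.card_univ, Fintype.card_fin, nsmul_eq_mul]
  calc _ = variance h μ / n := by field_simp
    _ ≤ _ := by gcongr

end ProductMeasure

/-- The gap between population and empirical square loss of a linear predictor, uniformly over
the ball of radius `lam`: it is controlled by the Frobenius error of the empirical second moment
matrix and the Euclidean error of the empirical correlation with the response. -/
theorem loss_gap_le {α : Type*} [MeasurableSpace α] {μ : Measure α} {n : ℕ} [NeZero n] {N : ℕ}
    {u : Fin N → α → ℝ} {y : α → ℝ}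
    (huu : ∀ k l, Integrable (fun p => u k p * u l p) μ)
    (huy : ∀ k, Integrable (fun p => u k p * y p) μ) (hy : Integrable (fun p => y p ^ 2) μ)
    {lam τ₁ τ₂ : ℝ} (hlam : 0 ≤ lam) (hτ₁ : 0 < τ₁) (hτ₂ : 0 < τ₂) {w : Fin N → ℝ}
    (hw : ∑ k, w k ^ 2 ≤ lam ^ 2) (D : Fin n → α) :
    ∫ p, (∑ k, w k * u k p - y p) ^ 2 ∂μ
        - (Finset.expect Finset.univ fun i => (∑ k, w k * u k (D i) - y (D i)) ^ 2)
      ≤ lam ^ 2 / 2 * (τ₁ * (∑ q : Fin N × Fin N, ((Finset.expect Finset.univ fun i =>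
            u q.1 (D i) * u q.2 (D i)) - ∫ p, u q.1 p * u q.2 p ∂μ) ^ 2) + 1 / τ₁)
        + lam * (τ₂ * (∑ k, ((Finset.expect Finset.univ fun i =>
            u k (D i) * y (D i)) - ∫ p, u k p * y p ∂μ) ^ 2) + 1 / τ₂)
        + (∫ p, y p ^ 2 ∂μ - Finset.expect Finset.univ fun i => y (D i) ^ 2) := by
  have hexp : ∀ p, (∑ k, w k * u k p - y p) ^ 2
      = ∑ q : Fin N × Fin N, (w q.1 * w q.2) * (u q.1 p * u q.2 p)
        - ∑ k, (2 * w k) * (u k p * y p) + y p ^ 2 := by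
    intro p
    have h1 : ∑ q : Fin N × Fin N, (w q.1 * w q.2) * (u q.1 p * u q.2 p)
        = (∑ k, w k * u k p) * ∑ l, w l * u l p := by
      rw [Finset.sum_mul_sum, ← Finset.univ_product_univ, Finset.sum_product]
      exact Finset.sum_congr rfl fun k _ => Finset.sum_congr rfl fun l _ => by ring
    have h2 : ∑ k, (2 * w k) * (u k p * y p) = 2 * (∑ k, w k * u k p) * y p := by
      rw [Finset.mul_sum, Finset.sum_mul]
      exact Finset.sum_congr rfl fun k _ => by ring
    rw [h1, h2]; ring
  simp only [hexp]
  have i1 : Integrable (fun p => ∑ q : Fin N × Fin N, (w q.1 * w q.2) * (u q.1 p * u q.2 p)) μ :=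
    integrable_finsetSum _ fun q _ => (huu q.1 q.2).const_mul _
  have i2 : Integrable (fun p => ∑ k, (2 * w k) * (u k p * y p)) μ :=
    integrable_finsetSum _ fun k _ => (huy k).const_mul _
  have i12 : Integrable (fun p => ∑ q : Fin N × Fin N, (w q.1 * w q.2) * (u q.1 p * u q.2 p)
      - ∑ k, (2 * w k) * (u k p * y p)) μ := i1.sub i2
  rw [integral_add i12 hy, integral_sub i1 i2,
    integral_finsetSum _ (fun q _ => (huu q.1 q.2).const_mul _),
    integral_finsetSum _ (fun k _ => (huy k).const_mul _),
    Finset.expect_add_distrib, Finset.expect_sub_distrib, Finset.expect_sum_comm,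
    Finset.expect_sum_comm]
  simp only [integral_const_mul, ← Finset.mul_expect]
  set Δ : Fin N × Fin N → ℝ := fun q => (Finset.expect Finset.univ fun i =>
            u q.1 (D i) * u q.2 (D i)) - ∫ p, u q.1 p * u q.2 p ∂μ with hΔ
  set δ : Fin N → ℝ := fun k => (Finset.expect Finset.univ fun i =>
            u k (D i) * y (D i)) - ∫ p, u k p * y p ∂μ with hδ
  have hww : ∑ q : Fin N × Fin N, (w q.1 * w q.2) ^ 2 ≤ lam ^ 2 * lam ^ 2 := by
    have : ∑ q : Fin N × Fin N, (w q.1 * w q.2) ^ 2 = (∑ k, w k ^ 2) * ∑ l, w l ^ 2 := by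
      rw [Finset.sum_mul_sum, ← Finset.univ_product_univ, Finset.sum_product]
      exact Finset.sum_congr rfl fun k _ => Finset.sum_congr rfl fun l _ => by ring
    rw [this]
    have h0 : 0 ≤ ∑ k, w k ^ 2 := Finset.sum_nonneg fun k _ => sq_nonneg _
    gcongr
  -- Cauchy–Schwarz, then the weighted inequality between geometric and arithmetic means
  have amgm : ∀ {s τ a : ℝ}, 0 ≤ s → 0 < τ → 0 ≤ a → ∀ z, z ^ 2 ≤ a ^ 2 * s →
      z ≤ a / 2 * (τ * s + 1 / τ) := by
    intro s τ a hs hτ ha z hz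
    have h1 : 0 ≤ a / 2 * (τ * s + 1 / τ) := by positivity
    refine le_of_sq_le_sq (hz.trans ?_) h1
    have h2 : (a / 2 * (τ * s + 1 / τ)) ^ 2 - a ^ 2 * s = (a / 2 * (τ * s - 1 / τ)) ^ 2 := by
      field_simp; ring
    linarith [sq_nonneg (a / 2 * (τ * s - 1 / τ))]
  have b1 : ∑ q : Fin N × Fin N, (w q.1 * w q.2) * (-Δ q)
      ≤ lam ^ 2 / 2 * (τ₁ * (∑ q, Δ q ^ 2) + 1 / τ₁) := by
    refine amgm (Finset.sum_nonneg fun q _ => sq_nonneg _) hτ₁ (sq_nonneg lam) _ ?_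
    refine (Finset.sum_mul_sq_le_sq_mul_sq _ _ _).trans ?_
    simp only [neg_sq]
    have h0 : 0 ≤ ∑ q, Δ q ^ 2 := Finset.sum_nonneg fun k _ => sq_nonneg _
    calc _ ≤ (lam ^ 2 * lam ^ 2) * ∑ q, Δ q ^ 2 := by gcongr
      _ = _ := by ring
  have b2 : ∑ k, w k * δ k ≤ lam / 2 * (τ₂ * (∑ k, δ k ^ 2) + 1 / τ₂) := by
    refine amgm (Finset.sum_nonneg fun q _ => sq_nonneg _) hτ₂ hlam _ ?_
    refine (Finset.sum_mul_sq_le_sq_mul_sq _ _ _).trans ?_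
    have h0 : 0 ≤ ∑ q, δ q ^ 2 := Finset.sum_nonneg fun k _ => sq_nonneg _
    gcongr
  have e1 : ∑ q : Fin N × Fin N, (w q.1 * w q.2) * (-Δ q)
      = ∑ q : Fin N × Fin N, (w q.1 * w q.2) * (∫ p, u q.1 p * u q.2 p ∂μ)
        - ∑ q : Fin N × Fin N, (w q.1 * w q.2) * (Finset.expect Finset.univ fun i =>
            u q.1 (D i) * u q.2 (D i)) := by
    rw [← Finset.sum_sub_distrib]
    exact Finset.sum_congr rfl fun q _ => by simp only [hΔ]; ring
  have e2 : 2 * ∑ k, w k * δ k = ∑ k, (2 * w k) * (Finset.expect Finset.univ fun i =>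
            u k (D i) * y (D i)) - ∑ k, (2 * w k) * ∫ p, u k p * y p ∂μ := by
    rw [← Finset.sum_sub_distrib, Finset.mul_sum]
    exact Finset.sum_congr rfl fun q _ => by simp only [hδ]; ring
  rw [e1] at b1
  linarith

theorem RVec.inner_eq_sum {N : ℕ} (w z : RVec N) : inner ℝ w z = ∑ k, w k * z k := by
  simp [PiLp.inner_apply, mul_comm]

theorem RVec.norm_sq_eq_sum {N : ℕ} (w : RVec N) : ‖w‖ ^ 2 = ∑ k, w k ^ 2 := by
  simp [EuclideanSpace.norm_sq_eq]

theorem RVec.abs_apply_le {N : ℕ} (w : RVec N) (k : Fin N) : |w k| ≤ ‖w‖ := by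
  simpa using PiLp.norm_apply_le w k

/-- If `H` is the regression function, the excess square loss of a predictor `g` with values in
`L²` is its squared `L²` distance from `H`. -/
theorem integral_sq_sub_eq_excess {d : ℕ} {μ : Measure (RVec d × ℝ)}
    [IsProbabilityMeasure μ] (hy : Integrable (fun p => p.2 ^ 2) μ) {H g : RVec d → ℝ}
    (hH : MemLp (fun p => H p.1) 2 μ) (hg : MemLp (fun p => g p.1) 2 μ)
    (hreg : ∫ p, (p.2 - H p.1) * (g p.1 - H p.1) ∂μ = 0) :
    ∫ p, (H p.1 - g p.1) ^ 2 ∂μ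
      = ∫ p, (g p.1 - p.2) ^ 2 ∂μ - ∫ p, (H p.1 - p.2) ^ 2 ∂μ := by
  have hY : MemLp (fun p : RVec d × ℝ => p.2) 2 μ :=
    (memLp_two_iff_integrable_sq measurable_snd.aestronglyMeasurable).2 hy
  have i1 : Integrable (fun p => (g p.1 - p.2) ^ 2) μ := (hg.sub hY).integrable_sq
  have i2 : Integrable (fun p => (H p.1 - p.2) ^ 2) μ := (hH.sub hY).integrable_sq
  have i3 : Integrable (fun p => (p.2 - H p.1) * (g p.1 - H p.1)) μ :=
    (hY.sub hH).integrable_mul (hg.sub hH)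
  have i12 : Integrable (fun p => (g p.1 - p.2) ^ 2 - (H p.1 - p.2) ^ 2) μ := i1.sub i2
  calc ∫ p, (H p.1 - g p.1) ^ 2 ∂μ
      = ∫ p, ((g p.1 - p.2) ^ 2 - (H p.1 - p.2) ^ 2
          + 2 * ((p.2 - H p.1) * (g p.1 - H p.1))) ∂μ := by
        congr 1; ext p; ring
    _ = _ := by
        rw [integral_add i12 (i3.const_mul 2), integral_sub i1 i2, integral_const_mul, hreg]
        ring

/-- **Oracle inequality for fixed features** `ψ`. If the output weights `W j D`, `j` random and
`D` the data, stay in the ball of radius `lam` and beat the comparator `v` in empirical risk up to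
a given optimization error, then their mean prediction error exceeds that of `v` by at most the
optimization error and the deviations of the empirical second moments. -/
theorem lintegral_excess_fixed_features_le {d N n : ℕ} [NeZero n] {μ : Measure (RVec d × ℝ)}
    [IsProbabilityMeasure μ] {ψ : RVec d → RVec N} (hψ : Measurable ψ) {R2 : ℝ}
    (hψb : ∀ᵐ p ∂μ, ‖ψ p.1‖ ^ 2 ≤ R2) (hy : Integrable (fun p => p.2 ^ 2) μ)
    {H : RVec d → ℝ} (hH : MemLp (fun p => H p.1) 2 μ)
    (hreg : ∀ g : RVec d → ℝ, MemLp (fun p => g p.1) 2 μ → Measurable g →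
      ∫ p, (p.2 - H p.1) * (g p.1 - H p.1) ∂μ = 0)
    {J : Type*} [Fintype J] [Nonempty J] {W : J → (Fin n → RVec d × ℝ) → RVec N} {lam : ℝ}
    (hlam : 0 ≤ lam) (hW : ∀ j D, ‖W j D‖ ≤ lam) {v : RVec N} {c₀ c₁ : ℝ}
    (hopt : ∀ D : Fin n → RVec d × ℝ, (∀ i, ‖ψ (D i).1‖ ^ 2 ≤ R2) →
      (Finset.expect Finset.univ fun j => Finset.expect Finset.univ fun i =>
        (inner ℝ (W j D) (ψ (D i).1) - (D i).2) ^ 2)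
      - (Finset.expect Finset.univ fun i => (inner ℝ v (ψ (D i).1) - (D i).2) ^ 2)
      ≤ c₀ + c₁ * (lam ^ 2 * R2 ^ 2 + R2 * Finset.expect Finset.univ fun i => (D i).2 ^ 2))
    {τ₁ τ₂ : ℝ} (hτ₁ : 0 < τ₁) (hτ₂ : 0 < τ₂) :
    ∫⁻ D, ENNReal.ofReal (Finset.expect Finset.univ fun j =>
        ∫ p, (H p.1 - inner ℝ (W j D) (ψ p.1)) ^ 2 ∂μ) ∂(Measure.pi fun _ : Fin n => μ)
      ≤ ENNReal.ofReal (∫ p, (H p.1 - inner ℝ v (ψ p.1)) ^ 2 ∂μ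
        + lam ^ 2 / 2 * (τ₁ * (R2 ^ 2 / n) + 1 / τ₁)
        + lam * (τ₂ * (R2 * (∫ p, p.2 ^ 2 ∂μ) / n) + 1 / τ₂)
        + (c₀ + c₁ * (lam ^ 2 * R2 ^ 2 + R2 * ∫ p, p.2 ^ 2 ∂μ))) := by
  have hn : (0 : ℝ) < n := by exact_mod_cast NeZero.pos n
  have hR2 : 0 ≤ R2 := by
    obtain ⟨p, hp⟩ := hψb.exists
    exact (sq_nonneg _).trans hp
  have hY : MemLp (fun p : RVec d × ℝ => p.2) 2 μ :=
    (memLp_two_iff_integrable_sq measurable_snd.aestronglyMeasurable).2 hy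
  set u : Fin N → RVec d × ℝ → ℝ := fun k p => ψ p.1 k with hu
  have hum : ∀ k, Measurable (u k) := fun k => by
    have : Measurable fun z : RVec N => z k := by fun_prop
    exact this.comp (hψ.comp measurable_fst)
  have hub : ∀ k, ∀ᵐ p ∂μ, u k p ^ 2 ≤ R2 := fun k => by
    filter_upwards [hψb] with p hp
    refine le_trans ?_ hp
    rw [← sq_abs]
    exact pow_le_pow_left₀ (abs_nonneg _) (RVec.abs_apply_le _ _) 2
  have huu2 : ∀ k l, MemLp (fun p => u k p * u l p) 2 μ := fun k l => by
    refine MemLp.of_bound ((hum k).mul (hum l)).aestronglyMeasurable R2 ?_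
    filter_upwards [hub k, hub l] with p h1 h2
    rw [Real.norm_eq_abs, abs_le]
    constructor <;> nlinarith [sq_nonneg (u k p - u l p), sq_nonneg (u k p + u l p)]
  have huy2 : ∀ k, MemLp (fun p => u k p * p.2) 2 μ := fun k => by
    refine (memLp_two_iff_integrable_sq ((hum k).mul measurable_snd).aestronglyMeasurable).2 ?_
    refine (hy.const_mul R2).mono' (((hum k).mul measurable_snd).pow_const 2).aestronglyMeasurable ?_
    filter_upwards [hub k] with p h1
    rw [Real.norm_of_nonneg (sq_nonneg _), Pi.mul_apply, mul_pow]
    gcongr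
  have hwψ : ∀ w : RVec N, MemLp (fun p : RVec d × ℝ => inner ℝ w (ψ p.1)) 2 μ := fun w => by
    refine MemLp.of_bound
      ((measurable_const.inner hψ).comp measurable_fst).aestronglyMeasurable (‖w‖ * √R2) ?_
    filter_upwards [hψb] with p hp
    refine (abs_real_inner_le_norm _ _).trans ?_
    gcongr
    exact Real.le_sqrt_of_sq_le hp
  set m2 := ∫ p, p.2 ^ 2 ∂μ with hm2
  set Ls := ∫ p, (H p.1 - p.2) ^ 2 ∂μ with hLs
  have hexc : ∀ w : RVec N, ∫ p, (H p.1 - inner ℝ w (ψ p.1)) ^ 2 ∂μ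
      = ∫ p, (inner ℝ w (ψ p.1) - p.2) ^ 2 ∂μ - Ls := fun w =>
    integral_sq_sub_eq_excess (g := fun x => inner ℝ w (ψ x)) hy hH (hwψ w)
      (hreg _ (hwψ w) (measurable_const.inner hψ))
  -- random quantities: the two deviations, the mean square response, the risk of `v`
  set S : (Fin n → RVec d × ℝ) → ℝ := fun D => ∑ q : Fin N × Fin N,
    ((Finset.expect Finset.univ fun i => u q.1 (D i) * u q.2 (D i))
      - ∫ p, u q.1 p * u q.2 p ∂μ) ^ 2 with hS
  set S' : (Fin n → RVec d × ℝ) → ℝ := fun D => ∑ k,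
    ((Finset.expect Finset.univ fun i => u k (D i) * (D i).2) - ∫ p, u k p * p.2 ∂μ) ^ 2 with hS'
  set y2 : (Fin n → RVec d × ℝ) → ℝ := fun D => Finset.expect Finset.univ fun i => (D i).2 ^ 2
    with hy2
  set Lv : (Fin n → RVec d × ℝ) → ℝ := fun D => Finset.expect Finset.univ fun i =>
    (inner ℝ v (ψ (D i).1) - (D i).2) ^ 2 with hLv
  set r : (Fin n → RVec d × ℝ) → ℝ := fun D =>
    lam ^ 2 / 2 * (τ₁ * S D + 1 / τ₁) + lam * (τ₂ * S' D + 1 / τ₂) + (m2 - y2 D)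
      + (c₀ + c₁ * (lam ^ 2 * R2 ^ 2 + R2 * y2 D)) + (Lv D - Ls) with hr
  have hle : ∀ᵐ D ∂(Measure.pi fun _ : Fin n => μ), Finset.expect Finset.univ (fun j =>
        ∫ p, (H p.1 - inner ℝ (W j D) (ψ p.1)) ^ 2 ∂μ) ≤ r D := by
    have hall : ∀ᵐ D ∂(Measure.pi fun _ : Fin n => μ), ∀ i, ‖ψ (D i).1‖ ^ 2 ≤ R2 :=
      ae_all_iff.2 fun i => (measurePreserving_eval (fun _ : Fin n => μ) i).quasiMeasurePreserving.ae
        hψb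
    filter_upwards [hall] with D hD
    have h1 : ∀ j, ∫ p, (H p.1 - inner ℝ (W j D) (ψ p.1)) ^ 2 ∂μ
        ≤ (Finset.expect Finset.univ fun i => (inner ℝ (W j D) (ψ (D i).1) - (D i).2) ^ 2)
          + (lam ^ 2 / 2 * (τ₁ * S D + 1 / τ₁) + lam * (τ₂ * S' D + 1 / τ₂) + (m2 - y2 D) - Ls) := by
      intro j
      have hw : ∑ k, (W j D) k ^ 2 ≤ lam ^ 2 := by
        rw [← RVec.norm_sq_eq_sum]
        exact pow_le_pow_left₀ (norm_nonneg _) (hW j D) 2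
      have := loss_gap_le (μ := μ) (u := u) (y := fun p => p.2)
        (fun k l => (huu2 k l).integrable one_le_two) (fun k => (huy2 k).integrable one_le_two) hy
        hlam hτ₁ hτ₂ hw D
      simp only [hu, ← RVec.inner_eq_sum] at this
      rw [hexc]
      simp only [hS, hS', hu, hy2, hm2]
      linarith
    refine (Finset.expect_le_expect fun j _ => h1 j).trans ?_
    rw [Finset.expect_add_distrib, Finset.expect_const Finset.univ_nonempty]
    have := hopt D hD
    simp only [hr, hLv]
    linarith
  have iS : Integrable S (Measure.pi fun _ : Fin n => μ) :=
    integrable_finsetSum _ fun q _ => (integral_pi_expect_sub_sq_le (huu2 q.1 q.2)).1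
  have iS' : Integrable S' (Measure.pi fun _ : Fin n => μ) :=
    integrable_finsetSum _ fun k _ => (integral_pi_expect_sub_sq_le (huy2 k)).1
  have iy2 : Integrable y2 (Measure.pi fun _ : Fin n => μ) := integrable_pi_expect hy
  have hLvi : Integrable (fun p : RVec d × ℝ => (inner ℝ v (ψ p.1) - p.2) ^ 2) μ :=
    ((hwψ v).sub hY).integrable_sq
  have iLv : Integrable Lv (Measure.pi fun _ : Fin n => μ) := integrable_pi_expect hLvi
  have bS : ∫ D, S D ∂(Measure.pi fun _ : Fin n => μ) ≤ R2 ^ 2 / n := by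
    simp only [hS]
    rw [integral_finsetSum _ fun q _ => (integral_pi_expect_sub_sq_le (huu2 q.1 q.2)).1]
    refine (Finset.sum_le_sum fun q _ => (integral_pi_expect_sub_sq_le (huu2 q.1 q.2)).2).trans ?_
    rw [← Finset.sum_div, ← integral_finsetSum _ fun q _ => (huu2 q.1 q.2).integrable_sq]
    gcongr
    have : ∫ p, (∑ q : Fin N × Fin N, (u q.1 p * u q.2 p) ^ 2) ∂μ ≤ ∫ _p, R2 ^ 2 ∂μ := by
      refine integral_mono_ae (integrable_finsetSum _ fun q _ => (huu2 q.1 q.2).integrable_sq)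
        (integrable_const _) ?_
      filter_upwards [hψb] with p hp
      have e1 : ∑ q : Fin N × Fin N, (u q.1 p * u q.2 p) ^ 2 = (‖ψ p.1‖ ^ 2) ^ 2 := by
        rw [RVec.norm_sq_eq_sum, sq (∑ k, _), Finset.sum_mul_sum, ← Finset.univ_product_univ,
          Finset.sum_product]
        exact Finset.sum_congr rfl fun k _ => Finset.sum_congr rfl fun l _ => by
          simp only [hu]; ring
      rw [e1]
      gcongr
    simpa using this
  have bS' : ∫ D, S' D ∂(Measure.pi fun _ : Fin n => μ) ≤ R2 * m2 / n := by
    simp only [hS']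
    rw [integral_finsetSum _ fun k _ => (integral_pi_expect_sub_sq_le (huy2 k)).1]
    refine (Finset.sum_le_sum fun k _ => (integral_pi_expect_sub_sq_le (huy2 k)).2).trans ?_
    rw [← Finset.sum_div, ← integral_finsetSum _ fun k _ => (huy2 k).integrable_sq, hm2,
      ← integral_const_mul]
    gcongr ?_ / _
    refine integral_mono_ae (integrable_finsetSum _ fun k _ => (huy2 k).integrable_sq)
      (hy.const_mul _) ?_
    filter_upwards [hψb] with p hp
    have e1 : ∑ k, (u k p * p.2) ^ 2 = ‖ψ p.1‖ ^ 2 * p.2 ^ 2 := by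
      rw [RVec.norm_sq_eq_sum, Finset.sum_mul]
      exact Finset.sum_congr rfl fun k _ => by simp only [hu]; ring
    rw [e1]
    gcongr
  have hr' : r = fun D => (lam ^ 2 / 2 * (1 / τ₁) + lam * (1 / τ₂) + m2
      + c₀ + c₁ * (lam ^ 2 * R2 ^ 2) - Ls) + (lam ^ 2 / 2 * τ₁) * S D + (lam * τ₂) * S' D
      + (c₁ * R2 - 1) * y2 D + Lv D := by
    ext D; simp only [hr]; ring
  have j1 := (integrable_const (μ := Measure.pi fun _ : Fin n => μ) (lam ^ 2 / 2 * (1 / τ₁)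
    + lam * (1 / τ₂) + m2 + c₀ + c₁ * (lam ^ 2 * R2 ^ 2) - Ls)).fun_add
      (iS.const_mul (lam ^ 2 / 2 * τ₁))
  have j2 := j1.fun_add (iS'.const_mul (lam * τ₂))
  have j3 := j2.fun_add (iy2.const_mul (c₁ * R2 - 1))
  have ir : Integrable r (Measure.pi fun _ : Fin n => μ) := by
    rw [hr']; exact j3.fun_add iLv
  have hint : ∫ D, r D ∂(Measure.pi fun _ : Fin n => μ)
      = lam ^ 2 / 2 * (τ₁ * (∫ D, S D ∂(Measure.pi fun _ : Fin n => μ)) + 1 / τ₁)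
        + lam * (τ₂ * (∫ D, S' D ∂(Measure.pi fun _ : Fin n => μ)) + 1 / τ₂)
        + (c₀ + c₁ * (lam ^ 2 * R2 ^ 2 + R2 * m2))
        + (∫ p, (inner ℝ v (ψ p.1) - p.2) ^ 2 ∂μ - Ls) := by
    have e0 : ∫ D, y2 D ∂(Measure.pi fun _ : Fin n => μ) = m2 := integral_pi_expect hy
    have e0' : ∫ D, Lv D ∂(Measure.pi fun _ : Fin n => μ)
      = ∫ p, (inner ℝ v (ψ p.1) - p.2) ^ 2 ∂μ := integral_pi_expect hLvi
    rw [hr', integral_add j3 iLv, integral_add j2 (iy2.const_mul _),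
      integral_add j1 (iS'.const_mul _), integral_add (integrable_const _) (iS.const_mul _),
      integral_const_mul, integral_const_mul, integral_const_mul, e0, e0', integral_const,
      probReal_univ, one_smul]
    ring
  calc _ ≤ ∫⁻ D, ENNReal.ofReal (r D) ∂(Measure.pi fun _ : Fin n => μ) :=
        lintegral_mono_ae (hle.mono fun D hD => ENNReal.ofReal_le_ofReal hD)
    _ = ENNReal.ofReal (∫ D, r D ∂(Measure.pi fun _ : Fin n => μ)) := by
        refine (ofReal_integral_eq_lintegral_ofReal ir (hle.mono fun D hD => le_trans ?_ hD)).symm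
        exact Finset.expect_nonneg fun j _ => integral_nonneg fun p => sq_nonneg _
    _ ≤ _ := by
        refine ENNReal.ofReal_le_ofReal ?_
        rw [hint, hexc v]
        have b1 := mul_le_mul_of_nonneg_left (mul_le_mul_of_nonneg_left bS hτ₁.le)
          (show 0 ≤ lam ^ 2 / 2 by positivity)
        have b2 := mul_le_mul_of_nonneg_left (mul_le_mul_of_nonneg_left bS' hτ₂.le) hlam
        simp only [mul_add]
        linarith

/-! ### Moments of the random features and the random oracle weights -/

/-- Bound for `|ϱ(a · x + b)|`, `p = (a, b)`, on the cube `‖x‖_∞ ≤ M`. -/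
noncomputable def neuronBound {d : ℕ} (M : ℝ) (p : RVec d × ℝ) : ℝ :=
  M * √(d : ℝ) * ‖p.1‖ + |p.2|

/-- Bound for the squared norm of the feature vector on the cube `‖x‖_∞ ≤ M`. -/
noncomputable def featureBound {d N : ℕ} (M : ℝ) (c : Fin N → RVec d × ℝ) : ℝ :=
  ∑ k, neuronBound M (c k) ^ 2

/-- The feature map of the neurons `c k = (a_k, b_k)`. -/
noncomputable def neurons {d N : ℕ} (c : Fin N → RVec d × ℝ) (x : RVec d) : RVec N :=
  features (fun i => (c i).1) (fun i => (c i).2) x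

theorem neuronBound_nonneg {d : ℕ} {M : ℝ} (hM : 0 ≤ M) (p : RVec d × ℝ) :
    0 ≤ neuronBound M p := by unfold neuronBound; positivity

@[fun_prop]
theorem measurable_neuronBound {d : ℕ} (M : ℝ) :
    Measurable (neuronBound M : RVec d × ℝ → ℝ) := by unfold neuronBound; fun_prop

theorem featureBound_nonneg {d N : ℕ} (M : ℝ) (c : Fin N → RVec d × ℝ) :
    0 ≤ featureBound M c := Finset.sum_nonneg fun _ _ => sq_nonneg _

theorem norm_sq_neurons_le {d N : ℕ} {M : ℝ} (hM : 0 ≤ M) (c : Fin N → RVec d × ℝ) {x : RVec d}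
    (hx : ∀ l, |x l| ≤ M) : ‖neurons c x‖ ^ 2 ≤ featureBound M c := by
  rw [RVec.norm_sq_eq_sum]
  refine Finset.sum_le_sum fun k _ => ?_
  exact pow_le_pow_left₀ (relu_nonneg _) (relu_inner_add_le hM hx _ _) 2

/-- Moment bounds for a random neuron; `K` does not depend on the dimension. -/
theorem exists_moment_neuronBound {πb : ℝ → ℝ} (hπb : IsPolyDecayDensity πb)
    (hB4 : Integrable (fun z : ℝ => z ^ 4 * πb z)) {ν M : ℝ} (hν : 4 < ν) (hM : 0 ≤ M) :
    ∃ K > (0 : ℝ), ∀ (d : ℕ) [NeZero d] [IsProbabilityMeasure (multivariateT ν d)],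
      Integrable (fun p => neuronBound M p ^ 4) ((multivariateT ν d).prod (biasLaw πb)) ∧
      Integrable (fun p => neuronBound M p ^ 2) ((multivariateT ν d).prod (biasLaw πb)) ∧
      ∫ p, neuronBound M p ^ 4 ∂((multivariateT ν d).prod (biasLaw πb)) ≤ (K * d ^ 2) ^ 2 ∧
      ∫ p, neuronBound M p ^ 2 ∂((multivariateT ν d).prod (biasLaw πb)) ≤ K * d ^ 2 := by
  have := hπb.isProbabilityMeasure
  have h4B : Integrable (fun b : ℝ => |b| ^ 4) (biasLaw πb) := by
    rw [integrable_biasLaw_iff hπb]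
    refine hB4.congr (.of_forall fun z => ?_)
    have : |z| ^ 4 = z ^ 4 := Even.pow_abs ⟨2, rfl⟩ z
    simp only [this, mul_comm]
  set b4 := ∫ b, |b| ^ 4 ∂(biasLaw πb) with hb4
  have hb40 : 0 ≤ b4 := integral_nonneg fun _ => by positivity
  set Q := 3 * ν ^ 2 / ((ν - 2) * (ν - 4)) with hQ
  have hQ0 : 0 ≤ Q := by
    have : 0 < ν - 2 := by linarith
    have : 0 < ν - 4 := by linarith
    positivity
  set K := √(8 * (M ^ 4 * Q + b4) + 1) with hK
  have hK0 : 0 < K := Real.sqrt_pos.2 (by positivity)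
  have hK2 : K ^ 2 = 8 * (M ^ 4 * Q + b4) + 1 := Real.sq_sqrt (by positivity)
  refine ⟨K, hK0, fun d _ _ => ?_⟩
  have hd1 : (1 : ℝ) ≤ d := by exact_mod_cast NeZero.one_le (n := d)
  obtain ⟨hA, hA'⟩ := fourth_moment_multivariateT hν d
  have iA := hA.comp_fst (biasLaw πb)
  have iB := h4B.comp_snd (multivariateT ν d)
  have hpt : ∀ p : RVec d × ℝ, neuronBound M p ^ 4
      ≤ 8 * (M ^ 4 * d ^ 2) * ‖p.1‖ ^ 4 + 8 * |p.2| ^ 4 := by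
    intro p
    have h1 : (M * √(d : ℝ) * ‖p.1‖) ^ 4 = M ^ 4 * d ^ 2 * ‖p.1‖ ^ 4 := by
      rw [mul_pow, mul_pow, show √(d : ℝ) ^ 4 = (√(d : ℝ) ^ 2) ^ 2 by ring,
        Real.sq_sqrt (by positivity)]
    have h2 := add_pow_le (show 0 ≤ M * √(d : ℝ) * ‖p.1‖ by positivity) (abs_nonneg p.2) 4
    rw [h1, show (2 : ℝ) ^ (4 - 1) = 8 by norm_num] at h2
    unfold neuronBound
    linarith
  have i4 : Integrable (fun p => neuronBound M p ^ 4)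
      ((multivariateT ν d).prod (biasLaw πb)) := by
    refine ((iA.const_mul (8 * (M ^ 4 * d ^ 2))).add (iB.const_mul 8)).mono' (by fun_prop)
      (.of_forall fun p => ?_)
    have := neuronBound_nonneg hM p
    rw [Real.norm_of_nonneg (by positivity)]
    exact hpt p
  have hm4 : ∫ p, neuronBound M p ^ 4 ∂((multivariateT ν d).prod (biasLaw πb))
      ≤ (K * d ^ 2) ^ 2 := by
    calc _ ≤ ∫ p : RVec d × ℝ, (8 * (M ^ 4 * d ^ 2) * ‖p.1‖ ^ 4 + 8 * |p.2| ^ 4)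
          ∂((multivariateT ν d).prod (biasLaw πb)) :=
          integral_mono i4 ((iA.const_mul (8 * (M ^ 4 * d ^ 2))).add (iB.const_mul 8)) hpt
      _ = 8 * (M ^ 4 * d ^ 2) * ∫ a : RVec d, ‖a‖ ^ 4 ∂(multivariateT ν d) + 8 * b4 := by
          rw [integral_add (iA.const_mul _) (iB.const_mul _), integral_const_mul,
            integral_const_mul, integral_fun_fst (fun a : RVec d => ‖a‖ ^ 4),
            integral_fun_snd (fun b : ℝ => |b| ^ 4)]
          simp [hb4]
      _ ≤ 8 * (M ^ 4 * d ^ 2) * (Q * d ^ 2) + 8 * b4 := by gcongr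
      _ ≤ (8 * (M ^ 4 * Q + b4) + 1) * (d : ℝ) ^ 4 := by
          have : (1 : ℝ) ≤ (d : ℝ) ^ 4 := one_le_pow₀ hd1
          nlinarith
      _ = _ := by rw [← hK2]; ring
  set s := K * (d : ℝ) ^ 2 with hs
  have hs0 : 0 < s := by positivity
  -- The second moment follows from the fourth.
  have hpt2 : ∀ p : RVec d × ℝ,
      neuronBound M p ^ 2 ≤ 1 / (2 * s) * neuronBound M p ^ 4 + s / 2 := by
    intro p
    have : 1 / (2 * s) * neuronBound M p ^ 4 + s / 2 - neuronBound M p ^ 2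
        = (neuronBound M p ^ 2 - s) ^ 2 / (2 * s) := by field_simp; ring
    have h0 : 0 ≤ (neuronBound M p ^ 2 - s) ^ 2 / (2 * s) := by positivity
    linarith
  have i2' := (i4.const_mul (1 / (2 * s))).fun_add (integrable_const (s / 2))
  have i2 : Integrable (fun p => neuronBound M p ^ 2)
      ((multivariateT ν d).prod (biasLaw πb)) := by
    refine i2'.mono' (by fun_prop) (.of_forall fun p => ?_)
    rw [Real.norm_of_nonneg (sq_nonneg _)]
    exact hpt2 p
  refine ⟨i4, i2, hm4, (integral_mono i2 i2' hpt2).trans ?_⟩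
  rw [integral_add (i4.const_mul _) (integrable_const _), integral_const_mul, integral_const,
    probReal_univ, one_smul]
  calc _ ≤ 1 / (2 * s) * s ^ 2 + s / 2 := by gcongr
    _ = s := by field_simp; norm_num

section RandomNeurons

variable {d N : ℕ} {τ : Measure (RVec d × ℝ)} [IsProbabilityMeasure τ] {M κ : ℝ}

theorem integral_featureBound_le [NeZero N]
    (i2 : Integrable (fun p : RVec d × ℝ => neuronBound M p ^ 2) τ)
    (h2 : ∫ p, neuronBound M p ^ 2 ∂τ ≤ κ) :
    Integrable (fun c : Fin N → RVec d × ℝ => featureBound M c) (Measure.pi fun _ => τ) ∧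
      ∫ c : Fin N → RVec d × ℝ, featureBound M c ∂(Measure.pi fun _ => τ) ≤ N * κ := by
  have hN : (N : ℝ) ≠ 0 := by exact_mod_cast NeZero.ne N
  have e : (fun c : Fin N → RVec d × ℝ => featureBound M c)
      = fun c => (N : ℝ) * Finset.expect Finset.univ fun k => neuronBound M (c k) ^ 2 := by
    ext c; simp [featureBound, Finset.expect_eq_sum_div_card, hN, mul_div_cancel₀]
  rw [e]
  refine ⟨(integrable_pi_expect i2).const_mul _, ?_⟩
  rw [integral_const_mul, integral_pi_expect i2]
  gcongr

theorem integral_featureBound_sq_le [NeZero N]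
    (i4 : Integrable (fun p : RVec d × ℝ => neuronBound M p ^ 4) τ)
    (h4 : ∫ p, neuronBound M p ^ 4 ∂τ ≤ κ ^ 2) :
    Integrable (fun c : Fin N → RVec d × ℝ => featureBound M c ^ 2) (Measure.pi fun _ => τ) ∧
      ∫ c : Fin N → RVec d × ℝ, featureBound M c ^ 2 ∂(Measure.pi fun _ => τ) ≤ (N * κ) ^ 2 := by
  have hN : (N : ℝ) ≠ 0 := by exact_mod_cast NeZero.ne N
  have hpt : ∀ c : Fin N → RVec d × ℝ, featureBound M c ^ 2
      ≤ (N : ℝ) ^ 2 * Finset.expect Finset.univ fun k => neuronBound M (c k) ^ 4 := by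
    intro c
    have h1 := sq_sum_le_card_mul_sum_sq (s := (Finset.univ : Finset (Fin N)))
      (f := fun k => neuronBound M (c k) ^ 2)
    simp only [Finset.card_univ, Fintype.card_fin, ← pow_mul] at h1
    refine h1.trans (le_of_eq ?_)
    simp only [Finset.expect_eq_sum_div_card, Finset.card_univ, Fintype.card_fin]
    field_simp
  have i := (integrable_pi_expect (n := N) i4).const_mul ((N : ℝ) ^ 2)
  have hm : Measurable fun c : Fin N → RVec d × ℝ => featureBound M c := by
    unfold featureBound; fun_prop
  have hi : Integrable (fun c : Fin N → RVec d × ℝ => featureBound M c ^ 2)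
      (Measure.pi fun _ => τ) := by
    refine i.mono' (hm.pow_const 2).aestronglyMeasurable (.of_forall fun c => ?_)
    rw [Real.norm_of_nonneg (sq_nonneg _)]
    exact hpt c
  refine ⟨hi, (integral_mono hi i hpt).trans ?_⟩
  rw [integral_const_mul, integral_pi_expect i4, mul_pow]
  gcongr

/-- Output weights of the random oracle: neuron `k` gets the weight `f(a_k, b_k) / N`. -/
noncomputable def oracleWeights (f : RVec d × ℝ → ℝ) (c : Fin N → RVec d × ℝ) : RVec N :=
  WithLp.toLp 2 fun k => f (c k) / N

theorem norm_oracleWeights_le {f : RVec d × ℝ → ℝ} {F : ℝ} (hF : 0 ≤ F) (hf : ∀ p, |f p| ≤ F)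
    (c : Fin N → RVec d × ℝ) : ‖oracleWeights f c‖ ≤ F / √(N : ℝ) := by
  refine le_of_sq_le_sq ?_ (by positivity)
  rw [RVec.norm_sq_eq_sum, div_pow, Real.sq_sqrt (by positivity)]
  rcases Nat.eq_zero_or_pos N with rfl | hN
  · simp
  have hN' : (0 : ℝ) < N := by exact_mod_cast hN
  calc ∑ k, (f (c k) / N) ^ 2 ≤ ∑ _k : Fin N, F ^ 2 / (N : ℝ) ^ 2 := by
        refine Finset.sum_le_sum fun k _ => ?_
        rw [div_pow]
        gcongr ?_ / _
        rw [← sq_abs]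
        exact pow_le_pow_left₀ (abs_nonneg _) (hf _) 2
    _ = _ := by simp; field_simp

theorem inner_oracleWeights (f : RVec d × ℝ → ℝ) (c : Fin N → RVec d × ℝ) (x : RVec d) :
    inner ℝ (oracleWeights f c) (neurons c x)
      = Finset.expect Finset.univ fun k => f (c k) * relu (inner ℝ (c k).1 x + (c k).2) := by
  rw [RVec.inner_eq_sum, Finset.expect_eq_sum_div_card, Finset.sum_div]
  simp only [Finset.card_univ, Fintype.card_fin]
  exact Finset.sum_congr rfl fun k _ => by simp only [oracleWeights, neurons, features]; ring

/-- Mean square error of the random oracle network: a Monte Carlo estimate. -/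
theorem lintegral_oracle_error_le [NeZero N] {μ : Measure (RVec d × ℝ)} [IsProbabilityMeasure μ]
    (hM : 0 ≤ M) (hx : ∀ᵐ p ∂μ, ∀ l, |p.1 l| ≤ M)
    (i2 : Integrable (fun p : RVec d × ℝ => neuronBound M p ^ 2) τ)
    (h2 : ∫ p, neuronBound M p ^ 2 ∂τ ≤ κ) {H : RVec d → ℝ} (hH : Measurable H)
    {f : RVec d × ℝ → ℝ} (hfm : Measurable f) {F : ℝ} (hf : ∀ p, |f p| ≤ F)
    (hrep : ∀ x : RVec d, (∀ l, |x l| ≤ M) → ∫ p, f p * relu (inner ℝ p.1 x + p.2) ∂τ = H x) :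
    ∫⁻ c : Fin N → RVec d × ℝ, ENNReal.ofReal (∫ p, (H p.1
        - inner ℝ (oracleWeights f c) (neurons c p.1)) ^ 2 ∂μ) ∂(Measure.pi fun _ => τ)
      ≤ ENNReal.ofReal (F ^ 2 * κ / N) := by
  simp only [inner_oracleWeights]
  have hmeas : Measurable fun z : (Fin N → RVec d × ℝ) × (RVec d × ℝ) => (H z.2.1
      - Finset.expect Finset.univ fun k =>
        f (z.1 k) * relu (inner ℝ (z.1 k).1 z.2.1 + (z.1 k).2)) ^ 2 := by
    simp only [Finset.expect_eq_sum_div_card]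
    have hk : ∀ k : Fin N, Measurable fun z : (Fin N → RVec d × ℝ) × (RVec d × ℝ) => z.1 k :=
      fun k => (measurable_pi_apply k).comp measurable_fst
    have h1 : ∀ k : Fin N, Measurable fun z : (Fin N → RVec d × ℝ) × (RVec d × ℝ) =>
        f (z.1 k) * relu (inner ℝ (z.1 k).1 z.2.1 + (z.1 k).2) := fun k =>
      (hfm.comp (hk k)).mul (measurable_relu.comp
        (((measurable_fst.comp (hk k)).inner (measurable_fst.comp measurable_snd)).add
          (measurable_snd.comp (hk k))))
    exact ((hH.comp (measurable_fst.comp measurable_snd)).sub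
      ((Finset.measurable_sum _ fun k _ => h1 k).div_const _)).pow_const 2
  have hle : ∀ c : Fin N → RVec d × ℝ, ENNReal.ofReal (∫ p, (H p.1 - Finset.expect Finset.univ
      fun k => f (c k) * relu (inner ℝ (c k).1 p.1 + (c k).2)) ^ 2 ∂μ)
      ≤ ∫⁻ p, ENNReal.ofReal ((H p.1 - Finset.expect Finset.univ
      fun k => f (c k) * relu (inner ℝ (c k).1 p.1 + (c k).2)) ^ 2) ∂μ := by
    intro c
    by_cases hi : Integrable (fun p : RVec d × ℝ => (H p.1 - Finset.expect Finset.univ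
      fun k => f (c k) * relu (inner ℝ (c k).1 p.1 + (c k).2)) ^ 2) μ
    · exact (ofReal_integral_eq_lintegral_ofReal hi (.of_forall fun _ => sq_nonneg _)).le
    · rw [integral_undef hi]; simp
  refine (lintegral_mono hle).trans ?_
  rw [lintegral_lintegral_swap hmeas.ennreal_ofReal.aemeasurable]
  calc _ ≤ ∫⁻ _p : RVec d × ℝ, ENNReal.ofReal (F ^ 2 * κ / N) ∂μ := by
        refine lintegral_mono_ae ?_
        filter_upwards [hx] with p hp
        have hhm : Measurable fun q : RVec d × ℝ => f q * relu (inner ℝ q.1 p.1 + q.2) := by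
          have : Measurable fun q : RVec d × ℝ => relu (inner ℝ q.1 p.1 + q.2) := by fun_prop
          exact hfm.mul this
        have hpt : ∀ q : RVec d × ℝ, (f q * relu (inner ℝ q.1 p.1 + q.2)) ^ 2
            ≤ F ^ 2 * neuronBound M q ^ 2 := by
          intro q
          rw [mul_pow, ← sq_abs (f q)]
          gcongr
          · exact hf q
          · exact relu_nonneg _
          · exact relu_inner_add_le hM hp _ _
        have hmem : MemLp (fun q : RVec d × ℝ => f q * relu (inner ℝ q.1 p.1 + q.2)) 2 τ := by
          refine (memLp_two_iff_integrable_sq hhm.aestronglyMeasurable).2 ?_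
          refine (i2.const_mul (F ^ 2)).mono' (hhm.pow_const 2).aestronglyMeasurable
            (.of_forall fun q => ?_)
          rw [Real.norm_of_nonneg (sq_nonneg _)]
          exact hpt q
        obtain ⟨h3, h4⟩ := integral_pi_expect_sub_sq_le (n := N) hmem
        rw [hrep p.1 hp] at h3 h4
        have e : ∀ c : Fin N → RVec d × ℝ, (H p.1 - Finset.expect Finset.univ
            fun k => f (c k) * relu (inner ℝ (c k).1 p.1 + (c k).2)) ^ 2
            = ((Finset.expect Finset.univ
            fun k => f (c k) * relu (inner ℝ (c k).1 p.1 + (c k).2)) - H p.1) ^ 2 :=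
          fun c => by ring
        simp only [e]
        rw [← ofReal_integral_eq_lintegral_ofReal h3 (.of_forall fun _ => sq_nonneg _)]
        refine ENNReal.ofReal_le_ofReal (h4.trans ?_)
        gcongr
        refine (integral_mono hmem.integrable_sq (i2.const_mul (F ^ 2)) hpt).trans ?_
        rw [integral_const_mul]
        gcongr
    _ = _ := by simp

end RandomNeurons

/-! ### The target function -/

/-- The function `x ↦ E[Φ(x + V)]` is continuous and bounded when `V` has a characteristic
function with Gaussian decay. -/
theorem continuous_integral_add {d : ℕ} {μ : Measure (RVec d)} [IsProbabilityMeasure μ]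
    {C : ℝ} (hC : 0 < C) (hμ : ∀ ξ, ‖charFun μ ξ‖ ≤ Real.exp (-C * ‖ξ‖ ^ 2)) {Φ : RVec d → ℝ}
    (hΦ : Integrable Φ) :
    Continuous (fun x => ∫ v, Φ (x + v) ∂μ) ∧ ∃ b, ∀ x, |∫ v, Φ (x + v) ∂μ| ≤ b := by
  obtain ⟨h, hc, hi, -, hrep⟩ := exists_fourier_representation μ hC hμ hΦ
  have hnorm : ∀ x a, ‖h a * Complex.exp ((inner ℝ a x : ℝ) * Complex.I)‖ = ‖h a‖ := by
    intro x a
    rw [norm_mul, Complex.norm_exp_ofReal_mul_I, mul_one]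
  constructor
  · have h1 : Continuous fun x => ∫ a, h a * Complex.exp ((inner ℝ a x : ℝ) * Complex.I) := by
      refine continuous_of_dominated (bound := fun a => ‖h a‖) (fun x => ?_)
        (fun x => .of_forall fun a => (hnorm x a).le) hi.norm (.of_forall fun a => by fun_prop)
      exact (show Continuous fun a : RVec d => h a * Complex.exp ((inner ℝ a x : ℝ) * Complex.I)
        by fun_prop).aestronglyMeasurable
    have h2 : (fun x => ∫ v, Φ (x + v) ∂μ)
        = fun x => (∫ a, h a * Complex.exp ((inner ℝ a x : ℝ) * Complex.I)).re := by
      ext x; rw [← hrep, Complex.ofReal_re]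
    rw [h2]
    exact Complex.continuous_re.comp h1
  · refine ⟨∫ a, ‖h a‖, fun x => ?_⟩
    rw [← Real.norm_eq_abs, ← Complex.norm_real, hrep]
    refine (norm_integral_le_integral_norm _).trans (le_of_eq ?_)
    simp only [hnorm]

/-- Change of variables for the shifted function `Φ`, which need not be measurable: the law of `V`
is absolutely continuous. -/
theorem integral_comp_add_eq {Ω : Type*} [MeasurableSpace Ω] {P : Measure Ω}
    [IsProbabilityMeasure P] {d : ℕ} {V : Ω → RVec d} (hV : Measurable V) {C : ℝ} (hC : 0 < C)
    (hμ : ∀ ξ, ‖charFun (P.map V) ξ‖ ≤ Real.exp (-C * ‖ξ‖ ^ 2)) {Φ : RVec d → ℝ}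
    (hΦ : Integrable Φ) (x : RVec d) :
    ∫ ω, Φ (x + V ω) ∂P = ∫ v, Φ (x + v) ∂(P.map V) := by
  have := Measure.isProbabilityMeasure_map (μ := P) hV.aemeasurable
  have hac := absolutelyContinuous_of_integrable_charFun (P.map V)
    (integrable_charFun_of_norm_le _ hC hμ)
  refine (integral_map hV.aemeasurable (f := fun v => Φ (x + v)) ?_).symm
  exact (hΦ.comp_add_left x).aestronglyMeasurable.mono_ac hac

/-! ### Measurability of the iterates -/

theorem measurable_features {S : Type*} [MeasurableSpace S] {d N : ℕ} {a : S → Fin N → RVec d}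
    {b : S → Fin N → ℝ} {x : S → RVec d} (ha : Measurable a) (hb : Measurable b)
    (hx : Measurable x) : Measurable fun s => features (a s) (b s) (x s) := by
  refine (WithLp.measurable_toLp 2 (Fin N → ℝ)).comp (measurable_pi_lambda _ fun k => ?_)
  exact measurable_relu.comp ((((measurable_pi_apply k).comp ha).inner hx).add
    ((measurable_pi_apply k).comp hb))

theorem measurable_projBall {N : ℕ} (r : ℝ) :
    Measurable (projBall r : RVec N → RVec N) := by
  unfold projBall
  refine Measurable.ite (measurableSet_le measurable_norm measurable_const) measurable_id ?_
  exact (measurable_const.div measurable_norm).smul measurable_id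

theorem measurable_sgdIterate {S : Type*} [MeasurableSpace S] {d N n 𝔅 : ℕ} (η₀ lam : ℝ)
    {a : S → Fin N → RVec d} {b : S → Fin N → ℝ} {x : S → Fin n → RVec d} {y : S → Fin n → ℝ}
    (ha : Measurable a) (hb : Measurable b) (hx : Measurable x) (hy : Measurable y)
    (j : ℕ → Fin 𝔅 → Fin n) (t : ℕ) :
    Measurable fun s => sgdIterate η₀ lam (a s) (b s) (x s) (y s) j t := by
  have hxr : ∀ r, Measurable fun s => x s r := fun r => (measurable_pi_apply r).comp hx
  have hyr : ∀ r, Measurable fun s => y s r := fun r => (measurable_pi_apply r).comp hy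
  induction t with
  | zero => exact measurable_const
  | succ t ih =>
    cases t with
    | zero => exact measurable_const
    | succ t =>
      simp only [sgdIterate]
      refine (measurable_projBall lam).comp (ih.sub (Measurable.fun_const_smul
        (Finset.measurable_sum _ fun i _ => ?_) _))
      have hf := measurable_features ha hb (hxr (j (t + 1) i))
      exact ((ih.inner hf).sub (hyr _)).smul hf

theorem norm_sgdIterate_le {d N n 𝔅 : ℕ} {η₀ lam : ℝ} (hlam : 0 ≤ lam) (a : Fin N → RVec d)
    (b : Fin N → ℝ) (x : Fin n → RVec d) (y : Fin n → ℝ) (j : ℕ → Fin 𝔅 → Fin n) :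
    ∀ t, ‖sgdIterate η₀ lam a b x y j t‖ ≤ lam
  | 0 => by simpa [sgdIterate] using hlam
  | 1 => by simpa [sgdIterate] using hlam
  | t + 2 => by simpa only [sgdIterate] using norm_projBall_le hlam _

/-- The iterate at time `T` only uses the batches at the times `1, …, T - 1`. -/
theorem sgdIterate_congr {d N n 𝔅 : ℕ} (η₀ lam : ℝ) (a : Fin N → RVec d)
    (b : Fin N → ℝ) (x : Fin n → RVec d) (y : Fin n → ℝ) {j j' : ℕ → Fin 𝔅 → Fin n} :
    ∀ {T : ℕ}, (∀ t, 1 ≤ t → t < T → j t = j' t) →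
      sgdIterate η₀ lam a b x y j T = sgdIterate η₀ lam a b x y j' T
  | 0, _ => rfl
  | 1, _ => rfl
  | T + 2, h => by
    simp only [sgdIterate]
    rw [sgdIterate_congr η₀ lam a b x y (T := T + 1) fun t h1 h2 => h t h1 (by omega),
      h (T + 1) (by omega) (by omega)]

theorem network_eq_inner {d N : ℕ} (a : Fin N → RVec d) (b : Fin N → ℝ) (w : RVec N)
    (x : RVec d) : network a b w x = inner ℝ w (features a b x) := by
  rw [RVec.inner_eq_sum]; rfl

/-! ### Averaging over the hidden weights -/

/-- Output weights after projected SGD with hidden neurons `c`, data `D` and batches `j`. -/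
noncomputable def sgdWeights {d N n 𝔅 T : ℕ} [NeZero n] (η₀ lam : ℝ) (c : Fin N → RVec d × ℝ)
    (D : Fin n → RVec d × ℝ) (j : Finset.Icc 1 T → Fin 𝔅 → Fin n) : RVec N :=
  sgdIterate η₀ lam (fun i => (c i).1) (fun i => (c i).2) (fun i => (D i).1) (fun i => (D i).2)
    (extendBatch j) T

theorem norm_sgdWeights_le {d N n 𝔅 T : ℕ} [NeZero n] {η₀ lam : ℝ} (hlam : 0 ≤ lam)
    (c : Fin N → RVec d × ℝ) (D : Fin n → RVec d × ℝ) (j : Finset.Icc 1 T → Fin 𝔅 → Fin n) :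
    ‖sgdWeights η₀ lam c D j‖ ≤ lam := norm_sgdIterate_le hlam _ _ _ _ _ _

theorem measurable_sgdWeights {d N n 𝔅 T : ℕ} [NeZero n] (η₀ lam : ℝ)
    (j : Finset.Icc 1 T → Fin 𝔅 → Fin n) :
    Measurable fun z : (Fin N → RVec d × ℝ) × (Fin n → RVec d × ℝ) =>
      sgdWeights η₀ lam z.1 z.2 j := by
  unfold sgdWeights
  apply measurable_sgdIterate <;> fun_prop

theorem measurable_neurons {S : Type*} [MeasurableSpace S] {d N : ℕ}
    {c : S → Fin N → RVec d × ℝ} {x : S → RVec d} (hc : Measurable c) (hx : Measurable x) :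
    Measurable fun s => neurons (c s) (x s) := by
  unfold neurons
  apply measurable_features <;> fun_prop

theorem measurable_sub_inner_sgdWeights {d N n 𝔅 T : ℕ} [NeZero n] (η₀ lam : ℝ)
    (j : Finset.Icc 1 T → Fin 𝔅 → Fin n) {H : RVec d → ℝ} (hH : Measurable H) :
    Measurable fun z : ((Fin N → RVec d × ℝ) × (Fin n → RVec d × ℝ)) × (RVec d × ℝ) =>
      H z.2.1 - inner ℝ (sgdWeights η₀ lam z.1.1 z.1.2 j) (neurons z.1.1 z.2.1) := by
  have h1 : Measurable fun z : ((Fin N → RVec d × ℝ) × (Fin n → RVec d × ℝ)) × (RVec d × ℝ) =>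
      sgdWeights η₀ lam z.1.1 z.1.2 j :=
    (measurable_sgdWeights (d := d) (N := N) η₀ lam j).comp measurable_fst
  have h2 : Measurable fun z : ((Fin N → RVec d × ℝ) × (Fin n → RVec d × ℝ)) × (RVec d × ℝ) =>
      neurons z.1.1 z.2.1 := by apply measurable_neurons <;> fun_prop
  exact (hH.comp (measurable_fst.comp measurable_snd)).sub (h1.inner h2)

/-- Mean square prediction error of the trained network in terms of the moments of a random
neuron, the sample size and the number of SGD steps. -/
theorem lintegral_excess_random_features_le {d N n 𝔅 T : ℕ} [NeZero N] [NeZero n]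
    (h𝔅 : 1 ≤ 𝔅) (hT : 1 ≤ T) {τ μ : Measure (RVec d × ℝ)} [IsProbabilityMeasure τ]
    [IsProbabilityMeasure μ] {M κ : ℝ} (hM : 0 ≤ M) (hx : ∀ᵐ p ∂μ, ∀ l, |p.1 l| ≤ M)
    (hy : Integrable (fun p => p.2 ^ 2) μ)
    (i4 : Integrable (fun p : RVec d × ℝ => neuronBound M p ^ 4) τ)
    (i2 : Integrable (fun p : RVec d × ℝ => neuronBound M p ^ 2) τ)
    (h4 : ∫ p, neuronBound M p ^ 4 ∂τ ≤ κ ^ 2) (h2 : ∫ p, neuronBound M p ^ 2 ∂τ ≤ κ)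
    {H : RVec d → ℝ} (hHm : Measurable H) (hH : MemLp (fun p => H p.1) 2 μ)
    (hreg : ∀ g : RVec d → ℝ, MemLp (fun p => g p.1) 2 μ → Measurable g →
      ∫ p, (p.2 - H p.1) * (g p.1 - H p.1) ∂μ = 0)
    {f : RVec d × ℝ → ℝ} (hfm : Measurable f) {F : ℝ} (hf : ∀ p, |f p| ≤ F)
    (hrep : ∀ x : RVec d, (∀ l, |x l| ≤ M) → ∫ p, f p * relu (inner ℝ p.1 x + p.2) ∂τ = H x)
    {η₀ lam : ℝ} (hη : 0 < η₀) (hlam : F / √(N : ℝ) ≤ lam) {τ₁ τ₂ : ℝ} (hτ₁ : 0 < τ₁)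
    (hτ₂ : 0 < τ₂) :
    ∫⁻ c : Fin N → RVec d × ℝ, ∫⁻ D, ENNReal.ofReal (Finset.expect Finset.univ
        fun j : Finset.Icc 1 T → Fin 𝔅 → Fin n =>
        ∫ p, (H p.1 - inner ℝ (sgdWeights η₀ lam c D j) (neurons c p.1)) ^ 2 ∂μ)
        ∂(Measure.pi fun _ : Fin n => μ) ∂(Measure.pi fun _ : Fin N => τ)
      ≤ ENNReal.ofReal (F ^ 2 * κ / N
        + lam ^ 2 / 2 * (τ₁ * ((N * κ) ^ 2 / n) + 1 / τ₁)
        + lam * (τ₂ * (N * κ * (∫ p, p.2 ^ 2 ∂μ) / n) + 1 / τ₂)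
        + (2 * lam ^ 2 / η₀ + η₀ * (8 * (lam ^ 2 * (N * κ) ^ 2 + N * κ * ∫ p, p.2 ^ 2 ∂μ)))
          * ((2 + Real.log T) / √(T : ℝ))) := by
  have : NeZero 𝔅 := ⟨by omega⟩
  have hF0 : 0 ≤ F := (abs_nonneg _).trans (hf 0)
  have hlam0 : 0 ≤ lam := le_trans (by positivity) hlam
  set m2 := ∫ p, p.2 ^ 2 ∂μ with hm2
  have hm20 : 0 ≤ m2 := integral_nonneg fun _ => sq_nonneg _
  set ℓ := (2 + Real.log T) / √(T : ℝ) with hℓ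
  have hℓ0 : 0 ≤ ℓ := by
    have : 0 ≤ Real.log T := Real.log_natCast_nonneg T
    positivity
  obtain ⟨j2, k2⟩ := integral_featureBound_le (N := N) i2 h2
  obtain ⟨j4, k4⟩ := integral_featureBound_sq_le (N := N) i4 h4
  -- the error beyond the oracle error, as a function of the feature bound
  set r : ℝ → ℝ → ℝ := fun g g2 => lam ^ 2 / 2 * (τ₁ * (g2 / n) + 1 / τ₁)
        + lam * (τ₂ * (g * m2 / n) + 1 / τ₂)
        + (2 * lam ^ 2 / η₀ + η₀ * (8 * (lam ^ 2 * g2 + g * m2))) * ℓ with hr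
  have hr_aff : ∀ g g2, r g g2 = r 0 0
      + (lam ^ 2 / 2 * (τ₁ / n) + η₀ * 8 * lam ^ 2 * ℓ) * g2
      + (lam * (τ₂ * m2 / n) + η₀ * 8 * m2 * ℓ) * g := by
    intro g g2; simp only [hr]; ring
  have hr0 : ∀ g g2, 0 ≤ g → 0 ≤ g2 → 0 ≤ r g g2 := by
    intro g g2 h h'; simp only [hr]; positivity
  have hrmono : ∀ g g2 g' g2', g ≤ g' → g2 ≤ g2' → r g g2 ≤ r g' g2' := by
    intro g g2 g' g2' h h'
    rw [hr_aff g g2, hr_aff g' g2']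
    gcongr
  have hri : Integrable (fun c : Fin N → RVec d × ℝ => r (featureBound M c) (featureBound M c ^ 2))
      (Measure.pi fun _ : Fin N => τ) := by
    simp only [fun c : Fin N → RVec d × ℝ => hr_aff (featureBound M c) (featureBound M c ^ 2)]
    exact ((integrable_const _).add (j4.const_mul _)).add (j2.const_mul _)
  have hrle : ∫ c : Fin N → RVec d × ℝ, r (featureBound M c) (featureBound M c ^ 2)
      ∂(Measure.pi fun _ : Fin N => τ) ≤ r (N * κ) ((N * κ) ^ 2) := by
    have e : ∫ c : Fin N → RVec d × ℝ, r (featureBound M c) (featureBound M c ^ 2)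
      ∂(Measure.pi fun _ : Fin N => τ) = r
        (∫ c : Fin N → RVec d × ℝ, featureBound M c ∂(Measure.pi fun _ : Fin N => τ))
        (∫ c : Fin N → RVec d × ℝ, featureBound M c ^ 2 ∂(Measure.pi fun _ : Fin N => τ)) := by
      rw [hr_aff]
      simp only [fun c : Fin N → RVec d × ℝ => hr_aff (featureBound M c) (featureBound M c ^ 2)]
      rw [integral_add ((integrable_const _).fun_add (j4.const_mul _)) (j2.const_mul _),
        integral_add (integrable_const _) (j4.const_mul _), integral_const_mul,
        integral_const_mul, integral_const, probReal_univ, one_smul]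
    rw [e]
    exact hrmono _ _ _ _ k2 k4
  have hinner : ∀ c : Fin N → RVec d × ℝ,
      ∫⁻ D, ENNReal.ofReal (Finset.expect Finset.univ
        fun j : Finset.Icc 1 T → Fin 𝔅 → Fin n =>
        ∫ p, (H p.1 - inner ℝ (sgdWeights η₀ lam c D j) (neurons c p.1)) ^ 2 ∂μ)
        ∂(Measure.pi fun _ : Fin n => μ)
      ≤ ENNReal.ofReal (∫ p, (H p.1 - inner ℝ (oracleWeights f c) (neurons c p.1)) ^ 2 ∂μ)
        + ENNReal.ofReal (r (featureBound M c) (featureBound M c ^ 2)) := by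
    intro c
    have hG := featureBound_nonneg M c
    rw [← ENNReal.ofReal_add (integral_nonneg fun _ => sq_nonneg _)
      (hr0 _ _ hG (sq_nonneg _))]
    have hψ : Measurable (neurons c) := measurable_neurons measurable_const measurable_id
    refine (lintegral_excess_fixed_features_le (ψ := neurons c) hψ (R2 := featureBound M c)
      (hx.mono fun p hp => norm_sq_neurons_le hM c hp) hy hH hreg
      (W := fun j D => sgdWeights η₀ lam c D j) hlam0
      (fun j D => norm_sgdWeights_le hlam0 c D j) (v := oracleWeights f c)
      (c₀ := 2 * lam ^ 2 / η₀ * ℓ) (c₁ := η₀ * 8 * ℓ) (fun D hD => ?_) hτ₁ hτ₂).trans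
      (ENNReal.ofReal_le_ofReal (le_of_eq ?_))
    · refine (expect_sgdIterate_sub_le h𝔅 hT hη hlam0 hG (fun i => (c i).1) (fun i => (c i).2)
        (fun i => (D i).1) (fun i => (D i).2) hD
        ((norm_oracleWeights_le hF0 hf c).trans hlam)).trans (le_of_eq ?_)
      rw [mul_div_assoc]; ring
    · simp only [hr]; ring
  refine (lintegral_mono hinner).trans ?_
  rw [lintegral_add_right' _ hri.aestronglyMeasurable.aemeasurable.ennreal_ofReal,
    ← ofReal_integral_eq_lintegral_ofReal hri
      (.of_forall fun c => hr0 _ _ (featureBound_nonneg M c) (sq_nonneg _))]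
  refine (add_le_add (lintegral_oracle_error_le hM hx i2 h2 hHm hfm hf hrep)
    (ENNReal.ofReal_le_ofReal hrle)).trans ?_
  have hκ : 0 ≤ κ := le_trans (integral_nonneg fun _ => sq_nonneg _) h2
  rw [← ENNReal.ofReal_add (by positivity) (hr0 _ _ (by positivity) (sq_nonneg _))]
  refine ENNReal.ofReal_le_ofReal (le_of_eq ?_)
  simp only [hr]; ring

/-! ### Joint laws -/

/-- Tonelli for independent random elements `c`, `D`, `q` and an index `j` that is uniform on a
finite set. -/
theorem lintegral_indep_uniform {Ω S₁ S₂ S₃ ι : Type*} [MeasurableSpace Ω] [MeasurableSpace S₁]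
    [MeasurableSpace S₂] [MeasurableSpace S₃] [Fintype ι] [MeasurableSpace ι]
    [MeasurableSingletonClass ι] {P : Measure Ω} [IsProbabilityMeasure P] {c : Ω → S₁}
    {D : Ω → S₂} {q : Ω → S₃} {j : Ω → ι} (hc : Measurable c) (hD : Measurable D)
    (hq : Measurable q) (hj : Measurable j) (h₁ : IndepFun c D P)
    (h₂ : IndepFun q (fun ω => (c ω, D ω)) P) (h₃ : IndepFun j (fun ω => ((c ω, D ω), q ω)) P)
    (hunif : ∀ i, P.map j {i} = (Fintype.card ι : ENNReal)⁻¹) {g : ι → S₁ → S₂ → S₃ → ENNReal}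
    (hg : ∀ i, Measurable fun z : (S₁ × S₂) × S₃ => g i z.1.1 z.1.2 z.2) :
    ∫⁻ ω, g (j ω) (c ω) (D ω) (q ω) ∂P = ∫⁻ x, ∫⁻ y, ∑ i,
      (∫⁻ z, g i x y z ∂(P.map q)) * (Fintype.card ι : ENNReal)⁻¹ ∂(P.map D) ∂(P.map c) := by
  have := Measure.isProbabilityMeasure_map (μ := P) hc.aemeasurable
  have := Measure.isProbabilityMeasure_map (μ := P) hD.aemeasurable
  have := Measure.isProbabilityMeasure_map (μ := P) hq.aemeasurable
  have := Measure.isProbabilityMeasure_map (μ := P) hj.aemeasurable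
  have hcD := hc.prodMk hD
  have l₁ := (indepFun_iff_map_prod_eq_prod_map_map hc.aemeasurable hD.aemeasurable).1 h₁
  have l₂ := (indepFun_iff_map_prod_eq_prod_map_map hcD.aemeasurable hq.aemeasurable).1 h₂.symm
  have l₃ := (indepFun_iff_map_prod_eq_prod_map_map (hcD.prodMk hq).aemeasurable
    hj.aemeasurable).1 h₃.symm
  have hgm : Measurable fun z : ((S₁ × S₂) × S₃) × ι => g z.2 z.1.1.1 z.1.1.2 z.1.2 :=
    measurable_from_prod_countable_left hg
  have hgz : ∀ i, Measurable fun w : S₁ × S₂ => ∫⁻ z, g i w.1 w.2 z ∂(P.map q) := fun i =>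
    Measurable.lintegral_prod_right' (f := fun z : (S₁ × S₂) × S₃ => g i z.1.1 z.1.2 z.2) (hg i)
  calc ∫⁻ ω, g (j ω) (c ω) (D ω) (q ω) ∂P
      = ∫⁻ z, g z.2 z.1.1.1 z.1.1.2 z.1.2 ∂(P.map fun ω => (((c ω, D ω), q ω), j ω)) :=
        (lintegral_map hgm ((hcD.prodMk hq).prodMk hj)).symm
    _ = ∫⁻ w, ∑ i, g i w.1.1 w.1.2 w.2 * (Fintype.card ι : ENNReal)⁻¹
          ∂(P.map fun ω => ((c ω, D ω), q ω)) := by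
        rw [l₃, lintegral_prod _ hgm.aemeasurable]
        simp only [lintegral_fintype, hunif]
    _ = ∫⁻ w, ∑ i, (∫⁻ z, g i w.1 w.2 z ∂(P.map q)) * (Fintype.card ι : ENNReal)⁻¹
          ∂(P.map fun ω => (c ω, D ω)) := by
        rw [l₂, lintegral_prod _
          (Finset.measurable_sum _ fun i _ => (hg i).mul_const _).aemeasurable]
        refine lintegral_congr fun w => ?_
        have hw : ∀ i, Measurable fun z => g i w.1 w.2 z := fun i =>
          (hg i).comp measurable_prodMk_left
        rw [lintegral_finsetSum _ fun i _ => (hw i).mul_const _]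
        exact Finset.sum_congr rfl fun i _ => lintegral_mul_const _ (hw i)
    _ = _ := by
        rw [l₁, lintegral_prod _
          (Finset.measurable_sum _ fun i _ => (hgz i).mul_const _).aemeasurable]

section Laws

variable {Ω : Type*} [MeasurableSpace Ω] {P : Measure Ω} [IsProbabilityMeasure P]

theorem IsHiddenWeights.isProbabilityMeasure {d N : ℕ} [NeZero N] {ν : ℝ} {πb : ℝ → ℝ}
    {A : Fin N → Ω → RVec d} {B : Fin N → Ω → ℝ} (h : IsHiddenWeights P ν πb A B) :
    IsProbabilityMeasure (multivariateT ν d) := by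
  rw [← h.law_A 0]
  exact Measure.isProbabilityMeasure_map (h.measurable_A 0).aemeasurable

/-- The neurons `(A_i, B_i)` are i.i.d.; the hypotheses provide the independence of the two families
separately and of the families from one another. -/
theorem IsHiddenWeights.map_eq_pi {d N : ℕ} {ν : ℝ} {πb : ℝ → ℝ}
    [IsProbabilityMeasure (multivariateT ν d)] [IsProbabilityMeasure (biasLaw πb)]
    {A : Fin N → Ω → RVec d} {B : Fin N → Ω → ℝ} (h : IsHiddenWeights P ν πb A B) :
    P.map (fun ω i => (A i ω, B i ω))
      = Measure.pi fun _ : Fin N => (multivariateT ν d).prod (biasLaw πb) := by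
  have hA : Measurable fun ω i => A i ω := measurable_pi_lambda _ h.measurable_A
  have hB : Measurable fun ω i => B i ω := measurable_pi_lambda _ h.measurable_B
  have lA := (iIndepFun_iff_map_fun_eq_pi_map fun i => (h.measurable_A i).aemeasurable).1 h.iIndep_A
  have lB := (iIndepFun_iff_map_fun_eq_pi_map fun i => (h.measurable_B i).aemeasurable).1 h.iIndep_B
  have lAB := (indepFun_iff_map_prod_eq_prod_map_map hA.aemeasurable hB.aemeasurable).1 h.indep_A_B
  simp only [h.law_A] at lA
  simp only [h.law_B] at lB
  rw [lA, lB] at lAB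
  have e := (measurePreserving_arrowProdEquivProdArrow (RVec d) ℝ (Fin N)
    (fun _ => multivariateT ν d) (fun _ => biasLaw πb)).symm
  rw [← e.map_eq]
  unfold biasLaw
  rw [← lAB, Measure.map_map (MeasurableEquiv.measurable _) (hA.prodMk hB)]
  rfl

/-- The batch indices are uniform on all index sequences. -/
theorem IsBatchIndices.map_singleton {d N n 𝔅 T : ℕ} [NeZero n]
    {A : Fin N → Ω → RVec d} {B : Fin N → Ω → ℝ}
    {X : Fin n → Ω → RVec d} {Y : Fin n → Ω → ℝ} {Xbar : Ω → RVec d} {Ybar : Ω → ℝ}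
    {J : ℕ → Fin 𝔅 → Ω → Fin n} (h : IsBatchIndices P T A B X Y Xbar Ybar J)
    (i : Finset.Icc 1 T → Fin 𝔅 → Fin n) :
    P.map (fun ω (t : Finset.Icc 1 T) k => J t k ω) {i}
      = (Fintype.card (Finset.Icc 1 T → Fin 𝔅 → Fin n) : ENNReal)⁻¹ := by
  have hm : ∀ q : Fin 𝔅 × Finset.Icc 1 T, Measurable fun ω => J q.2 q.1 ω := fun q =>
    h.measurable q.2 q.2.2 q.1
  have l := (iIndepFun_iff_map_fun_eq_pi_map fun q => (hm q).aemeasurable).1 h.iIndep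
  have hm' : Measurable fun ω (t : Finset.Icc 1 T) k => J t k ω :=
    measurable_pi_lambda _ fun t => measurable_pi_lambda _ fun k => hm (k, t)
  have e : (fun ω (t : Finset.Icc 1 T) k => J t k ω) ⁻¹' {i}
      = (fun ω (q : Fin 𝔅 × Finset.Icc 1 T) => J q.2 q.1 ω) ⁻¹' {fun q => i q.2 q.1} := by
    ext ω
    simp only [Set.mem_preimage, Set.mem_singleton_iff, funext_iff, Prod.forall]
    exact ⟨fun hω a b => hω b a, fun hω a b => hω b a⟩
  rw [Measure.map_apply hm' (measurableSet_singleton _), e,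
    ← Measure.map_apply (measurable_pi_lambda _ hm) (measurableSet_singleton _), l,
    Measure.pi_singleton]
  have hu : ∀ q : Fin 𝔅 × Finset.Icc 1 T,
      P.map (fun ω => J q.2 q.1 ω) {i q.2 q.1} = (n : ENNReal)⁻¹ := by
    intro q
    rw [Measure.map_apply (hm q) (measurableSet_singleton _)]
    have hn : (0 : ℝ) < n := by exact_mod_cast NeZero.pos n
    have := h.uniform q.2 q.2.2 q.1 (i q.2 q.1)
    rw [Measure.real, one_div] at this
    change P {ω | J q.2 q.1 ω = i q.2 q.1} = _
    rw [← ENNReal.ofReal_toReal (measure_ne_top P _), this, ENNReal.ofReal_inv_of_pos hn,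
      ENNReal.ofReal_natCast]
  simp only [hu, Finset.prod_const, Finset.card_univ, Fintype.card_prod, Fintype.card_fun,
    Fintype.card_fin]
  rw [← pow_mul, Nat.cast_pow, ENNReal.inv_pow]

/-- The residual of the regression function is orthogonal to functions of the input. -/
theorem integral_residual_mul_eq_zero {d : ℕ} {X : Ω → RVec d} {Y : Ω → ℝ} (hX : Measurable X)
    (hY : MemLp Y 2 P) {H : RVec d → ℝ} (hHm : Measurable H) (hH : MemLp (fun ω => H (X ω)) 2 P)
    (hreg : P[Y | MeasurableSpace.comap X inferInstance] =ᵐ[P] fun ω => H (X ω))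
    {g : RVec d → ℝ} (hgm : Measurable g) (hg : MemLp (fun ω => g (X ω)) 2 P) :
    ∫ ω, (Y ω - H (X ω)) * (g (X ω) - H (X ω)) ∂P = 0 := by
  set G : Ω → ℝ := fun ω => g (X ω) - H (X ω) with hG
  have hG2 : MemLp G 2 P := hg.sub hH
  have hGm : StronglyMeasurable[MeasurableSpace.comap X inferInstance] G :=
    (((hgm.sub hHm).comp (comap_measurable X)) : _).stronglyMeasurable
  have hYG : Integrable (Y * G) P := hY.integrable_mul hG2
  have h1 := condExp_mul_of_stronglyMeasurable_right hGm hYG (hY.integrable one_le_two)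
  have h2 : ∫ ω, Y ω * G ω ∂P = ∫ ω, H (X ω) * G ω ∂P := by
    calc ∫ ω, Y ω * G ω ∂P
        = ∫ ω, (P[Y * G | MeasurableSpace.comap X inferInstance]) ω ∂P :=
          (integral_condExp hX.comap_le).symm
      _ = _ := by
          refine integral_congr_ae ?_
          filter_upwards [h1, hreg] with ω e1 e2
          rw [e1, Pi.mul_apply, e2]
  have h3 : Integrable (fun ω => H (X ω) * G ω) P := hH.integrable_mul hG2
  have h4 : Integrable (fun ω => Y ω * G ω) P := hYG
  simp only [sub_mul]
  rw [integral_sub h4 h3, h2, sub_self]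

end Laws

section Prediction

variable {Ω : Type*} [MeasurableSpace Ω] {P : Measure Ω} [IsProbabilityMeasure P]

/-- Mean square prediction error on the original probability space: by independence it is the
iterated integral over the laws of the neurons, the data, the batches and the test pair. -/
theorem lintegral_prediction_error_le {d N n 𝔅 T : ℕ} [NeZero N] [NeZero n] (h𝔅 : 1 ≤ 𝔅)
    (hT : 1 ≤ T) {ν : ℝ} {πb : ℝ → ℝ} [IsProbabilityMeasure (multivariateT ν d)]
    [IsProbabilityMeasure (biasLaw πb)] {A : Fin N → Ω → RVec d} {B : Fin N → Ω → ℝ}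
    {X : Fin n → Ω → RVec d} {Y : Fin n → Ω → ℝ} {Xbar : Ω → RVec d} {Ybar : Ω → ℝ}
    {J : ℕ → Fin 𝔅 → Ω → Fin n} (hW : IsHiddenWeights P ν πb A B)
    (hD : IsLearningData P A B X Y Xbar Ybar) (hJ : IsBatchIndices P T A B X Y Xbar Ybar J)
    {M κ : ℝ} (hM : 0 ≤ M) (hx : ∀ᵐ ω ∂P, ∀ l, |X 0 ω l| ≤ M)
    (hy : Integrable (fun ω => Y 0 ω ^ 2) P)
    (i4 : Integrable (fun p => neuronBound M p ^ 4) ((multivariateT ν d).prod (biasLaw πb)))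
    (i2 : Integrable (fun p => neuronBound M p ^ 2) ((multivariateT ν d).prod (biasLaw πb)))
    (h4 : ∫ p, neuronBound M p ^ 4 ∂((multivariateT ν d).prod (biasLaw πb)) ≤ κ ^ 2)
    (h2 : ∫ p, neuronBound M p ^ 2 ∂((multivariateT ν d).prod (biasLaw πb)) ≤ κ)
    {H : RVec d → ℝ} (hHm : Measurable H) {b : ℝ} (hHb : ∀ x, |H x| ≤ b)
    (hreg : P[Y 0 | MeasurableSpace.comap (X 0) inferInstance] =ᵐ[P] fun ω => H (X 0 ω))
    {f : RVec d × ℝ → ℝ} (hfm : Measurable f) {F : ℝ} (hf : ∀ p, |f p| ≤ F)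
    (hrep : ∀ x : RVec d, (∀ l, |x l| ≤ M) → ∫ p, f p * relu (inner ℝ p.1 x + p.2)
      ∂((multivariateT ν d).prod (biasLaw πb)) = H x)
    {η₀ lam : ℝ} (hη : 0 < η₀) (hlam : F / √(N : ℝ) ≤ lam) {τ₁ τ₂ : ℝ} (hτ₁ : 0 < τ₁)
    (hτ₂ : 0 < τ₂) {err : Ω → ℝ}
    (herr : ∀ ω, err ω = H (Xbar ω) - network (fun i => A i ω) (fun i => B i ω)
      (sgdIterate η₀ lam (fun i => A i ω) (fun i => B i ω) (fun i => X i ω) (fun i => Y i ω)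
        (fun t i => J t i ω) T) (Xbar ω)) :
    Measurable err ∧ ∫⁻ ω, ENNReal.ofReal (err ω ^ 2) ∂P ≤ ENNReal.ofReal (F ^ 2 * κ / N
        + lam ^ 2 / 2 * (τ₁ * ((N * κ) ^ 2 / n) + 1 / τ₁)
        + lam * (τ₂ * (N * κ * (∫ ω, Y 0 ω ^ 2 ∂P) / n) + 1 / τ₂)
        + (2 * lam ^ 2 / η₀ + η₀ * (8 * (lam ^ 2 * (N * κ) ^ 2 + N * κ * ∫ ω, Y 0 ω ^ 2 ∂P)))
          * ((2 + Real.log T) / √(T : ℝ))) := by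
  have : NeZero 𝔅 := ⟨by omega⟩
  have hXY : ∀ i, Measurable fun ω => (X i ω, Y i ω) := fun i =>
    (hD.measurable_X i).prodMk (hD.measurable_Y i)
  set c : Ω → Fin N → RVec d × ℝ := fun ω i => (A i ω, B i ω) with hc
  set D : Ω → Fin n → RVec d × ℝ := fun ω i => (X i ω, Y i ω) with hDdef
  set q : Ω → RVec d × ℝ := fun ω => (Xbar ω, Ybar ω) with hq
  set j : Ω → Finset.Icc 1 T → Fin 𝔅 → Fin n := fun ω t k => J t k ω with hj
  set μ := P.map fun ω => (X 0 ω, Y 0 ω) with hμ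
  have hcm : Measurable c := measurable_pi_lambda _ fun i =>
    (hW.measurable_A i).prodMk (hW.measurable_B i)
  have hDm : Measurable D := measurable_pi_lambda _ hXY
  have hqm : Measurable q := hD.measurable_Xbar.prodMk hD.measurable_Ybar
  have hjm : Measurable j := measurable_pi_lambda _ fun t => measurable_pi_lambda _ fun k =>
    hJ.measurable t t.2 k
  have : IsProbabilityMeasure μ := Measure.isProbabilityMeasure_map (hXY 0).aemeasurable
  have lq : P.map q = μ := (hD.identDistrib 0).map_eq.symm
  have lD : P.map D = Measure.pi fun _ : Fin n => μ := by
    have := (iIndepFun_iff_map_fun_eq_pi_map fun i => (hXY i).aemeasurable).1 hD.iIndep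
    rw [this]
    congr 1
    ext1 i
    exact ((hD.identDistrib i).trans (hD.identDistrib 0).symm).map_eq
  have hzip : Measurable fun w : (Fin N → RVec d) × (Fin N → ℝ) => fun i => (w.1 i, w.2 i) := by
    fun_prop
  have h₁ : IndepFun c D P := hD.indep_weights.comp hzip measurable_id
  have h₂ : IndepFun q (fun ω => (c ω, D ω)) P :=
    hD.indep_test.comp (ψ := fun w : (Fin N → RVec d) × (Fin N → ℝ) × (Fin n → RVec d × ℝ) =>
      ((fun i => (w.1 i, w.2.1 i)), w.2.2)) measurable_id (by fun_prop)
  have h₃ : IndepFun j (fun ω => ((c ω, D ω), q ω)) P :=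
    hJ.indep.comp (φ := fun (w : Fin 𝔅 × Finset.Icc 1 T → Fin n) t k => w (k, t))
      (ψ := fun w : ((Fin N → RVec d) × (Fin N → ℝ) × (Fin n → RVec d × ℝ)) × (RVec d × ℝ) =>
      (((fun i => (w.1.1 i, w.1.2.1 i)), w.1.2.2), w.2)) (by fun_prop) (by fun_prop)
  -- The error is a function of these random elements: the batches outside `1, …, T - 1` are not
  -- used.
  have herr' : ∀ ω, err ω = H (q ω).1 - inner ℝ (sgdWeights η₀ lam (c ω) (D ω) (j ω))
      (neurons (c ω) (q ω).1) := by
    intro ω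
    rw [herr, network_eq_inner]
    unfold sgdWeights neurons
    rw [sgdIterate_congr η₀ lam _ _ _ _ (j' := extendBatch (j ω))]
    intro t h1 h2
    ext1 k
    simp [extendBatch, hj, h1, h2.le]
  have hgm := fun i : Finset.Icc 1 T → Fin 𝔅 → Fin n =>
    measurable_sub_inner_sgdWeights (N := N) η₀ lam i hHm
  constructor
  · have hm : Measurable fun z : (((Fin N → RVec d × ℝ) × (Fin n → RVec d × ℝ)) × (RVec d × ℝ))
        × (Finset.Icc 1 T → Fin 𝔅 → Fin n) =>
        H z.1.2.1 - inner ℝ (sgdWeights η₀ lam z.1.1.1 z.1.1.2 z.2) (neurons z.1.1.1 z.1.2.1) :=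
      measurable_from_prod_countable_left hgm
    rw [show err = _ from funext herr']
    exact hm.comp (((hcm.prodMk hDm).prodMk hqm).prodMk hjm)
  have hx' : ∀ᵐ p ∂μ, ∀ l, |p.1 l| ≤ M := by
    refine (ae_map_iff (hXY 0).aemeasurable ?_).2 hx
    have : {p : RVec d × ℝ | ∀ l, |p.1 l| ≤ M} = ⋂ l, {p | |p.1 l| ≤ M} := by ext; simp
    rw [this]
    exact MeasurableSet.iInter fun l => measurableSet_le (by fun_prop) measurable_const
  have hy' : Integrable (fun p => p.2 ^ 2) μ :=
    (integrable_map_measure (by fun_prop) (hXY 0).aemeasurable).2 hy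
  have hy2 : ∫ p, p.2 ^ 2 ∂μ = ∫ ω, Y 0 ω ^ 2 ∂P :=
    integral_map (hXY 0).aemeasurable (by fun_prop)
  have hHμ : MemLp (fun p => H p.1) 2 μ :=
    MemLp.of_bound (hHm.comp measurable_fst).aestronglyMeasurable b
      (.of_forall fun p => hHb p.1)
  have hHP : MemLp (fun ω => H (X 0 ω)) 2 P :=
    MemLp.of_bound (hHm.comp (hD.measurable_X 0)).aestronglyMeasurable b
      (.of_forall fun ω => hHb _)
  have hY2 : MemLp (Y 0) 2 P :=
    (memLp_two_iff_integrable_sq (hD.measurable_Y 0).aestronglyMeasurable).2 hy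
  have hregμ : ∀ g : RVec d → ℝ, MemLp (fun p => g p.1) 2 μ → Measurable g →
      ∫ p, (p.2 - H p.1) * (g p.1 - H p.1) ∂μ = 0 := by
    intro g hg hgm
    have hm : Measurable fun p : RVec d × ℝ => (p.2 - H p.1) * (g p.1 - H p.1) :=
      (measurable_snd.sub (hHm.comp measurable_fst)).mul
        ((hgm.comp measurable_fst).sub (hHm.comp measurable_fst))
    rw [hμ, integral_map (hXY 0).aemeasurable hm.aestronglyMeasurable]
    exact integral_residual_mul_eq_zero (hD.measurable_X 0) hY2 hHm hHP hreg hgm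
      ((memLp_map_measure_iff hg.aestronglyMeasurable (hXY 0).aemeasurable).1 hg)
  have hlam0 : 0 ≤ lam := by
    have : 0 ≤ F := (abs_nonneg _).trans (hf 0)
    exact le_trans (by positivity) hlam
  -- for fixed neurons, data and batches the squared error is integrable in the test pair
  have hint : ∀ (c' : Fin N → RVec d × ℝ) (D' : Fin n → RVec d × ℝ)
      (i : Finset.Icc 1 T → Fin 𝔅 → Fin n), Integrable (fun p : RVec d × ℝ => (H p.1
      - inner ℝ (sgdWeights η₀ lam c' D' i) (neurons c' p.1)) ^ 2) μ := by
    intro c' D' i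
    have hm := (hgm i).comp (measurable_prodMk_left (x := (c', D')))
    refine MemLp.integrable_sq (MemLp.of_bound hm.aestronglyMeasurable
      (b + lam * √(featureBound M c')) ?_)
    filter_upwards [hx'] with p hp
    refine (norm_sub_le _ _).trans (add_le_add (hHb _) ?_)
    refine (abs_real_inner_le_norm _ _).trans ?_
    gcongr
    · exact norm_sgdWeights_le hlam0 _ _ _
    · exact Real.le_sqrt_of_sq_le (norm_sq_neurons_le hM c' hp)
  have hkey := lintegral_indep_uniform hcm hDm hqm hjm h₁ h₂ h₃ hJ.map_singleton
    (g := fun i c' D' p => ENNReal.ofReal ((H p.1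
      - inner ℝ (sgdWeights η₀ lam c' D' i) (neurons c' p.1)) ^ 2))
    fun i => ((hgm i).pow_const 2).ennreal_ofReal
  simp only [herr']
  rw [hkey, lq, lD, hW.map_eq_pi, ← hy2]
  refine le_trans (le_of_eq ?_) (lintegral_excess_random_features_le h𝔅 hT hM hx' hy' i4 i2 h4 h2
    hHm hHμ hregμ hfm hf hrep hη hlam hτ₁ hτ₂)
  refine lintegral_congr fun c' => lintegral_congr fun D' => ?_
  have hcard : (0 : ℝ) < Fintype.card (Finset.Icc 1 T → Fin 𝔅 → Fin n) := by
    exact_mod_cast Fintype.card_pos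
  rw [Finset.expect_eq_sum_div_card, Finset.card_univ, ENNReal.ofReal_div_of_pos hcard,
    ENNReal.ofReal_natCast, ENNReal.ofReal_sum_of_nonneg
      fun i _ => integral_nonneg fun _ => sq_nonneg _, div_eq_mul_inv, Finset.sum_mul]
  refine Finset.sum_congr rfl fun i _ => ?_
  rw [ofReal_integral_eq_lintegral_ofReal (hint c' D' i) (.of_forall fun _ => sq_nonneg _)]

end Prediction

/-! ### Choice of the parameters -/

/-- Contribution of the finite sample, for the weights `τ₁ = √n / (N K d²)` and
`τ₂ = √n / √(N K d² m)`, which balance the two inequalities between arithmetic and geometric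
means. -/
theorem sample_error_le {d N n K m lam Clam δ : ℝ} (hd : 1 ≤ d) (hN : 1 ≤ N) (hn : 0 < n)
    (hK : 0 < K) (hm : 0 < m) (hδ : 1 ≤ δ) (hlam : 0 ≤ lam) (hlam' : lam ≤ Clam * δ / √N) :
    lam ^ 2 / 2 * (√n / (N * (K * d ^ 2)) * ((N * (K * d ^ 2)) ^ 2 / n)
          + 1 / (√n / (N * (K * d ^ 2))))
        + lam * (√n / √(N * (K * d ^ 2) * m) * (N * (K * d ^ 2) * m / n)
          + 1 / (√n / √(N * (K * d ^ 2) * m)))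
      ≤ (Clam ^ 2 * K + 2 * Clam * √(K * m)) * (δ * d) ^ 2 / √n := by
  have hN0 : 0 < N := by linarith
  have hd0 : 0 < d := by linarith
  have hδ0 : 0 < δ := by linarith
  have hsN : 0 < √N := Real.sqrt_pos.2 hN0
  have hsn : 0 < √n := Real.sqrt_pos.2 hn
  have hC : 0 ≤ Clam := by
    by_contra h
    have : Clam * δ / √N < 0 := div_neg_of_neg_of_pos (mul_neg_of_neg_of_pos (not_le.1 h) hδ0) hsN
    linarith
  have e1 : lam ^ 2 / 2 * (√n / (N * (K * d ^ 2)) * ((N * (K * d ^ 2)) ^ 2 / n)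
      + 1 / (√n / (N * (K * d ^ 2)))) = lam ^ 2 * N * (K * d ^ 2) / √n := by
    have : n = √n ^ 2 := (Real.sq_sqrt hn.le).symm
    set s := √n
    rw [this]; field_simp; ring
  have hsplit : √(N * (K * d ^ 2) * m) = √N * d * √(K * m) := by
    rw [show N * (K * d ^ 2) * m = N * d ^ 2 * (K * m) by ring, Real.sqrt_mul (by positivity),
      Real.sqrt_mul hN0.le, Real.sqrt_sq hd0.le]
  have hu : 0 < √(N * (K * d ^ 2) * m) := Real.sqrt_pos.2 (by positivity)
  have e2 : lam * (√n / √(N * (K * d ^ 2) * m) * (N * (K * d ^ 2) * m / n)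
      + 1 / (√n / √(N * (K * d ^ 2) * m))) = 2 * (lam * √N) * d * √(K * m) / √n := by
    have h1 : n = √n ^ 2 := (Real.sq_sqrt hn.le).symm
    have h2 : N * (K * d ^ 2) * m = √(N * (K * d ^ 2) * m) ^ 2 :=
      (Real.sq_sqrt (by positivity)).symm
    have h3 : 2 * (lam * √N) * d * √(K * m) = 2 * lam * √(N * (K * d ^ 2) * m) := by
      rw [hsplit]; ring
    rw [h3]
    set s := √n
    set u := √(N * (K * d ^ 2) * m)
    rw [h2, h1]; field_simp; ring
  have hl : lam * √N ≤ Clam * δ := (le_div_iff₀ hsN).1 hlam'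
  have hl2 : lam ^ 2 * N ≤ (Clam * δ) ^ 2 := by
    calc lam ^ 2 * N = (lam * √N) ^ 2 := by rw [mul_pow, Real.sq_sqrt hN0.le]
      _ ≤ _ := by gcongr
  have hδd : δ * d ≤ (δ * d) ^ 2 := by
    have : 1 ≤ δ * d := one_le_mul_of_one_le_of_one_le hδ hd
    nlinarith
  rw [e1, e2, ← add_div]
  gcongr
  calc lam ^ 2 * N * (K * d ^ 2) + 2 * (lam * √N) * d * √(K * m)
      ≤ (Clam * δ) ^ 2 * (K * d ^ 2) + 2 * (Clam * δ) * d * √(K * m) := by gcongr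
    _ = Clam ^ 2 * K * (δ * d) ^ 2 + 2 * Clam * √(K * m) * (δ * d) := by ring
    _ ≤ Clam ^ 2 * K * (δ * d) ^ 2 + 2 * Clam * √(K * m) * (δ * d) ^ 2 := by gcongr
    _ = _ := by ring

/-- Contribution of the finite number of SGD steps. -/
theorem optimization_error_le {d N K m lam Clam η₀ δ : ℝ} (hd : 1 ≤ d) (hN : 1 ≤ N)
    (hK : 0 < K) (hm : 0 < m) (hη : 0 < η₀) (hδ : 1 ≤ δ) (hlam : 0 ≤ lam)
    (hlam' : lam ≤ Clam * δ / √N) :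
    2 * lam ^ 2 / η₀ + η₀ * (8 * (lam ^ 2 * (N * (K * d ^ 2)) ^ 2 + N * (K * d ^ 2) * m))
      ≤ (2 * Clam ^ 2 / η₀ + 8 * η₀ * (Clam ^ 2 * K ^ 2 + K * m)) * (δ * d ^ 2 * N) ^ 2 := by
  have hN0 : 0 < N := by linarith
  have hd0 : 0 < d := by linarith
  have hδ0 : 0 < δ := by linarith
  have hsN : 0 < √N := Real.sqrt_pos.2 hN0
  have hl2 : lam ^ 2 * N ≤ Clam ^ 2 * δ ^ 2 := by
    calc lam ^ 2 * N = (lam * √N) ^ 2 := by rw [mul_pow, Real.sq_sqrt hN0.le]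
      _ ≤ (Clam * δ) ^ 2 := by
        have := (le_div_iff₀ hsN).1 hlam'
        gcongr
      _ = _ := by ring
  have hd4 : 1 ≤ d ^ 4 := one_le_pow₀ hd
  have hN2 : 1 ≤ N ^ 2 := one_le_pow₀ hN
  have hδ2 : 1 ≤ δ ^ 2 := one_le_pow₀ hδ
  have hd24 : d ^ 2 ≤ d ^ 4 := pow_le_pow_right₀ hd (by norm_num)
  have hN12 : N ≤ N ^ 2 := by nlinarith
  have a1 : lam ^ 2 ≤ Clam ^ 2 * (δ * d ^ 2 * N) ^ 2 := by
    calc lam ^ 2 = lam ^ 2 * 1 := (mul_one _).symm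
      _ ≤ lam ^ 2 * N := by gcongr
      _ ≤ Clam ^ 2 * δ ^ 2 := hl2
      _ = Clam ^ 2 * δ ^ 2 * (1 * 1) := by ring
      _ ≤ Clam ^ 2 * δ ^ 2 * (d ^ 4 * N ^ 2) := by gcongr
      _ = _ := by ring
  have a2 : lam ^ 2 * (N * (K * d ^ 2)) ^ 2 ≤ Clam ^ 2 * K ^ 2 * (δ * d ^ 2 * N) ^ 2 := by
    calc lam ^ 2 * (N * (K * d ^ 2)) ^ 2 = lam ^ 2 * N * (K ^ 2 * d ^ 4 * N) := by ring
      _ ≤ Clam ^ 2 * δ ^ 2 * (K ^ 2 * d ^ 4 * N ^ 2) := by gcongr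
      _ = _ := by ring
  have a3 : N * (K * d ^ 2) * m ≤ K * m * (δ * d ^ 2 * N) ^ 2 := by
    calc N * (K * d ^ 2) * m = K * m * (1 * d ^ 2 * N) := by ring
      _ ≤ K * m * (δ ^ 2 * d ^ 4 * N ^ 2) := by gcongr
      _ = _ := by ring
  calc _ = 2 / η₀ * lam ^ 2 + 8 * η₀ * (lam ^ 2 * (N * (K * d ^ 2)) ^ 2)
        + 8 * η₀ * (N * (K * d ^ 2) * m) := by ring
    _ ≤ 2 / η₀ * (Clam ^ 2 * (δ * d ^ 2 * N) ^ 2)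
        + 8 * η₀ * (Clam ^ 2 * K ^ 2 * (δ * d ^ 2 * N) ^ 2)
        + 8 * η₀ * (K * m * (δ * d ^ 2 * N) ^ 2) := by gcongr
    _ = _ := by ring

theorem Real.sq_rpow_one_fourth {x : ℝ} (hx : 0 ≤ x) : (x ^ (1 / 4 : ℝ)) ^ 2 = √x := by
  rw [← Real.rpow_natCast, ← Real.rpow_mul hx, Real.sqrt_eq_rpow]
  norm_num

theorem memLp_two_and_sqrt_integral_le {Ω : Type*} [MeasurableSpace Ω] {P : Measure Ω}
    {g : Ω → ℝ} (hg : Measurable g) {s t : ℝ} (ht : 0 ≤ t) (hs : s ≤ t ^ 2)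
    (h : ∫⁻ ω, ENNReal.ofReal (g ω ^ 2) ∂P ≤ ENNReal.ofReal s) :
    MemLp g 2 P ∧ √(∫ ω, |g ω| ^ 2 ∂P) ≤ t := by
  have hm : Measurable fun ω => g ω ^ 2 := hg.pow_const 2
  constructor
  · refine (memLp_two_iff_integrable_sq hg.aestronglyMeasurable).2
      ⟨hm.aestronglyMeasurable, ?_⟩
    rw [hasFiniteIntegral_iff_ofReal (.of_forall fun _ => sq_nonneg _)]
    exact h.trans_lt ENNReal.ofReal_lt_top
  · refine Real.sqrt_le_iff.2 ⟨ht, ?_⟩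
    simp only [sq_abs]
    rw [integral_eq_lintegral_of_nonneg_ae (.of_forall fun _ => sq_nonneg _)
      hm.aestronglyMeasurable]
    exact ENNReal.toReal_le_of_le_ofReal (sq_nonneg t) (h.trans (ENNReal.ofReal_le_ofReal hs))

theorem sq_add_sq_add_sq_le_sq_add {a b c : ℝ} (ha : 0 ≤ a) (hb : 0 ≤ b) (hc : 0 ≤ c) :
    a ^ 2 + b ^ 2 + c ^ 2 ≤ (a + b + c) ^ 2 := by
  nlinarith [mul_nonneg ha hb, mul_nonneg ha hc, mul_nonneg hb hc]

theorem mainTheorem7 (πb : ℝ → ℝ) (hπb : IsPolyDecayDensity πb)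
    (hB4 : Integrable (fun z : ℝ => z ^ 4 * πb z)) :
    ∃ k : ℕ, ∀ ν C M : ℝ, 4 < ν → 1 / ((2 : ℝ) ^ (3 / 2 : ℝ) * Real.pi) < C → 0 < M →
    ∃ Cwgt > (0 : ℝ), ∃ Capp > (0 : ℝ),
    ∀ η₀ Clam m₄ : ℝ, 0 < η₀ → 0 < Clam →
    ∃ Cest > (0 : ℝ), ∃ Copt > (0 : ℝ),
    ∀ (d N n 𝔅 𝒯 : ℕ) [NeZero d] [NeZero N] [NeZero n], 1 ≤ 𝔅 → 𝔅 ≤ n → 2 ≤ 𝒯 →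
    ∀ {Ω : Type*} [MeasurableSpace Ω] (P : Measure Ω) [IsProbabilityMeasure P]
      (A : Fin N → Ω → RVec d) (B : Fin N → Ω → ℝ)
      (X : Fin n → Ω → RVec d) (Y : Fin n → Ω → ℝ) (Xbar : Ω → RVec d) (Ybar : Ω → ℝ)
      (J : ℕ → Fin 𝔅 → Ω → Fin n)
      (V : Ω → RVec d) (Φ : RVec d → ℝ) (H : RVec d → ℝ) (p lam : ℝ),
      IsHiddenWeights P ν πb A B →
      IsLearningData P A B X Y Xbar Ybar →
      IsBatchIndices P 𝒯 A B X Y Xbar Ybar J →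
      -- `H(x) = E[Φ(x + V)]` with `Φ ∈ L¹` and a Gaussian bound on the characteristic function
      Integrable Φ →
      Measurable V →
      (∀ ξ : RVec d, ‖charFun (P.map V) ξ‖ ≤ Real.exp (-C * ‖ξ‖ ^ 2)) →
      (∀ x, H x = ∫ ω, Φ (x + V ω) ∂P) →
      -- `H` is the regression function of the data
      (P[Y 0 | MeasurableSpace.comap (X 0) inferInstance] =ᵐ[P] fun ω => H (X 0 ω)) →
      (∀ᵐ ω ∂P, ∀ l, |X 0 ω l| ≤ M) →
      Integrable (fun ω => |Y 0 ω| ^ 4) P →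
      ∫ ω, |Y 0 ω| ^ 4 ∂P = m₄ →
      0 ≤ p →
      Cwgt * (∫ x, |Φ x|) * (ν + d) ^ (2 * (k : ℝ) + 1 / 2) / √(N : ℝ) ≤ lam →
      lam ≤ Clam * (d : ℝ) ^ p / √(N : ℝ) →
      -- prediction error of the network with output weights `W_𝒯`
      let err : Ω → ℝ := fun ω =>
        H (Xbar ω) - network (fun i => A i ω) (fun i => B i ω)
          (sgdIterate η₀ lam (fun i => A i ω) (fun i => B i ω) (fun i => X i ω) (fun i => Y i ω)
            (fun t i => J t i ω) 𝒯) (Xbar ω)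
      MemLp err 2 P ∧
      √(∫ ω, |err ω| ^ 2 ∂P) ≤
        Capp * (∫ x, |Φ x|) * (ν + d) ^ (k + 3) / √(N : ℝ)
        + Cest * (d : ℝ) ^ (p + 1) / (n : ℝ) ^ (1 / 4 : ℝ)
        + Copt * (d : ℝ) ^ (p + 2) * N * √(2 + Real.log 𝒯) / (𝒯 : ℝ) ^ (1 / 4 : ℝ) := by
  obtain ⟨m, hm⟩ := exists_random_feature_representation hπb hB4
  have := hπb.isProbabilityMeasure
  refine ⟨m + 1, fun ν C M hν hC hM => ?_⟩
  have hC0 : 0 < C := lt_trans (by positivity) hC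
  obtain ⟨F, hF, hrep⟩ := hm ν C M hν hC hM
  obtain ⟨K, hK, hmom⟩ := exists_moment_neuronBound hπb hB4 hν hM.le
  refine ⟨F, hF, F * √K, by positivity, fun η₀ Clam m₄ hη hClam => ?_⟩
  -- A bound for `E[Y²]`, positive for every value of the parameter `m₄`
  set m₂ := 1 + |m₄| with hm₂
  have hm₂0 : 0 < m₂ := by positivity
  refine ⟨√(Clam ^ 2 * K + 2 * Clam * √(K * m₂)), by positivity,
    √(2 * Clam ^ 2 / η₀ + 8 * η₀ * (Clam ^ 2 * K ^ 2 + K * m₂)), by positivity, ?_⟩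
  intro d N n 𝔅 𝒯 _ _ _ h𝔅 _ h𝒯 Ω _ P _ A B X Y Xbar Ybar J V Φ H p lam hW hD hJ hΦ hV hchar hH
    hreg hX hY4 hm₄ hp hlam hlam' err
  have := hW.isProbabilityMeasure
  have := Measure.isProbabilityMeasure_map (μ := P) hV.aemeasurable
  have hd1 : (1 : ℝ) ≤ d := by exact_mod_cast NeZero.one_le (n := d)
  have hN1 : (1 : ℝ) ≤ N := by exact_mod_cast NeZero.one_le (n := N)
  have hn0 : (0 : ℝ) < n := by exact_mod_cast NeZero.pos n
  have hT0 : (0 : ℝ) < 𝒯 := by exact_mod_cast (by omega : 0 < 𝒯)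
  have hd0 : (0 : ℝ) < d := by linarith
  have hN0 : (0 : ℝ) < N := by linarith
  have hνd : 1 ≤ ν + d := by linarith
  have hΦ0 : 0 ≤ ∫ x, |Φ x| := integral_nonneg fun _ => abs_nonneg _
  have hδ1 : 1 ≤ (d : ℝ) ^ p := Real.one_le_rpow hd1 hp
  set δ := (d : ℝ) ^ p with hδ
  set L := ∫ x, |Φ x| with hL
  have hHeq : ∀ x, H x = ∫ v, Φ (x + v) ∂(P.map V) := fun x =>
    (hH x).trans (integral_comp_add_eq hV hC0 hchar hΦ x)
  obtain ⟨hHc, b, hHb⟩ := continuous_integral_add hC0 hchar hΦ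
  simp only [← hHeq] at hHc hHb
  obtain ⟨f, hfm, hf, hfrep⟩ := hrep d (P.map V) Φ hΦ hchar
  simp only [← hHeq] at hfrep
  obtain ⟨i4, i2, k4, k2⟩ := hmom d
  have hY2pt : ∀ ω, Y 0 ω ^ 2 ≤ 1 + |Y 0 ω| ^ 4 := fun ω => by
    nlinarith [sq_nonneg (|Y 0 ω| ^ 2 - 1), sq_abs (Y 0 ω), sq_nonneg (|Y 0 ω| ^ 2)]
  have hbd := (integrable_const (1 : ℝ)).fun_add hY4
  have hY2 : Integrable (fun ω => Y 0 ω ^ 2) P :=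
    hbd.mono' ((hD.measurable_Y 0).pow_const 2).aestronglyMeasurable
      (.of_forall fun ω => by rw [Real.norm_of_nonneg (sq_nonneg _)]; exact hY2pt ω)
  have hEY : ∫ ω, Y 0 ω ^ 2 ∂P ≤ m₂ := by
    refine (integral_mono hY2 hbd hY2pt).trans ?_
    rw [integral_add (integrable_const _) hY4, hm₄, integral_const, probReal_univ, one_smul]
    exact add_le_add le_rfl (le_abs_self _)
  -- The lower bound on `lam` puts the weights of the random oracle into the ball.
  set F₀ := F * L * (ν + d) ^ (m + 1) with hF₀
  have hF₀0 : 0 ≤ F₀ := by positivity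
  have hlamF : F₀ / √(N : ℝ) ≤ lam := by
    refine le_trans ?_ hlam
    gcongr
    rw [hF₀]
    gcongr
    rw [← Real.rpow_natCast]
    refine Real.rpow_le_rpow_of_exponent_le hνd ?_
    have : (0 : ℝ) ≤ ((m + 1 : ℕ) : ℝ) := by positivity
    linarith
  have hlam0 : 0 ≤ lam := le_trans (by positivity) hlamF
  have hτ₁ : 0 < √(n : ℝ) / (N * (K * d ^ 2)) := by positivity
  have hτ₂ : 0 < √(n : ℝ) / √(N * (K * d ^ 2) * m₂) := by positivity
  obtain ⟨hmeas, hle⟩ := lintegral_prediction_error_le h𝔅 (by omega : 1 ≤ 𝒯) hW hD hJ hM.le hX hY2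
    i4 i2 k4 k2 hHc.measurable hHb hreg hfm hf hfrep hη hlamF hτ₁ hτ₂ (err := err) fun _ => rfl
  have hlog : 0 ≤ 2 + Real.log 𝒯 := by
    have := Real.log_natCast_nonneg 𝒯
    linarith
  refine memLp_two_and_sqrt_integral_le hmeas (by positivity) ?_ hle
  have hS := sample_error_le hd1 hN1 hn0 hK hm₂0 hδ1 hlam0 hlam'
  have hO := optimization_error_le hd1 hN1 hK hm₂0 hη hδ1 hlam0 hlam'
  set τ₁ := √(n : ℝ) / (N * (K * d ^ 2))
  set τ₂ := √(n : ℝ) / √(N * (K * d ^ 2) * m₂)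
  set EY := ∫ ω, Y 0 ω ^ 2 ∂P
  set t₁ := F * √K * L * (ν + d) ^ (m + 1 + 3) / √(N : ℝ) with ht₁
  set t₂ := √(Clam ^ 2 * K + 2 * Clam * √(K * m₂)) * (d : ℝ) ^ (p + 1) / (n : ℝ) ^ (1 / 4 : ℝ)
    with ht₂
  set t₃ := √(2 * Clam ^ 2 / η₀ + 8 * η₀ * (Clam ^ 2 * K ^ 2 + K * m₂)) * (d : ℝ) ^ (p + 2) * N
    * √(2 + Real.log 𝒯) / (𝒯 : ℝ) ^ (1 / 4 : ℝ) with ht₃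
  have e₁ : F₀ ^ 2 * (K * d ^ 2) / N ≤ t₁ ^ 2 := by
    have h1 : t₁ ^ 2 = F ^ 2 * K * L ^ 2 * ((ν + d) ^ (m + 1 + 3)) ^ 2 / N := by
      rw [ht₁, div_pow, Real.sq_sqrt hN0.le]
      simp only [mul_pow, Real.sq_sqrt hK.le]
    have h2 : (ν + d) ^ (m + 1) * d ≤ (ν + d) ^ (m + 1 + 3) := by
      rw [pow_add _ (m + 1)]
      gcongr
      calc (d : ℝ) ≤ ν + d := by linarith
        _ ≤ (ν + d) ^ 3 := le_self_pow₀ hνd (by norm_num)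
    rw [h1]
    calc F₀ ^ 2 * (K * d ^ 2) / N
        = F ^ 2 * K * L ^ 2 * ((ν + d) ^ (m + 1) * d) ^ 2 / N := by rw [hF₀]; ring
      _ ≤ _ := by gcongr
  have e₂ : t₂ ^ 2 = (Clam ^ 2 * K + 2 * Clam * √(K * m₂)) * (δ * d) ^ 2 / √(n : ℝ) := by
    rw [ht₂, div_pow, mul_pow, Real.sq_rpow_one_fourth hn0.le, Real.sq_sqrt (by positivity),
      Real.rpow_add hd0, Real.rpow_one]
  have e₃ : t₃ ^ 2 = (2 * Clam ^ 2 / η₀ + 8 * η₀ * (Clam ^ 2 * K ^ 2 + K * m₂))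
      * (δ * d ^ 2 * N) ^ 2 * ((2 + Real.log 𝒯) / √(𝒯 : ℝ)) := by
    rw [ht₃, div_pow, mul_pow, mul_pow, mul_pow, Real.sq_rpow_one_fourth hT0.le,
      Real.sq_sqrt (by positivity), Real.sq_sqrt hlog, Real.rpow_add hd0, Real.rpow_two]
    ring
  have p₁ : 0 ≤ t₁ := by positivity
  have p₂ : 0 ≤ t₂ := by positivity
  have p₃ : 0 ≤ t₃ := by positivity
  refine le_trans ?_ (sq_add_sq_add_sq_le_sq_add p₁ p₂ p₃)
  rw [e₂, e₃, add_assoc (_ / _)]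
  have hO' := mul_le_mul_of_nonneg_right hO (show 0 ≤ (2 + Real.log 𝒯) / √(𝒯 : ℝ) by positivity)
  refine add_le_add (add_le_add e₁ (le_trans ?_ hS)) (le_trans ?_ hO')
  · gcongr
  · gcongr
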